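/- Let $a>0$ and $x_0\in\mathbb{R}$, let $V(\phi)=2\phi^2(\phi-\tanh a)(\phi-\coth a)$, and consider the Klein--Gordon equation $\phi_{tt}-\phi_{xx}+V'(\phi)=0$ on the real line with its ground state lump $$\phi(x)=\frac{\sinh(2a)}{\cosh(2a)+\cosh(2(x-x_0))}.$$ Let $U(x)=V''(\phi(x))$ and let $H=-\partial_x^2+U(x)$ be the linearization operator about the lump, acting on $L^2(\mathbb{R};\mathbb{C})$ with domain $H^2(\mathbb{R})$. Then: 1. The continuous spectrum of $H$ (the points $\lambda$ of the spectrum for which $H-\lambda$ is injective with dense range) is $[4,\infty)$. The essential spectrum of $H$ (the complement, in the spectrum, of the discrete spectrum, that is, of the isolated points of the spectrum that are eigenvalues of finite multiplicity) is also $[4,\infty)$. 2. $\phi'$ is an eigenfunction of $H$ with eigenvalue $0$ (a zero mode), and it has exactly one node, at $x=x_0$. 3. The spectrum of $H$ is real and has a least element $\lambda_{-1}$, which is negative and belongs to the discrete spectrum. It has a real eigenfunction $\eta_{-1}$ of class $C^2$, with $\eta_{-1},\eta_{-1}'\in L^2(\mathbb{R})$, that has no zeros and is even about $x_0$, i.e.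 $\eta_{-1}(x_0-s)=\eta_{-1}(x_0+s)$ for all $s$. The function $w(t,x)=e^{\sqrt{|\lambda_{-1}|}\,t}\,\eta_{-1}(x)$ solves the linearized equation $w_{tt}-w_{xx}+U(x)w=0$. 4. Consequently the lump is linearly unstable: the linearized equation has a growing mode $e^{\kappa t}\eta(x)$ with $\kappa>0$, $0\ne\eta\in C^2$ and $\eta,\eta'\in L^2(\mathbb{R})$. Moreover the lump is a sphaleron over the false vacuum $0$: it is a static solution ($\phi''=V'(\phi)$), its energy density $\tfrac12\phi'^2+V(\phi)$ is integrable, it is non-constant with $\phi(x)\to0$ as $x\to\pm\infty$, where $0$ is a local but not global minimum of $V$, and it is linearly unstable. -/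

import Mathlib

open MeasureTheory Set Filter Topology
open scoped ContDiff

noncomputable section

namespace Sphaleron

/-! Spectra of unbounded operators -/

section Spectra

variable {E : Type*} [NormedAddCommGroup E] [NormedSpace ℂ E]

/-- The operator `T - z` on the domain of `T`. -/
def shift (T : E →ₗ.[ℂ] E) (z : ℂ) : T.domain →ₗ[ℂ] E :=
  T.toFun - z • T.domain.subtype

/-- The resolvent set: `T - z` is a bijection from the domain of `T` onto `E`
with a bounded inverse `R`. -/
def resolventSet (T : E →ₗ.[ℂ] E) : Set ℂ :=
  {z | ∃ R : E →L[ℂ] E,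
    (∀ y : E, ∃ x : T.domain, (x : E) = R y ∧ shift T z x = y) ∧
    ∀ x : T.domain, R (shift T z x) = x}

/-- The spectrum of an unbounded operator. -/
def spectrum (T : E →ₗ.[ℂ] E) : Set ℂ := (resolventSet T)ᶜ

/-- The continuous spectrum: the points `z` of the spectrum for which `T - z` is injective
with dense range. -/
def continuousSpectrum (T : E →ₗ.[ℂ] E) : Set ℂ :=
  {z | z ∈ spectrum T ∧ Function.Injective (shift T z) ∧ DenseRange (shift T z)}

/-- The discrete spectrum (of a self-adjoint operator): the isolated points of the spectrum that
are eigenvalues of finite multiplicity. -/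
def discreteSpectrum (T : E →ₗ.[ℂ] E) : Set ℂ :=
  {z | z ∈ spectrum T ∧ (∃ ε > 0, spectrum T ∩ Metric.ball z ε ⊆ {z}) ∧
    LinearMap.ker (shift T z) ≠ ⊥ ∧ FiniteDimensional ℂ (LinearMap.ker (shift T z))}

/-- The essential spectrum (of a self-adjoint operator): the complement of the discrete spectrum
in the spectrum. -/
def essentialSpectrum (T : E →ₗ.[ℂ] E) : Set ℂ := spectrum T \ discreteSpectrum T

end Spectra

/-! Schrödinger operators on the line -/

/-- The Hilbert space `L²(ℝ; ℂ)`. -/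
abbrev L2 : Type := Lp ℂ 2 (volume : Measure ℝ)

/-- `g` is the weak derivative of `f`. -/
def IsWeakDeriv (f g : L2) : Prop :=
  ∀ ψ : ℝ → ℝ, ContDiff ℝ ∞ ψ → HasCompactSupport ψ →
    ∫ x, deriv ψ x • f x = - ∫ x, ψ x • g x

theorem integrable_test_smul (f : L2) {ψ : ℝ → ℝ} (h : Continuous ψ) (hc : HasCompactSupport ψ) :
    Integrable (fun x => ψ x • f x) :=
  ((Lp.memLp f).locallyIntegrable (by norm_num)).integrable_smul_left_of_hasCompactSupport h hc

theorem integrable_deriv_test_smul (f : L2) {ψ : ℝ → ℝ} (h : ContDiff ℝ ∞ ψ)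
    (hc : HasCompactSupport ψ) : Integrable (fun x => deriv ψ x • f x) :=
  integrable_test_smul f (h.continuous_deriv (by simp)) hc.deriv

theorem integral_smul_add (f f' : L2) {ψ : ℝ → ℝ} (h : Continuous ψ) (hc : HasCompactSupport ψ) :
    ∫ x, ψ x • (f + f' : L2) x = (∫ x, ψ x • f x) + ∫ x, ψ x • f' x := by
  rw [← integral_add (integrable_test_smul f h hc) (integrable_test_smul f' h hc)]
  refine integral_congr_ae ?_
  filter_upwards [Lp.coeFn_add f f'] with x hx
  rw [hx, Pi.add_apply, smul_add]

theorem integral_smul_const_smul (c : ℂ) (f : L2) (ψ : ℝ → ℝ) :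
    ∫ x, ψ x • (c • f : L2) x = c * ∫ x, ψ x • f x := by
  rw [← integral_const_mul]
  refine integral_congr_ae ?_
  filter_upwards [Lp.coeFn_smul c f] with x hx
  rw [hx, Pi.smul_apply, smul_comm, smul_eq_mul]

theorem IsWeakDeriv.add {f g f' g' : L2} (h : IsWeakDeriv f g) (h' : IsWeakDeriv f' g') :
    IsWeakDeriv (f + f') (g + g') := by
  intro ψ hψ hc
  rw [integral_smul_add f f' (hψ.continuous_deriv (by simp)) hc.deriv,
    integral_smul_add g g' hψ.continuous hc, h ψ hψ hc, h' ψ hψ hc]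
  ring

theorem IsWeakDeriv.const_smul (c : ℂ) {f g : L2} (h : IsWeakDeriv f g) :
    IsWeakDeriv (c • f) (c • g) := by
  intro ψ hψ hc
  rw [integral_smul_const_smul, integral_smul_const_smul, h ψ hψ hc]
  ring

theorem isWeakDeriv_zero : IsWeakDeriv 0 0 := by
  intro ψ _ _
  simp

theorem IsWeakDeriv.eq_zero {g : L2} (h : IsWeakDeriv 0 g) : g = 0 := by
  have key : ∀ᵐ x, g x = 0 := by
    refine ae_eq_zero_of_integral_contDiff_smul_eq_zero
      ((Lp.memLp g).locallyIntegrable (by norm_num)) ?_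
    intro ψ hψ hc
    have := h ψ hψ hc
    rw [integral_eq_zero_of_ae] at this
    · simpa using this
    · exact Eventually.of_forall fun x => by simp
  rw [Lp.eq_zero_iff_ae_eq_zero]
  exact key

/-- The graph of `-∂ₓ² + U` on `L²(ℝ; ℂ)`: the pairs `(f, k)` for which `f` has weak derivatives
`f' = g` and `f'' = h` in `L²` (that is, `f ∈ H²(ℝ)`) and `k = -f'' + U f` lies in `L²`. -/
def schrodingerGraph (U : ℝ → ℝ) : Submodule ℂ (L2 × L2) where
  carrier := {p | ∃ g h : L2, IsWeakDeriv p.1 g ∧ IsWeakDeriv g h ∧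
    ∀ᵐ x, p.2 x = - h x + (U x : ℂ) * p.1 x}
  zero_mem' := by
    refine ⟨0, 0, isWeakDeriv_zero, isWeakDeriv_zero, ?_⟩
    exact Eventually.of_forall fun x => by simp
  add_mem' := by
    rintro p q ⟨g, h, hg, hh, hp⟩ ⟨g', h', hg', hh', hq⟩
    refine ⟨g + g', h + h', hg.add hg', hh.add hh', ?_⟩
    filter_upwards [hp, hq, Lp.coeFn_add p.1 q.1, Lp.coeFn_add p.2 q.2, Lp.coeFn_add h h']
      with x h1 h2 h3 h4 h5
    rw [Prod.snd_add, Prod.fst_add, h3, h4, h5]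
    simp only [Pi.add_apply, h1, h2]
    ring
  smul_mem' := by
    rintro c p ⟨g, h, hg, hh, hp⟩
    refine ⟨c • g, c • h, hg.const_smul c, hh.const_smul c, ?_⟩
    filter_upwards [hp, Lp.coeFn_smul c p.1, Lp.coeFn_smul c p.2, Lp.coeFn_smul c h]
      with x h1 h3 h4 h5
    rw [Prod.smul_snd, Prod.smul_fst, h3, h4, h5]
    simp only [Pi.smul_apply, smul_eq_mul, h1]
    ring

theorem schrodingerGraph_single_valued (U : ℝ → ℝ) :
    ∀ p ∈ schrodingerGraph U, p.1 = 0 → p.2 = 0 := by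
  rintro p ⟨g, h, hg, hh, hp⟩ h1
  rw [h1] at hg
  have e1 : g = 0 := hg.eq_zero
  rw [e1] at hh
  have e2 : h = 0 := hh.eq_zero
  rw [Lp.eq_zero_iff_ae_eq_zero]
  have h0 := Lp.coeFn_zero ℂ 2 (volume : Measure ℝ)
  filter_upwards [hp, h0] with x hx hx0
  rw [hx, h1, e2, hx0]
  simp

/-- The Schrödinger operator `-∂ₓ² + U` on `L²(ℝ; ℂ)`, with domain
`{f ∈ H²(ℝ) | U f ∈ L²}`, which is `H²(ℝ)` when `U` is bounded and measurable. -/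
def schrodinger (U : ℝ → ℝ) : L2 →ₗ.[ℂ] L2 := (schrodingerGraph U).toLinearPMap

theorem schrodinger_graph (U : ℝ → ℝ) : (schrodinger U).graph = schrodingerGraph U :=
  Submodule.toLinearPMap_graph_eq _ (schrodingerGraph_single_valued U)

/-- The real function `η` represents an eigenfunction of `T` with eigenvalue `μ`. -/
def IsEigenfunction (T : L2 →ₗ.[ℂ] L2) (μ : ℝ) (η : ℝ → ℝ) : Prop :=
  ∃ f : T.domain, (f : L2) ≠ 0 ∧ (∀ᵐ x, (f : L2) x = (η x : ℂ)) ∧ T f = (μ : ℂ) • (f : L2)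

/-! Klein–Gordon models `φ_tt - φ_xx + V'(φ) = 0` -/

/-- The potential `U(x) = V''(φ(x))` of the linearization about a static solution `φ`. -/
def perturbationPotential (V φ : ℝ → ℝ) (x : ℝ) : ℝ := deriv (deriv V) (φ x)

/-- `φ` is a static solution: `φ'' = V'(φ)`. -/
def IsStaticSolution (V φ : ℝ → ℝ) : Prop :=
  ContDiff ℝ 2 φ ∧ ∀ x, deriv (deriv φ) x = deriv V (φ x)

/-- The energy `∫ (φ'² / 2 + V(φ)) dx` of a static field is finite. -/
def HasFiniteEnergy (V φ : ℝ → ℝ) : Prop :=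
  Integrable (fun x => (1 / 2) * deriv φ x ^ 2 + V (φ x))

/-- A false vacuum: a local minimum of `V` that is not a global minimum. -/
def IsFalseVacuum (V : ℝ → ℝ) (c : ℝ) : Prop := IsLocalMin V c ∧ ∃ d, V d < V c

/-- A localized profile: a non-constant field that tends to `c` at both ends of the line. -/
def IsLocalized (φ : ℝ → ℝ) (c : ℝ) : Prop :=
  (∃ x, φ x ≠ c) ∧ Tendsto φ atBot (𝓝 c) ∧ Tendsto φ atTop (𝓝 c)

/-- `w(t, x) = exp(κ t) η(x)`, with `κ > 0` and `η ≠ 0` of class `C²` with `η, η' ∈ L²`,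
solves the linearized equation `w_tt - w_xx + V''(φ) w = 0`. -/
def IsGrowingMode (V φ : ℝ → ℝ) (κ : ℝ) (η : ℝ → ℝ) : Prop :=
  0 < κ ∧ η ≠ 0 ∧ ContDiff ℝ 2 η ∧ MemLp η 2 ∧ MemLp (deriv η) 2 ∧
  ∀ t x : ℝ,
    deriv (deriv (fun s => Real.exp (κ * s) * η x)) t
      - deriv (deriv (fun y => Real.exp (κ * t) * η y)) x
      + perturbationPotential V φ x * (Real.exp (κ * t) * η x) = 0

/-- Linear instability: an exponentially growing mode exists. -/
def IsLinearlyUnstable (V φ : ℝ → ℝ) : Prop := ∃ κ η, IsGrowingMode V φ κ η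

/-- A sphaleron: a static solution of finite energy with a profile localized over a false vacuum
`c`, which is linearly unstable. -/
structure IsSphaleron (V φ : ℝ → ℝ) (c : ℝ) : Prop where
  static : IsStaticSolution V φ
  falseVacuum : IsFalseVacuum V c
  localized : IsLocalized φ c
  finiteEnergy : HasFiniteEnergy V φ
  unstable : IsLinearlyUnstable V φ

/-- The quartic potential `V(φ) = 2 φ² (φ - tanh a) (φ - coth a)`. -/
def quarticPotential (a u : ℝ) : ℝ :=
  2 * u ^ 2 * (u - Real.tanh a) * (u - Real.cosh a / Real.sinh a)

/-- The ground state lump `φ(x) = sinh 2a / (cosh 2a + cosh 2(x - x₀))`. -/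
def lump (a x₀ x : ℝ) : ℝ :=
  Real.sinh (2 * a) / (Real.cosh (2 * a) + Real.cosh (2 * (x - x₀)))

/-- The linearization operator `-∂ₓ² + V''(φ(x))` about the lump. -/
def lumpOperator (a x₀ : ℝ) : L2 →ₗ.[ℂ] L2 :=
  schrodinger (perturbationPotential (quarticPotential a) (lump a x₀))

end Sphaleron

end

noncomputable section

namespace Sphaleron

/-! ### Weak derivatives on the line -/

/-! The potential of the linearization is 4 + W with W = 24 φ (φ − coth 2a). Since 0 < φ ≤ coth 2a,
the well W is nonpositive; it is continuous and bounded by a multiple of e^{-|x|}. The spectral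
statements are proved for wells of this kind, starting from the explicit inverse R₀ of −∂² + k², Re
k > 0, which is convolution with e^{-k|x|}/(2k).

Off [4, ∞) write z = 4 − k². Then H − z = (1 + W R₀)(−∂² + k²), and W R₀ is compact
(`isCompactOperator_mulL_freeResolvent`), so z is an eigenvalue or a resolvent point
(`mem_resolventSet_of_not_isEigenvalue`). The same compactness makes these eigenvalues isolated and
of finite multiplicity. On [4, ∞), spread-out plane waves are approximate eigenvectors
(`mem_spectrum_of_four_le`), an energy estimate excludes eigenvalues
(`not_isEigenvalue_of_four_le`), and symmetry then gives dense range (`denseRange_shift`). Hence the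
continuous and the essential spectrum are both [4, ∞).

Differentiating φ'' = V'(φ) shows that φ' is a zero mode, and its explicit form shows its single
node. For the ground state (`exists_ground_state`), take the resolvent R of H at a point μ far below
the spectrum. It is self-adjoint, so its norm is attained on its spectrum, and the lowest spectral
point of H is l = μ + 1/‖R‖. Because W ≤ 0, the Neumann series of R preserves positivity, so the
absolute value of a lowest eigenvector is again one. A nonnegative nonzero solution of the second
order equation has no zeros (`exists_positive_solution`). Were l = 0, this would apply to |φ'|,
which vanishes at x₀; hence l < 0. Adding the reflection about x₀ makes the eigenfunction even, and
e^{√(−l) t} η is the growing mode (`exists_lump_ground_state`). -/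

/-- Integration by parts of a compactly supported `C¹` function against a primitive `G` of a
locally integrable function. -/
theorem integral_deriv_mul_primitive {ψ g G : ℝ → ℂ} (hψ : ContDiff ℝ 1 ψ)
    (hc : HasCompactSupport ψ) (hg : LocallyIntegrable g)
    (hG : ∀ x y, G y - G x = ∫ t in x..y, g t) :
    ∫ x, deriv ψ x * G x = - ∫ x, ψ x * g x := by
  obtain ⟨R, hR⟩ : ∃ R : ℝ, ∀ x, x ∉ Ioc (-R) R → ψ x = 0 ∧ deriv ψ x = 0 := by
    obtain ⟨R, hR⟩ := hc.isCompact.isBounded.subset_closedBall 0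
    refine ⟨R + 1, fun x hx => ?_⟩
    have hx' : x ∉ tsupport ψ := fun h => hx (by
      have := hR h
      rw [mem_closedBall_zero_iff, Real.norm_eq_abs, abs_le] at this
      constructor <;> linarith [this.1, this.2])
    exact ⟨image_eq_zero_of_notMem_tsupport hx',
      image_eq_zero_of_notMem_tsupport fun h => hx' (tsupport_deriv_subset h)⟩
  have hcd := hψ.continuous_deriv le_rfl
  have hgi : IntegrableOn g (Ioc (-R) R) :=
    (hg.integrableOn_isCompact isCompact_Icc).mono_set Ioc_subset_Icc_self
  set g' : ℝ → ℂ := (Ioc (-R) R).indicator g with hg'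
  have hg'i : Integrable g' := hgi.integrable_indicator measurableSet_Ioc
  have hdi : Integrable (deriv ψ) := hcd.integrable_of_hasCompactSupport hc.deriv
  -- The double integral of ψ'(x) g(t) over t < x is computed in both orders. As g is only locally
  -- integrable, G need not be differentiable everywhere.
  have hF : Integrable (Function.uncurry fun x t => if t < x then deriv ψ x * g' t else 0)
      (volume.prod volume) := by
    have := (hdi.mul_prod hg'i).indicator (s := {p : ℝ × ℝ | p.2 < p.1})
      (measurableSet_lt measurable_snd measurable_fst)
    refine this.congr (Eventually.of_forall fun p => ?_)
    simp [Function.uncurry, indicator]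
  have swap := integral_integral_swap hF
  have e1 : ∀ x, (∫ t, if t < x then deriv ψ x * g' t else 0)
      = deriv ψ x * G x - deriv ψ x * G (-R) := by
    intro x
    by_cases hx : x ∈ Ioc (-R) R
    · have : ∀ t, (if t < x then deriv ψ x * g' t else 0)
          = (Ioo (-R) x).indicator (fun t => deriv ψ x * g t) t := by
        intro t
        simp only [hg', indicator, mem_Ioc, mem_Ioo]
        by_cases h : t < x
        · simp [h, h.le.trans hx.2]
        · simp [h]
      simp_rw [this]
      rw [integral_indicator measurableSet_Ioo, integral_const_mul, ← integral_Ioc_eq_integral_Ioo,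
        ← intervalIntegral.integral_of_le hx.1.le, ← hG]
      ring
    · simp [(hR x hx).2]
  have e2 : ∀ t, (∫ x, if t < x then deriv ψ x * g' t else 0) = - (ψ t * g t) := by
    intro t
    have : ∀ x, (if t < x then deriv ψ x * g' t else 0)
        = (Ioi t).indicator (fun x => deriv ψ x * g' t) x := by
      intro x; simp [indicator]
    simp_rw [this]
    rw [integral_indicator measurableSet_Ioi, integral_mul_const,
      hc.integral_Ioi_deriv_eq hψ]
    by_cases ht : t ∈ Ioc (-R) R
    · simp [hg', ht]
    · simp [(hR t ht).1]
  have hi0 : ∫ x, deriv ψ x = 0 := by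
    rw [integral_eq_zero_of_hasDerivAt_of_integrable
      (fun x => (hψ.differentiable (by simp) x).hasDerivAt) hdi
      (hψ.continuous.integrable_of_hasCompactSupport hc)]
  have hGc : Continuous G := by
    have : G = fun y => G 0 + ∫ t in (0 : ℝ)..y, g t := by
      ext y; rw [← hG]; ring
    rw [this]
    exact continuous_const.add (intervalIntegral.continuous_primitive
      (fun a b => (hg.integrableOn_isCompact isCompact_uIcc).intervalIntegrable) 0)
  have hi1 : Integrable fun x => deriv ψ x * G x :=
    (hcd.mul hGc).integrable_of_hasCompactSupport hc.deriv.mul_right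
  simp_rw [e1, e2] at swap
  rw [integral_sub hi1 (hdi.mul_const _), integral_mul_const, hi0, zero_mul, sub_zero,
    integral_neg] at swap
  exact swap

theorem continuous_of_primitive {g G : ℝ → ℂ} (hg : LocallyIntegrable g)
    (hG : ∀ x y, G y - G x = ∫ t in x..y, g t) : Continuous G := by
  have : G = fun y => G 0 + ∫ t in (0 : ℝ)..y, g t := by
    ext y; rw [← hG]; ring
  rw [this]
  exact continuous_const.add (intervalIntegral.continuous_primitive
    (fun a b => (hg.integrableOn_isCompact isCompact_uIcc).intervalIntegrable) 0)

theorem L2_locallyIntegrable (f : L2) : LocallyIntegrable f :=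
  (Lp.memLp f).locallyIntegrable (by norm_num)

theorem HasCompactSupport_ofReal {ψ : ℝ → ℝ} (h : HasCompactSupport ψ) :
    HasCompactSupport fun x => (ψ x : ℂ) := h.comp_left (g := fun r : ℝ => (r : ℂ)) (by simp)

theorem deriv_ofReal_comp {ψ : ℝ → ℝ} (h : Differentiable ℝ ψ) (x : ℝ) :
    deriv (fun x => (ψ x : ℂ)) x = ((deriv ψ x : ℝ) : ℂ) :=
  ((h x).hasDerivAt.ofReal_comp).deriv

/-- A primitive in `L²` of a function in `L²` has it as its weak derivative. -/
theorem isWeakDeriv_of_primitive {f g : L2} {F : ℝ → ℂ} (hf : f =ᵐ[volume] F)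
    (hF : ∀ x y, F y - F x = ∫ t in x..y, g t) : IsWeakDeriv f g := by
  intro ψ hψ hc
  have hψ' : ContDiff ℝ 1 fun x => (ψ x : ℂ) :=
    Complex.ofRealCLM.contDiff.comp (hψ.of_le (by simp))
  have := integral_deriv_mul_primitive hψ' (HasCompactSupport_ofReal hc)
    (L2_locallyIntegrable g) hF
  simp_rw [deriv_ofReal_comp (hψ.differentiable (by simp))] at this
  simp_rw [Complex.real_smul]
  rw [← this]
  refine integral_congr_ae ?_
  filter_upwards [hf] with x hx
  rw [hx]

/-- A locally integrable function with zero weak derivative is constant. -/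
theorem ae_eq_const_of_weakDeriv_zero {h : ℝ → ℂ} (hh : LocallyIntegrable h)
    (h0 : ∀ ψ : ℝ → ℝ, ContDiff ℝ ∞ ψ → HasCompactSupport ψ → ∫ x, deriv ψ x • h x = 0) :
    ∃ c : ℂ, ∀ᵐ x, h x = c := by
  let b : ContDiffBump (0 : ℝ) := ⟨1, 2, by norm_num, by norm_num⟩
  set ρ : ℝ → ℝ := b.normed volume with hρ
  have hρs : ContDiff ℝ ∞ ρ := b.contDiff_normed
  have hρc : HasCompactSupport ρ := b.hasCompactSupport_normed
  have hρi : ∫ x, ρ x = 1 := b.integral_normed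
  set c := ∫ x, ρ x • h x with hcdef
  refine ⟨c, ?_⟩
  suffices ∀ᵐ x, h x - c = 0 by
    filter_upwards [this] with x hx
    exact sub_eq_zero.mp hx
  refine ae_eq_zero_of_integral_contDiff_smul_eq_zero
    (hh.sub (locallyIntegrable_const c)) fun θ hθ hθc => ?_
  have hiθ := hθ.continuous.integrable_of_hasCompactSupport hθc (μ := volume)
  have hiρ := hρs.continuous.integrable_of_hasCompactSupport hρc (μ := volume)
  set I := ∫ x, θ x with hI
  -- Subtracting I ρ makes the integral zero, so the primitive of q has compact support and is
  -- itself an admissible test function.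
  set q : ℝ → ℝ := fun x => θ x - I * ρ x with hq
  have hqs : ContDiff ℝ ∞ q := hθ.sub (contDiff_const.mul hρs)
  have hqc : HasCompactSupport q := hθc.sub hρc.mul_left
  have hqi : Integrable q := hiθ.sub (hiρ.const_mul I)
  have hq0 : ∫ x, q x = 0 := by
    rw [integral_sub hiθ (hiρ.const_mul I), integral_const_mul, hρi]; simp [hI]
  set ψ : ℝ → ℝ := fun x => ∫ t in Iic x, q t with hψdef
  have hψ0 : ∀ x, ψ x = ψ 0 + ∫ t in (0 : ℝ)..x, q t := by
    intro x
    rw [← intervalIntegral.integral_Iic_sub_Iic hqi.integrableOn hqi.integrableOn]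
    simp [hψdef]
  have hderiv : ∀ x, HasDerivAt ψ (q x) x := by
    intro x
    have := (intervalIntegral.integral_hasDerivAt_right (hqi.intervalIntegrable (a := 0) (b := x))
      (hqs.continuous.stronglyMeasurableAtFilter _ _) hqs.continuous.continuousAt).const_add (ψ 0)
    refine this.congr_of_eventuallyEq (Eventually.of_forall hψ0)
  have hdψ : deriv ψ = q := funext fun x => (hderiv x).deriv
  have hψs : ContDiff ℝ ∞ ψ :=
    contDiff_infty_iff_deriv.2 ⟨fun x => (hderiv x).differentiableAt, hdψ ▸ hqs⟩
  have hψc : HasCompactSupport ψ := by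
    obtain ⟨R, hR⟩ := hqc.isCompact.isBounded.subset_closedBall 0
    refine HasCompactSupport.intro (isCompact_Icc (a := -R) (b := R)) fun x hx => ?_
    have hz : ∀ t, t ∉ Icc (-R) R → q t = 0 := fun t ht =>
      image_eq_zero_of_notMem_tsupport fun h => ht (by
        have := hR h
        rwa [mem_closedBall_zero_iff, Real.norm_eq_abs, abs_le] at this)
    rcases lt_or_ge x (-R) with h | h
    · refine setIntegral_eq_zero_of_forall_eq_zero fun t ht => hz t fun h' => ?_
      linarith [h'.1, mem_Iic.1 ht]
    · have hx' : R < x := by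
        by_contra h'
        exact hx ⟨h, not_lt.1 h'⟩
      have := integral_add_compl (measurableSet_Iic (a := x)) hqi
      rw [hq0, setIntegral_eq_zero_of_forall_eq_zero (t := (Iic x)ᶜ), add_zero] at this
      · exact this
      · intro t ht
        refine hz t fun h' => ?_
        simp only [mem_compl_iff, mem_Iic, not_le] at ht
        linarith [h'.2]
  have key := h0 ψ hψs hψc
  rw [hdψ] at key
  have i1 : Integrable fun x => θ x • h x :=
    hh.integrable_smul_left_of_hasCompactSupport hθ.continuous hθc
  have i2 : Integrable fun x => ρ x • h x :=
    hh.integrable_smul_left_of_hasCompactSupport hρs.continuous hρc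
  have e : ∫ x, q x • h x = (∫ x, θ x • h x) - I • c := by
    rw [hcdef, ← integral_smul, ← integral_sub i1 (i2.fun_smul I)]
    refine integral_congr_ae (Eventually.of_forall fun x => ?_)
    simp only [hq, sub_smul, mul_smul]
  simp_rw [smul_sub]
  rw [integral_sub i1 (hiθ.smul_const c), integral_smul_const, ← hI, ← e, key]

/-- A function with a weak derivative has a continuous representative, which is a primitive
of the weak derivative. -/
theorem IsWeakDeriv.exists_primitive {f g : L2} (h : IsWeakDeriv f g) :
    ∃ F : ℝ → ℂ, f =ᵐ[volume] F ∧ Continuous F ∧ ∀ x y, F y - F x = ∫ t in x..y, g t := by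
  have hgl := L2_locallyIntegrable g
  have hint : ∀ a b, IntervalIntegrable g volume a b :=
    fun a b => (hgl.integrableOn_isCompact isCompact_uIcc).intervalIntegrable
  set G : ℝ → ℂ := fun y => ∫ t in (0 : ℝ)..y, g t with hGdef
  have hG : ∀ x y, G y - G x = ∫ t in x..y, g t := fun x y =>
    intervalIntegral.integral_interval_sub_left (hint _ _) (hint _ _)
  have hGc : Continuous G := continuous_of_primitive hgl hG
  have hfl := L2_locallyIntegrable f
  obtain ⟨c, hc⟩ := ae_eq_const_of_weakDeriv_zero (hfl.sub hGc.locallyIntegrable) (by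
    intro ψ hψ hψc
    have hψ' : ContDiff ℝ 1 fun x => (ψ x : ℂ) :=
      Complex.ofRealCLM.contDiff.comp (hψ.of_le (by simp))
    have e := integral_deriv_mul_primitive hψ' (HasCompactSupport_ofReal hψc) hgl hG
    simp_rw [deriv_ofReal_comp (hψ.differentiable (by simp)), ← Complex.real_smul] at e
    have hcd : Continuous (deriv ψ) := hψ.continuous_deriv (by simp)
    simp only [Pi.sub_apply, smul_sub]
    rw [integral_sub (hfl.integrable_smul_left_of_hasCompactSupport hcd hψc.deriv)
      (hGc.locallyIntegrable.integrable_smul_left_of_hasCompactSupport hcd hψc.deriv), e,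
      h ψ hψ hψc, sub_self])
  refine ⟨fun x => G x + c, ?_, hGc.add continuous_const, fun x y => ?_⟩
  · filter_upwards [hc] with x hx
    rw [← hx]; simp
  · rw [← hG]; ring

theorem IsWeakDeriv.sub {f g f' g' : L2} (h : IsWeakDeriv f g) (h' : IsWeakDeriv f' g') :
    IsWeakDeriv (f - f') (g - g') := by
  have := h.add (h'.const_smul (-1))
  simpa [sub_eq_add_neg] using this

/-! ### Convolution operators on `L²` -/

/-- Cauchy–Schwarz for the factors √a and √a · b. -/
theorem lintegral_mul_sq_le {α : Type*} [MeasurableSpace α] (μ : Measure α) {a b : α → ENNReal}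
    (ha : AEMeasurable a μ) (hb : AEMeasurable b μ) :
    (∫⁻ x, a x * b x ∂μ) ^ 2 ≤ (∫⁻ x, a x ∂μ) * ∫⁻ x, a x * b x ^ 2 ∂μ := by
  have h2 : (2 : ℝ).HolderConjugate 2 := Real.HolderConjugate.two_two
  have h := ENNReal.lintegral_mul_le_Lp_mul_Lq μ h2 (ha.pow_const (1 / 2 : ℝ))
    ((ha.pow_const (1 / 2 : ℝ)).mul hb)
  have e : ∀ x, a x ^ (1 / 2 : ℝ) * a x ^ (1 / 2 : ℝ) = a x := fun x => by
    rw [← ENNReal.rpow_add_of_nonneg _ _ (by norm_num) (by norm_num)]; norm_num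
  have e1 : ∀ x, ((fun x => a x ^ (1 / 2 : ℝ)) * ((fun x => a x ^ (1 / 2 : ℝ)) * b)) x
      = a x * b x := fun x => by
    simp only [Pi.mul_apply]; rw [← mul_assoc, e]
  have e2 : ∀ x, (a x ^ (1 / 2 : ℝ)) ^ (2 : ℝ) = a x := fun x => by
    rw [← ENNReal.rpow_mul]; norm_num
  have e3 : ∀ x, ((fun x => a x ^ (1 / 2 : ℝ)) * b) x ^ (2 : ℝ) = a x * b x ^ 2 := fun x => by
    simp only [Pi.mul_apply]
    rw [ENNReal.mul_rpow_of_nonneg _ _ (by norm_num), e2, ENNReal.rpow_two]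
  simp_rw [e1, e2, e3] at h
  calc _ ≤ ((∫⁻ x, a x ∂μ) ^ (1 / 2 : ℝ) * (∫⁻ x, a x * b x ^ 2 ∂μ) ^ (1 / 2 : ℝ)) ^ 2 := by
        gcongr
    _ = _ := by
        rw [mul_pow, ← ENNReal.rpow_two, ← ENNReal.rpow_two, ← ENNReal.rpow_mul,
          ← ENNReal.rpow_mul]
        norm_num

/-- The convolution of a kernel with a function in `L²`. -/
def conv (K : ℝ → ℂ) (f : L2) (x : ℝ) : ℂ := ∫ y, K (x - y) * f y

section Convolution

variable {K : ℝ → ℂ}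

theorem memLp_comp_sub_left (h : MemLp K 2) (x : ℝ) : MemLp (fun y => K (x - y)) 2 :=
  h.comp_measurePreserving (Measure.measurePreserving_sub_left volume x)

theorem integrable_conv (h : MemLp K 2) (f : L2) (x : ℝ) :
    Integrable fun y => K (x - y) * f y :=
  (memLp_comp_sub_left h x).integrable_mul (Lp.memLp f)

theorem conv_add (h : MemLp K 2) (f g : L2) (x : ℝ) :
    conv K (f + g) x = conv K f x + conv K g x := by
  rw [conv, conv, conv, ← integral_add (integrable_conv h f x) (integrable_conv h g x)]
  refine integral_congr_ae ?_
  filter_upwards [Lp.coeFn_add f g] with y hy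
  rw [hy, Pi.add_apply, mul_add]

theorem conv_smul (c : ℂ) (f : L2) (x : ℝ) : conv K (c • f) x = c * conv K f x := by
  rw [conv, conv, ← integral_const_mul]
  refine integral_congr_ae ?_
  filter_upwards [Lp.coeFn_smul c f] with y hy
  rw [hy, Pi.smul_apply, smul_eq_mul]
  ring

/-- The value of a convolution at a point as an inner product. -/
theorem conv_eq_inner (h : MemLp K 2) (f : L2) (x : ℝ) :
    conv K f x = inner ℂ ((memLp_comp_sub_left h x).star.toLp _) f := by
  rw [L2.inner_def, conv]
  refine integral_congr_ae ?_
  filter_upwards [MemLp.coeFn_toLp (memLp_comp_sub_left h x).star] with y hy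
  rw [hy]
  simp [mul_comm]

theorem norm_conv_le (h : MemLp K 2) (f : L2) (x : ℝ) :
    ‖conv K f x‖ ≤ (eLpNorm K 2 volume).toReal * ‖f‖ := by
  rw [conv_eq_inner h]
  refine (norm_inner_le_norm _ _).trans (le_of_eq ?_)
  rw [Lp.norm_toLp, eLpNorm_star]
  congr 2
  exact eLpNorm_comp_measurePreserving h.1 (Measure.measurePreserving_sub_left volume x)

theorem aestronglyMeasurable_conv_integrand (h1 : Integrable K) (f : L2) :
    AEStronglyMeasurable (fun p : ℝ × ℝ => K (p.1 - p.2) * f p.2) (volume.prod volume) :=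
  (h1.1.comp_quasiMeasurePreserving
    (quasiMeasurePreserving_sub_of_right_invariant volume volume)).mul (Lp.memLp f).1.comp_snd

theorem aestronglyMeasurable_conv (h1 : Integrable K) (f : L2) :
    AEStronglyMeasurable (conv K f) :=
  (aestronglyMeasurable_conv_integrand h1 f).integral_prod_right'

/-- Schur test: Cauchy–Schwarz in y with weight |K(x − y)|, then Tonelli. Each of the two
integrations of the kernel contributes one factor ‖K‖₁. -/
theorem lintegral_conv_sq_le (h1 : Integrable K) (f : L2) :
    ∫⁻ x, (∫⁻ y, ‖K (x - y)‖ₑ * ‖f y‖ₑ) ^ 2 ≤ (∫⁻ s, ‖K s‖ₑ) ^ 2 * ∫⁻ y, ‖f y‖ₑ ^ 2 := by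
  have hf := (Lp.memLp f).1
  have hK : ∀ x : ℝ, AEMeasurable (fun y => ‖K (x - y)‖ₑ) := fun x =>
    (h1.1.comp_measurePreserving (Measure.measurePreserving_sub_left volume x)).enorm
  have hm : AEMeasurable (Function.uncurry fun x y => ‖K (x - y)‖ₑ * ‖f y‖ₑ ^ 2)
      (volume.prod volume) :=
    (h1.1.comp_quasiMeasurePreserving
      (quasiMeasurePreserving_sub_of_right_invariant volume volume)).enorm.mul
      (hf.comp_snd.enorm.pow_const 2)
  calc ∫⁻ x, (∫⁻ y, ‖K (x - y)‖ₑ * ‖f y‖ₑ) ^ 2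
      ≤ ∫⁻ x, (∫⁻ s, ‖K s‖ₑ) * ∫⁻ y, ‖K (x - y)‖ₑ * ‖f y‖ₑ ^ 2 := by
        refine lintegral_mono fun x => (lintegral_mul_sq_le volume (hK x) hf.enorm).trans ?_
        rw [lintegral_sub_left_eq_self (fun s => ‖K s‖ₑ) x]
    _ = (∫⁻ s, ‖K s‖ₑ) * ∫⁻ y, ∫⁻ x, ‖K (x - y)‖ₑ * ‖f y‖ₑ ^ 2 := by
        have hm' : AEMeasurable fun x => ∫⁻ y, ‖K (x - y)‖ₑ * ‖f y‖ₑ ^ 2 :=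
          hm.lintegral_prod_right'
        rw [← lintegral_lintegral_swap hm, lintegral_const_mul'' _ hm']
    _ = (∫⁻ s, ‖K s‖ₑ) * ∫⁻ y, (∫⁻ s, ‖K s‖ₑ) * ‖f y‖ₑ ^ 2 := by
        congr 1
        refine lintegral_congr fun y => ?_
        have hKy : AEMeasurable fun x => ‖K (x - y)‖ₑ :=
          (h1.1.comp_measurePreserving (measurePreserving_sub_right volume y)).enorm
        rw [lintegral_mul_const'' _ hKy, lintegral_sub_right_eq_self (fun s => ‖K s‖ₑ) y]
    _ = _ := by
        rw [lintegral_const_mul'' _ (hf.enorm.pow_const 2), sq, mul_assoc]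

theorem eLpNorm_two_sq (f : ℝ → ℂ) : eLpNorm f 2 volume ^ 2 = ∫⁻ x, ‖f x‖ₑ ^ 2 := by
  have := eLpNorm_nnreal_pow_eq_lintegral (f := f) (μ := volume) (p := 2) (by norm_num)
  simpa [ENNReal.rpow_two] using this

theorem eLpNorm_conv_le (h1 : Integrable K) (f : L2) :
    eLpNorm (conv K f) 2 volume ≤ (∫⁻ s, ‖K s‖ₑ) * eLpNorm f 2 volume := by
  have h : eLpNorm (conv K f) 2 volume ^ 2 ≤ ((∫⁻ s, ‖K s‖ₑ) * eLpNorm f 2 volume) ^ 2 := by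
    rw [mul_pow, eLpNorm_two_sq, eLpNorm_two_sq]
    refine le_trans (lintegral_mono fun x => ?_) (lintegral_conv_sq_le h1 f)
    gcongr
    refine (enorm_integral_le_lintegral_enorm _).trans (le_of_eq ?_)
    simp_rw [enorm_mul]
  exact (ENNReal.pow_le_pow_left_iff (by norm_num)).1 h

theorem memLp_conv (h1 : Integrable K) (f : L2) : MemLp (conv K f) 2 :=
  ⟨aestronglyMeasurable_conv h1 f, (eLpNorm_conv_le h1 f).trans_lt
    (ENNReal.mul_lt_top h1.2 (Lp.memLp f).2)⟩

/-- Convolution with a kernel in `L¹ ∩ L²`, as a bounded operator on `L²`. -/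
def convL (h1 : Integrable K) (h2 : MemLp K 2) : L2 →L[ℂ] L2 :=
  LinearMap.mkContinuous
    { toFun := fun f => (memLp_conv h1 f).toLp
      map_add' := fun f g => by
        rw [← MemLp.toLp_add]
        exact MemLp.toLp_congr _ _ (Eventually.of_forall fun x => conv_add h2 f g x)
      map_smul' := fun c f => by
        rw [RingHom.id_apply, ← MemLp.toLp_const_smul]
        exact MemLp.toLp_congr _ _ (Eventually.of_forall fun x => conv_smul c f x) }
    (∫ s, ‖K s‖) fun f => by
      rw [LinearMap.coe_mk, AddHom.coe_mk, Lp.norm_toLp, Lp.norm_def,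
        integral_norm_eq_lintegral_enorm h1.1, ← ENNReal.toReal_mul]
      exact ENNReal.toReal_mono (ENNReal.mul_lt_top h1.2 (Lp.memLp f).2).ne (eLpNorm_conv_le h1 f)

theorem convL_ae (h1 : Integrable K) (h2 : MemLp K 2) (f : L2) :
    convL h1 h2 f =ᵐ[volume] conv K f := (memLp_conv h1 f).coeFn_toLp

theorem norm_convL_le (h1 : Integrable K) (h2 : MemLp K 2) :
    ‖convL h1 h2‖ ≤ ∫ s, ‖K s‖ :=
  LinearMap.mkContinuous_norm_le _ (integral_nonneg fun _ => norm_nonneg _) _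

/-- The adjoint of a convolution operator is the convolution with the conjugate reflected
kernel. -/
theorem inner_convL {K' : ℝ → ℂ} (h1 : Integrable K) (h2 : MemLp K 2) (h1' : Integrable K')
    (h2' : MemLp K' 2) (hK : ∀ᵐ s, K' (-s) = star (K s)) (f g : L2) :
    inner ℂ (convL h1 h2 f) g = inner ℂ f (convL h1' h2' g) := by
  -- Cauchy–Schwarz for |g| against |K| ∗ |f|, which is square integrable by the Schur bound. This
  -- is the absolute convergence needed for Fubini.
  have hfin : ∫⁻ x, ‖g x‖ₑ * ∫⁻ y, ‖K (x - y)‖ₑ * ‖f y‖ₑ < ⊤ := by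
    have hg := (Lp.memLp g).1
    have hm : AEMeasurable fun x => ∫⁻ y, ‖K (x - y)‖ₑ * ‖f y‖ₑ := by
      have := (aestronglyMeasurable_conv_integrand h1 f).enorm.lintegral_prod_right'
      simpa [enorm_mul] using this
    have := ENNReal.lintegral_mul_le_Lp_mul_Lq volume Real.HolderConjugate.two_two hg.enorm hm
    refine lt_of_le_of_lt this (ENNReal.mul_lt_top ?_ ?_)
    · refine ENNReal.rpow_lt_top_of_nonneg (by norm_num) (ne_of_lt ?_)
      simp_rw [ENNReal.rpow_two, ← eLpNorm_two_sq]
      exact ENNReal.pow_lt_top (Lp.memLp g).2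
    · refine ENNReal.rpow_lt_top_of_nonneg (by norm_num) (ne_of_lt ?_)
      simp_rw [ENNReal.rpow_two]
      refine (lintegral_conv_sq_le h1 f).trans_lt ?_
      rw [← eLpNorm_two_sq]
      exact ENNReal.mul_lt_top (ENNReal.pow_lt_top h1.2) (ENNReal.pow_lt_top (Lp.memLp f).2)
  have hmeas : AEStronglyMeasurable
      (Function.uncurry fun x y => g x * star (K (x - y) * f y)) (volume.prod volume) :=
    (Lp.memLp g).1.comp_fst.mul (aestronglyMeasurable_conv_integrand h1 f).star
  have hint : Integrable (Function.uncurry fun x y => g x * star (K (x - y) * f y))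
      (volume.prod volume) := by
    refine ⟨hmeas, ?_⟩
    rw [HasFiniteIntegral, lintegral_prod _ hmeas.enorm]
    refine lt_of_le_of_lt (le_of_eq ?_) hfin
    refine lintegral_congr fun x => ?_
    have hKx : AEMeasurable fun y => ‖K (x - y)‖ₑ * ‖f y‖ₑ :=
      (h1.1.comp_measurePreserving
        (Measure.measurePreserving_sub_left volume x)).enorm.mul (Lp.memLp f).1.enorm
    rw [← lintegral_const_mul'' _ hKx]
    refine lintegral_congr fun y => ?_
    simp only [Function.uncurry, enorm_mul, star_mul']
    congr 2 <;> exact RCLike.enorm_conj _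
  have swap := integral_integral_swap hint
  rw [L2.inner_def, L2.inner_def]
  calc ∫ x, inner ℂ (convL h1 h2 f x) (g x) = ∫ x, ∫ y, g x * star (K (x - y) * f y) := by
        refine integral_congr_ae ?_
        filter_upwards [convL_ae h1 h2 f] with x hx
        rw [hx, integral_const_mul]
        simp only [RCLike.inner_apply, conv, ← integral_conj]
        rfl
    _ = ∫ y, ∫ x, g x * star (K (x - y) * f y) := swap
    _ = _ := by
        refine integral_congr_ae ?_
        filter_upwards [convL_ae h1' h2' g] with y hy
        rw [hy]
        simp only [RCLike.inner_apply, conv, ← integral_mul_const]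
        refine integral_congr_ae ?_
        filter_upwards [(measurePreserving_sub_right volume y).quasiMeasurePreserving.ae hK]
          with x hx
        rw [neg_sub] at hx
        rw [hx, star_mul']
        simp
        ring

end Convolution

/-! ### The free resolvent -/

/-- The kernel of the inverse of `∂ + k`. -/
def kerR (k : ℂ) (s : ℝ) : ℂ := (Ici 0).indicator (fun s : ℝ => Complex.exp (-k * s)) s

/-- The kernel of the inverse of `-∂ + k`. -/
def kerL (k : ℂ) (s : ℝ) : ℂ := (Iio 0).indicator (fun s : ℝ => Complex.exp (k * s)) s

theorem integrable_kerR {k : ℂ} (hk : 0 < k.re) : Integrable (kerR k) := by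
  refine IntegrableOn.integrable_indicator ?_ measurableSet_Ici
  rw [integrableOn_Ici_iff_integrableOn_Ioi]
  exact integrableOn_exp_mul_complex_Ioi (by simpa using hk) 0

theorem integrable_kerL {k : ℂ} (hk : 0 < k.re) : Integrable (kerL k) := by
  refine IntegrableOn.integrable_indicator ?_ measurableSet_Iio
  exact (integrableOn_exp_mul_complex_Iic hk 0).mono_set Iio_subset_Iic_self

theorem norm_kerR (k : ℂ) (s : ℝ) :
    ‖kerR k s‖ = (Ici 0).indicator (fun s : ℝ => Real.exp (-k.re * s)) s := by
  rw [kerR, norm_indicator_eq_indicator_norm]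
  simp [Complex.norm_exp]

theorem norm_kerL (k : ℂ) (s : ℝ) :
    ‖kerL k s‖ = (Iio 0).indicator (fun s : ℝ => Real.exp (k.re * s)) s := by
  rw [kerL, norm_indicator_eq_indicator_norm]
  simp [Complex.norm_exp]

theorem integral_norm_kerR {k : ℂ} (hk : 0 < k.re) : ∫ s, ‖kerR k s‖ = 1 / k.re := by
  simp_rw [norm_kerR]
  rw [integral_indicator measurableSet_Ici, integral_Ici_eq_integral_Ioi,
    integral_exp_mul_Ioi (by linarith)]
  simp

theorem integral_norm_kerL {k : ℂ} (hk : 0 < k.re) : ∫ s, ‖kerL k s‖ = 1 / k.re := by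
  simp_rw [norm_kerL]
  rw [integral_indicator measurableSet_Iio, ← integral_Iic_eq_integral_Iio,
    integral_exp_mul_Iic hk]
  simp

theorem memLp_two_of_integrable_of_norm_le_one {K : ℝ → ℂ} (h : Integrable K)
    (hb : ∀ s, ‖K s‖ ≤ 1) : MemLp K 2 := by
  rw [memLp_two_iff_integrable_sq_norm h.1]
  refine h.norm.mono (h.1.norm.pow 2) (Eventually.of_forall fun s => ?_)
  simp only [norm_pow, norm_norm]
  nlinarith [hb s, norm_nonneg (K s)]

theorem memLp_kerR {k : ℂ} (hk : 0 < k.re) : MemLp (kerR k) 2 := by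
  refine memLp_two_of_integrable_of_norm_le_one (integrable_kerR hk) fun s => ?_
  rw [norm_kerR]
  refine indicator_le' (fun s hs => ?_) (fun _ _ => zero_le_one) s
  rw [Real.exp_le_one_iff]
  nlinarith [mem_Ici.1 hs]

theorem memLp_kerL {k : ℂ} (hk : 0 < k.re) : MemLp (kerL k) 2 := by
  refine memLp_two_of_integrable_of_norm_le_one (integrable_kerL hk) fun s => ?_
  rw [norm_kerL]
  refine indicator_le' (fun s hs => ?_) (fun _ _ => zero_le_one) s
  rw [Real.exp_le_one_iff]
  nlinarith [mem_Iio.1 hs]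

/-- The inverse of `∂ + k` on `L²`. -/
def solveR {k : ℂ} (hk : 0 < k.re) : L2 →L[ℂ] L2 := convL (integrable_kerR hk) (memLp_kerR hk)

/-- The inverse of `-∂ + k` on `L²`. -/
def solveL {k : ℂ} (hk : 0 < k.re) : L2 →L[ℂ] L2 := convL (integrable_kerL hk) (memLp_kerL hk)

/-- The inverse of `-∂² + k²` on `L²`. -/
def freeResolvent {k : ℂ} (hk : 0 < k.re) : L2 →L[ℂ] L2 :=
  (2 * k)⁻¹ • (solveR hk + solveL hk)

/-- Variation of constants: testing G, whose weak derivative is e^{-σx} h, with ψ e^{σx} gives the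
equation f' = h + σ f for f = e^{σx} G. -/
theorem isWeakDeriv_exp_mul_primitive {f h : L2} {G : ℝ → ℂ} (σ : ℂ)
    (hf : ∀ᵐ x : ℝ, f x = Complex.exp (σ * x) * G x)
    (hG : ∀ x y : ℝ, G y - G x = ∫ t in x..y, Complex.exp (-σ * t) * h t) :
    IsWeakDeriv f (h + σ • f) := by
  intro ψ hψ hc
  have hexp : ContDiff ℝ 1 fun x : ℝ => Complex.exp (σ * x) :=
    (contDiff_const.mul Complex.ofRealCLM.contDiff).cexp
  have hψ' : ContDiff ℝ 1 fun x => (ψ x : ℂ) :=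
    Complex.ofRealCLM.contDiff.comp (hψ.of_le (by simp))
  have hgl : LocallyIntegrable fun t : ℝ => Complex.exp (-σ * t) * h t := by
    have : Continuous fun t : ℝ => Complex.exp (-σ * t) := by fun_prop
    exact (L2_locallyIntegrable h).continuous_smul this
  have key := integral_deriv_mul_primitive (hψ'.mul hexp)
    ((HasCompactSupport_ofReal hc).mul_right) hgl hG
  have hd : ∀ x : ℝ, deriv (fun x : ℝ => (ψ x : ℂ) * Complex.exp (σ * x)) x
      = (deriv ψ x : ℝ) * Complex.exp (σ * x) + ψ x * (Complex.exp (σ * x) * σ) := by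
    intro x
    have h1 := ((hψ.differentiable (by simp) x).hasDerivAt).ofReal_comp
    have h2 : HasDerivAt (fun x : ℝ => Complex.exp (σ * x)) (Complex.exp (σ * x) * σ) x := by
      have := ((hasDerivAt_id x).ofReal_comp.const_mul σ).cexp
      simpa using this
    exact (h1.mul h2).deriv
  have e1 : ∫ x, deriv (fun x : ℝ => (ψ x : ℂ) * Complex.exp (σ * x)) x * G x
      = ∫ x, (deriv ψ x • f x + σ * (ψ x • f x)) := by
    refine integral_congr_ae ?_
    filter_upwards [hf] with x hx
    rw [hd, hx, Complex.real_smul, Complex.real_smul]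
    ring
  have e2 : ∫ x : ℝ, (ψ x : ℂ) * Complex.exp (σ * x) * (Complex.exp (-σ * x) * h x)
      = ∫ x, ψ x • h x := by
    refine integral_congr_ae (Eventually.of_forall fun x => ?_)
    have : Complex.exp (σ * x) * Complex.exp (-σ * x) = 1 := by
      rw [← Complex.exp_add]; simp
    simp only [Complex.real_smul]
    linear_combination (ψ x : ℂ) * h x * this
  have e3 := e1.symm.trans (key.trans (congrArg Neg.neg e2))
  rw [integral_add (integrable_deriv_test_smul f hψ hc)
    ((integrable_test_smul f hψ.continuous hc).const_mul σ), integral_const_mul] at e3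
  rw [integral_smul_add _ _ hψ.continuous hc, integral_smul_const_smul]
  linear_combination e3

/-- On y ≤ x the kernel factors as e^{-kx} e^{ky}, which puts the convolution into the form of
variation of constants with σ = −k. -/
theorem isWeakDeriv_solveR {k : ℂ} (hk : 0 < k.re) (f : L2) :
    IsWeakDeriv (solveR hk f) (f + (-k) • solveR hk f) := by
  have heq : ∀ x y : ℝ, kerR k (x - y) * f y
      = Complex.exp (-k * x) * (Iic x).indicator (fun y : ℝ => Complex.exp (k * y) * f y) y := by
    intro x y
    by_cases h : y ≤ x
    · rw [kerR, indicator_of_mem (by simpa using h), indicator_of_mem (by simpa using h),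
        ← mul_assoc, ← Complex.exp_add]
      congr 2; push_cast; ring
    · rw [kerR, indicator_of_notMem (by simpa using h), indicator_of_notMem (by simpa using h)]
      simp
  have hi : ∀ x : ℝ, IntegrableOn (fun y : ℝ => Complex.exp (k * y) * f y) (Iic x) := by
    intro x
    have := (integrable_conv (memLp_kerR hk) f x).const_mul (Complex.exp (k * x))
    simp_rw [heq, ← mul_assoc, ← Complex.exp_add] at this
    rw [← integrable_indicator_iff measurableSet_Iic]
    simpa using this
  refine isWeakDeriv_exp_mul_primitive (-k)
    (G := fun x => ∫ y in Iic x, Complex.exp (k * y) * f y) ?_ fun x y => ?_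
  · filter_upwards [convL_ae (integrable_kerR hk) (memLp_kerR hk) f] with x hx
    rw [solveR, hx, conv]
    simp_rw [heq]
    rw [integral_const_mul, integral_indicator measurableSet_Iic]
  · rw [intervalIntegral.integral_Iic_sub_Iic (hi _) (hi _)]
    simp

/-- As for `solveR`, with σ = k. The integral now runs over (x, ∞), so the source changes sign. -/
theorem isWeakDeriv_solveL {k : ℂ} (hk : 0 < k.re) (f : L2) :
    IsWeakDeriv (solveL hk f) (-f + k • solveL hk f) := by
  have heq : ∀ x y : ℝ, kerL k (x - y) * f y
      = Complex.exp (k * x) * (Ioi x).indicator (fun y : ℝ => Complex.exp (-k * y) * f y) y := by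
    intro x y
    by_cases h : x < y
    · rw [kerL, indicator_of_mem (by simpa using h), indicator_of_mem (by simpa using h),
        ← mul_assoc, ← Complex.exp_add]
      congr 2; push_cast; ring
    · rw [kerL, indicator_of_notMem (by simpa using h), indicator_of_notMem (by simpa using h)]
      simp
  have hi : ∀ x : ℝ, IntegrableOn (fun y : ℝ => Complex.exp (-k * y) * f y) (Ioi x) := by
    intro x
    have := (integrable_conv (memLp_kerL hk) f x).const_mul (Complex.exp (-k * x))
    simp_rw [heq, ← mul_assoc, ← Complex.exp_add] at this
    rw [← integrable_indicator_iff measurableSet_Ioi]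
    simpa using this
  have hG : ∀ x y : ℝ, x ≤ y → (∫ t in Ioi y, Complex.exp (-k * t) * f t)
      - (∫ t in Ioi x, Complex.exp (-k * t) * f t)
      = ∫ t in x..y, Complex.exp (-k * t) * (-f : L2) t := by
    intro x y hxy
    rw [← neg_sub, intervalIntegral.integral_Ioi_sub_Ioi (hi x) hxy,
      ← intervalIntegral.integral_neg]
    refine intervalIntegral.integral_congr_ae ?_
    filter_upwards [Lp.coeFn_neg f] with t ht _
    rw [ht, Pi.neg_apply, mul_neg]
  refine isWeakDeriv_exp_mul_primitive k
    (G := fun x => ∫ y in Ioi x, Complex.exp (-k * y) * f y) ?_ fun x y => ?_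
  · filter_upwards [convL_ae (integrable_kerL hk) (memLp_kerL hk) f] with x hx
    rw [solveL, hx, conv]
    simp_rw [heq]
    rw [integral_const_mul, integral_indicator measurableSet_Ioi]
  · rcases le_total x y with h | h
    · exact hG x y h
    · rw [intervalIntegral.integral_symm, ← hG y x h, neg_sub]

/-- The free resolvent solves `-u'' + k² u = f`. -/
theorem freeResolvent_isWeakDeriv {k : ℂ} (hk : 0 < k.re) (f : L2) :
    ∃ g, IsWeakDeriv (freeResolvent hk f) g ∧
      IsWeakDeriv g (k ^ 2 • freeResolvent hk f - f) := by
  have hk0 : k ≠ 0 := fun h => by simp [h] at hk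
  set A := solveR hk f with hA
  set B := solveL hk f with hB
  have dA := isWeakDeriv_solveR hk f
  have dB := isWeakDeriv_solveL hk f
  rw [← hA] at dA
  rw [← hB] at dB
  have e : freeResolvent hk f = (2 * k)⁻¹ • (A + B) := by simp [freeResolvent, hA, hB]
  -- From A' = f − kA and B' = −f + kB one gets (A + B)' = k(B − A) and (B − A)' = k(A + B) − 2f.
  refine ⟨(2 : ℂ)⁻¹ • (B - A), ?_, ?_⟩
  · rw [e]
    convert (dA.add dB).const_smul (2 * k)⁻¹ using 1
    match_scalars <;> field_simp
    ring
  · rw [e]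
    convert (dB.sub dA).const_smul (2 : ℂ)⁻¹ using 1
    match_scalars <;> field_simp
    ring

/-- A function in `L²` with `u' = σ u` vanishes. -/
theorem eq_zero_of_isWeakDeriv_smul {u : L2} {σ : ℂ} (h : IsWeakDeriv u (σ • u)) : u = 0 := by
  obtain ⟨F, hF, hFc, hFi⟩ := h.exists_primitive
  have hd : ∀ x, HasDerivAt F (σ * F x) x := by
    intro x
    have h1 : ∀ y, F y = F x + ∫ t in x..y, σ * F t := by
      intro y
      rw [← sub_eq_iff_eq_add', hFi]
      refine intervalIntegral.integral_congr_ae ?_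
      filter_upwards [hF, Lp.coeFn_smul σ u] with t ht ht' _
      rw [ht', Pi.smul_apply, ht, smul_eq_mul]
    have hc : Continuous fun t => σ * F t := by fun_prop
    exact ((intervalIntegral.integral_hasDerivAt_right (hc.intervalIntegrable x x)
      (hc.stronglyMeasurableAtFilter _ _) hc.continuousAt).const_add (F x)).congr_of_eventuallyEq
      (Eventually.of_forall h1)
  have hexp : ∀ x : ℝ, HasDerivAt (fun x : ℝ => Complex.exp (-σ * x))
      (Complex.exp (-σ * x) * -σ) x := by
    intro x
    have := ((hasDerivAt_id x).ofReal_comp.const_mul (-σ)).cexp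
    simpa using this
  have hconst : ∀ x : ℝ, Complex.exp (-σ * x) * F x = F 0 := by
    intro x
    have := is_const_of_deriv_eq_zero (f := fun x : ℝ => Complex.exp (-σ * x) * F x)
      (fun x => ((hexp x).mul (hd x)).differentiableAt)
      (fun x => by rw [((hexp x).fun_mul (hd x)).deriv]; ring) x 0
    simpa using this
  have hFx : ∀ x : ℝ, F x = Complex.exp (σ * x) * F 0 := by
    intro x
    rw [← hconst x, ← mul_assoc, ← Complex.exp_add]
    simp
  have hint : Integrable fun x => ‖F x‖ ^ 2 :=
    (memLp_two_iff_integrable_sq_norm hFc.aestronglyMeasurable).1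
      ((memLp_congr_ae hF).1 (Lp.memLp u))
  have hle : ∀ x, 0 ≤ σ.re * x → ‖F 0‖ ^ 2 ≤ ‖F x‖ ^ 2 := by
    intro x hx
    have h1 : 1 ≤ ‖Complex.exp (σ * x)‖ := by
      rw [Complex.norm_exp]
      refine Real.one_le_exp ?_
      simpa using hx
    rw [hFx x, norm_mul]
    gcongr
    exact le_mul_of_one_le_left (norm_nonneg _) h1
  have hF0 : F 0 = 0 := by
    -- On one of the half-lines |e^{σx}| ≥ 1, so there ‖F‖ ≥ ‖F 0‖ on a set of infinite measure.
    have hs : ∃ s : Set ℝ, MeasurableSet s ∧ volume s = ⊤ ∧ ∀ x ∈ s, 0 ≤ σ.re * x := by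
      rcases le_total 0 σ.re with h | h
      · exact ⟨Ioi 0, measurableSet_Ioi, by simp, fun x hx => mul_nonneg h (mem_Ioi.1 hx).le⟩
      · exact ⟨Iio 0, measurableSet_Iio, by simp,
          fun x hx => mul_nonneg_of_nonpos_of_nonpos h (mem_Iio.1 hx).le⟩
    obtain ⟨s, hs, hv, hx⟩ := hs
    have : IntegrableOn (fun _ => ‖F 0‖ ^ 2) s := by
      refine Integrable.mono (hint.integrableOn (s := s)) aestronglyMeasurable_const ?_
      filter_upwards [ae_restrict_mem hs] with x hxs
      simpa using hle x (hx x hxs)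
    rw [integrableOn_const_iff] at this
    rcases this with h | h
    · simpa using h
    · simp [hv] at h
  rw [Lp.eq_zero_iff_ae_eq_zero]
  filter_upwards [hF] with x hx
  rw [hx, hFx, hF0, mul_zero]
  rfl

/-- Factor ∂² − k² = (∂ + k)(∂ − k): the function u' − ku solves v' = −kv, so it vanishes, and then
u' = ku. -/
theorem eq_zero_of_isWeakDeriv_sq_smul {u g : L2} {k : ℂ} (h : IsWeakDeriv u g)
    (h' : IsWeakDeriv g (k ^ 2 • u)) : u = 0 := by
  have h1 : IsWeakDeriv (g - k • u) ((-k) • (g - k • u)) := by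
    convert h'.sub (h.const_smul k) using 1
    match_scalars <;> ring
  have h2 := eq_zero_of_isWeakDeriv_smul h1
  rw [sub_eq_zero.1 h2] at h
  exact eq_zero_of_isWeakDeriv_smul h

/-! ### Multiplication operators and the resolvent equation -/

theorem memLp_mul_of_bounded {W : ℝ → ℝ} (hc : Continuous W) {C : ℝ} (hb : ∀ x, |W x| ≤ C)
    (f : L2) : MemLp (fun x => (W x : ℂ) * f x) 2 :=
  (Lp.memLp f).of_le_mul (c := C)
    ((Complex.continuous_ofReal.comp hc).aestronglyMeasurable.mul (Lp.memLp f).1)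
    (Eventually.of_forall fun x => by
      rw [norm_mul, Complex.norm_real, Real.norm_eq_abs]
      gcongr
      exact hb x)

/-- Multiplication by a bounded continuous function, as a bounded operator on `L²`. -/
def mulL (W : ℝ → ℝ) (hc : Continuous W) (hb : ∃ C, ∀ x, |W x| ≤ C) : L2 →L[ℂ] L2 :=
  LinearMap.mkContinuous
    { toFun := fun f => (memLp_mul_of_bounded hc hb.choose_spec f).toLp
      map_add' := fun f g => by
        rw [← MemLp.toLp_add]
        refine MemLp.toLp_congr _ _ ?_
        filter_upwards [Lp.coeFn_add f g] with x hx
        rw [hx]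
        simp [mul_add]
      map_smul' := fun c f => by
        rw [RingHom.id_apply, ← MemLp.toLp_const_smul]
        refine MemLp.toLp_congr _ _ ?_
        filter_upwards [Lp.coeFn_smul c f] with x hx
        rw [hx]
        simp [mul_left_comm] }
    hb.choose fun f => by
      refine Lp.norm_le_mul_norm_of_ae_le_mul ?_
      filter_upwards [(memLp_mul_of_bounded hc hb.choose_spec f).coeFn_toLp] with x hx
      rw [LinearMap.coe_mk, AddHom.coe_mk, hx, norm_mul, Complex.norm_real, Real.norm_eq_abs]
      gcongr
      exact hb.choose_spec x

theorem mulL_ae {W : ℝ → ℝ} (hc : Continuous W) (hb : ∃ C, ∀ x, |W x| ≤ C) (f : L2) :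
    ∀ᵐ x, mulL W hc hb f x = W x * f x :=
  (memLp_mul_of_bounded hc hb.choose_spec f).coeFn_toLp

theorem norm_mulL_le {W : ℝ → ℝ} (hc : Continuous W) (hb : ∃ C, ∀ x, |W x| ≤ C) {C : ℝ}
    (hC0 : 0 ≤ C) (hC : ∀ x, |W x| ≤ C) : ‖mulL W hc hb‖ ≤ C := by
  refine ContinuousLinearMap.opNorm_le_bound _ hC0 fun f => ?_
  refine Lp.norm_le_mul_norm_of_ae_le_mul ?_
  filter_upwards [mulL_ae hc hb f] with x hx
  rw [hx, norm_mul, Complex.norm_real, Real.norm_eq_abs]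
  gcongr
  exact hC x

/-- The resolvent equation for `-∂² + 4 + W`. -/
theorem mem_schrodingerGraph_iff {W : ℝ → ℝ} (hc : Continuous W) (hb : ∃ C, ∀ x, |W x| ≤ C)
    {k : ℂ} (hk : 0 < k.re) (u f : L2) :
    (u, f) ∈ schrodingerGraph (fun x => 4 + W x) ↔
      u = freeResolvent hk (f - (4 - k ^ 2) • u - mulL W hc hb u) := by
  set p := f - (4 - k ^ 2) • u - mulL W hc hb u with hp
  obtain ⟨g', hg', hh'⟩ := freeResolvent_isWeakDeriv hk p
  constructor
  · rintro ⟨g, h, hg, hh, hf⟩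
    have e : h = k ^ 2 • u - p := by
      have e1 : h = (4 : ℂ) • u + mulL W hc hb u - f := by
        refine Lp.ext ?_
        filter_upwards [hf, mulL_ae hc hb u, Lp.coeFn_sub ((4 : ℂ) • u + mulL W hc hb u) f,
          Lp.coeFn_add ((4 : ℂ) • u) (mulL W hc hb u), Lp.coeFn_smul (4 : ℂ) u]
          with x h1 h2 h3 h4 h5
        rw [h3, Pi.sub_apply, h4, Pi.add_apply, h5, h2]
        simp only [Pi.smul_apply, smul_eq_mul]
        rw [h1]
        push_cast
        ring
      rw [e1, hp]
      module
    rw [e] at hh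
    -- Both u and R₀ p solve v'' = k² v − p in L², so their difference solves the homogeneous
    -- equation.
    have h1 := hg.sub hg'
    have h2 := hh.sub hh'
    have : k ^ 2 • u - p - (k ^ 2 • freeResolvent hk p - p)
        = k ^ 2 • (u - freeResolvent hk p) := by module
    rw [this] at h2
    exact sub_eq_zero.1 (eq_zero_of_isWeakDeriv_sq_smul h1 h2)
  · intro hu
    rw [← hu] at hg' hh'
    refine ⟨g', _, hg', hh', ?_⟩
    have e1 : k ^ 2 • u - p = (4 : ℂ) • u + mulL W hc hb u - f := by
      rw [hp]; module
    rw [e1]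
    filter_upwards [mulL_ae hc hb u, Lp.coeFn_sub ((4 : ℂ) • u + mulL W hc hb u) f,
      Lp.coeFn_add ((4 : ℂ) • u) (mulL W hc hb u), Lp.coeFn_smul (4 : ℂ) u]
      with x h2 h3 h4 h5
    rw [h3, Pi.sub_apply, h4, Pi.add_apply, h5, h2]
    simp only [Pi.smul_apply, smul_eq_mul]
    push_cast
    ring

/-! ### Graph formulations -/

section Graph

variable {U : ℝ → ℝ}

theorem mem_graph_of_domain (x : (schrodinger U).domain) :
    ((x : L2), schrodinger U x) ∈ schrodingerGraph U := by
  rw [← schrodinger_graph]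
  exact (schrodinger U).mem_graph x

theorem exists_domain_of_mem_graph {u f : L2} (h : (u, f) ∈ schrodingerGraph U) :
    ∃ x : (schrodinger U).domain, (x : L2) = u ∧ schrodinger U x = f := by
  rw [← schrodinger_graph] at h
  exact (LinearPMap.mem_graph_iff _).1 h

theorem shift_apply (z : ℂ) (x : (schrodinger U).domain) :
    shift (schrodinger U) z x = schrodinger U x - z • (x : L2) := rfl

theorem mem_resolventSet_iff {z : ℂ} :
    z ∈ resolventSet (schrodinger U) ↔ ∃ R : L2 →L[ℂ] L2,
      (∀ y, (R y, y + z • R y) ∈ schrodingerGraph U) ∧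
      ∀ u f, (u, f) ∈ schrodingerGraph U → R (f - z • u) = u := by
  refine exists_congr fun R => and_congr (forall_congr' fun y => ?_) ?_
  · constructor
    · rintro ⟨x, hx, hy⟩
      have := mem_graph_of_domain x
      rw [shift_apply, sub_eq_iff_eq_add] at hy
      rwa [hy, hx] at this
    · intro h
      obtain ⟨x, hx, hy⟩ := exists_domain_of_mem_graph h
      refine ⟨x, hx, ?_⟩
      rw [shift_apply, hy, hx, add_sub_cancel_right]
  · constructor
    · intro h u f huf
      obtain ⟨x, rfl, rfl⟩ := exists_domain_of_mem_graph huf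
      exact h x
    · intro h x
      exact h _ _ (mem_graph_of_domain x)

theorem mem_ker_shift_iff {z : ℂ} {x : (schrodinger U).domain} :
    x ∈ LinearMap.ker (shift (schrodinger U) z) ↔
      ((x : L2), z • (x : L2)) ∈ schrodingerGraph U := by
  rw [LinearMap.mem_ker, shift_apply, sub_eq_zero]
  constructor
  · intro h
    rw [← h]
    exact mem_graph_of_domain x
  · intro h
    obtain ⟨x', hx, hy⟩ := exists_domain_of_mem_graph h
    rw [← hy]
    congr 1
    exact Subtype.ext hx.symm

/-- `z` is an eigenvalue of `-∂² + U`. -/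
def IsEigenvalue (U : ℝ → ℝ) (z : ℂ) : Prop :=
  ∃ u : L2, u ≠ 0 ∧ (u, z • u) ∈ schrodingerGraph U

theorem ker_shift_ne_bot_iff {z : ℂ} :
    LinearMap.ker (shift (schrodinger U) z) ≠ ⊥ ↔ IsEigenvalue U z := by
  rw [Submodule.ne_bot_iff]
  constructor
  · rintro ⟨x, hx, hx0⟩
    exact ⟨x, fun h => hx0 (Subtype.ext h), mem_ker_shift_iff.1 hx⟩
  · rintro ⟨u, hu, h⟩
    obtain ⟨x, rfl, -⟩ := exists_domain_of_mem_graph h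
    exact ⟨x, mem_ker_shift_iff.2 h, fun h => hu (by simp [h])⟩

theorem IsEigenvalue.mem_spectrum {z : ℂ} (h : IsEigenvalue U z) :
    z ∈ spectrum (schrodinger U) := by
  obtain ⟨u, hu, hg⟩ := h
  intro hz
  obtain ⟨R, -, hR⟩ := mem_resolventSet_iff.1 hz
  have := hR u _ hg
  rw [sub_self, map_zero] at this
  exact hu this.symm

theorem injective_shift_of_not_isEigenvalue {z : ℂ} (h : ¬ IsEigenvalue U z) :
    Function.Injective (shift (schrodinger U) z) := by
  rw [← LinearMap.ker_eq_bot]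
  by_contra h'
  exact h (ker_shift_ne_bot_iff.1 h')

end Graph

/-! ### Compactness and the Fredholm alternative -/

/-- Sequential Banach–Alaoglu in the dual, transported by the Riesz isomorphism. That map is
conjugate linear, hence the conjugation in the proof. -/
theorem exists_weakly_convergent_subseq {H : Type*} [NormedAddCommGroup H]
    [InnerProductSpace ℂ H] [CompleteSpace H] [TopologicalSpace.SeparableSpace H] {f : ℕ → H}
    (hf : ∀ n, ‖f n‖ ≤ 1) :
    ∃ f₀ : H, ‖f₀‖ ≤ 1 ∧ ∃ φ : ℕ → ℕ, StrictMono φ ∧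
      ∀ g, Tendsto (fun n => inner ℂ g (f (φ n))) atTop (𝓝 (inner ℂ g f₀)) := by
  obtain ⟨a, ha, φ, hφ, hlim⟩ := WeakDual.isSeqCompact_closedBall ℂ H 0 1
    (x := fun n => StrongDual.toWeakDual (InnerProductSpace.toDual ℂ H (f n)))
    (fun n => by simpa using hf n)
  refine ⟨(InnerProductSpace.toDual ℂ H).symm (WeakDual.toStrongDual a), ?_, φ, hφ, fun g => ?_⟩
  · simpa using ha
  · have h1 := ((WeakDual.eval_continuous g).tendsto a).comp hlim
    have h2 := (Complex.continuous_conj.tendsto _).comp h1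
    convert h2 using 2
    · simp
    · rw [← inner_conj_symm, InnerProductSpace.toDual_symm_apply]
      rfl

theorem L2_norm_sq (f : L2) : ‖f‖ ^ 2 = ∫ x, ‖f x‖ ^ 2 := by
  rw [← inner_self_eq_norm_sq (𝕜 := ℂ) f, L2.inner_def, ← integral_re (L2.integrable_inner f f)]
  simp_rw [inner_self_eq_norm_sq]

theorem L2_integrable_norm_sq (f : L2) : Integrable fun x => ‖f x‖ ^ 2 :=
  (memLp_two_iff_integrable_sq_norm (Lp.memLp f).1).1 (Lp.memLp f)

/-- The pointwise values of the free resolvent. -/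
def freeVal (k : ℂ) (f : L2) (x : ℝ) : ℂ :=
  (2 * k)⁻¹ * (conv (kerR k) f x + conv (kerL k) f x)

theorem freeResolvent_ae {k : ℂ} (hk : 0 < k.re) (f : L2) :
    freeResolvent hk f =ᵐ[volume] freeVal k f := by
  filter_upwards [convL_ae (integrable_kerR hk) (memLp_kerR hk) f,
    convL_ae (integrable_kerL hk) (memLp_kerL hk) f,
    Lp.coeFn_smul (2 * k)⁻¹ (solveR hk f + solveL hk f),
    Lp.coeFn_add (solveR hk f) (solveL hk f)] with x h1 h2 h3 h4
  rw [freeResolvent, _root_.smul_apply, _root_.add_apply, h3,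
    Pi.smul_apply, h4, Pi.add_apply, solveR, solveL, h1, h2, freeVal, smul_eq_mul]

theorem exists_norm_freeVal_le {k : ℂ} (hk : 0 < k.re) :
    ∃ B, ∀ f x, ‖freeVal k f x‖ ≤ B * ‖f‖ := by
  refine ⟨‖(2 * k)⁻¹‖ * ((eLpNorm (kerR k) 2 volume).toReal
    + (eLpNorm (kerL k) 2 volume).toReal), fun f x => ?_⟩
  rw [freeVal, norm_mul, mul_assoc, add_mul]
  gcongr
  exact (norm_add_le _ _).trans
    (add_le_add (norm_conv_le (memLp_kerR hk) f x) (norm_conv_le (memLp_kerL hk) f x))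

/-- Each value of a convolution is an inner product with a fixed vector of L², so weak convergence
turns into pointwise convergence. -/
theorem tendsto_freeVal {k : ℂ} (hk : 0 < k.re) {f : ℕ → L2} {f₀ : L2}
    (h : ∀ g, Tendsto (fun n => inner ℂ g (f n)) atTop (𝓝 (inner ℂ g f₀))) (x : ℝ) :
    Tendsto (fun n => freeVal k (f n) x) atTop (𝓝 (freeVal k f₀ x)) := by
  simp_rw [freeVal, conv_eq_inner (memLp_kerR hk), conv_eq_inner (memLp_kerL hk)]
  exact ((h _).add (h _)).const_mul _

instance : TopologicalSpace.SeparableSpace L2 :=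
  have : Fact ((2 : ENNReal) ≠ ⊤) := ⟨by norm_num⟩
  inferInstance

/-- If fₙ → f₀ weakly in the unit ball, then R₀ (fₙ − f₀) tends to 0 pointwise and is uniformly
bounded. Multiplied by W it is dominated by a constant times |W|, which is in L², so the images
converge in norm. -/
theorem isCompactOperator_mulL_freeResolvent {W : ℝ → ℝ} (hc : Continuous W)
    (hb : ∃ C, ∀ x, |W x| ≤ C) (hW : MemLp W 2) {k : ℂ} (hk : 0 < k.re) :
    IsCompactOperator (mulL W hc hb ∘L freeResolvent hk) := by
  obtain ⟨B, hB⟩ := exists_norm_freeVal_le hk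
  set T := mulL W hc hb ∘L freeResolvent hk with hT
  have hTae : ∀ f : L2, ∀ᵐ x, T f x = W x * freeVal k f x := fun f => by
    filter_upwards [mulL_ae hc hb (freeResolvent hk f), freeResolvent_ae hk f] with x h1 h2
    rw [hT, ContinuousLinearMap.comp_apply, h1, h2]
  refine (isCompactOperator_iff_image_closedBall_subset_compact (T : L2 →ₗ[ℂ] L2) one_pos).2
    ⟨_, IsSeqCompact.isCompact ?_, Subset.rfl⟩
  intro v hv
  choose f hf hfv using hv
  obtain ⟨f₀, hf₀, φ, hφ, hlim⟩ := exists_weakly_convergent_subseq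
    (f := f) (fun n => by simpa using hf n)
  refine ⟨T f₀, ⟨f₀, by simpa using hf₀, rfl⟩, φ, hφ, ?_⟩
  have e : v ∘ φ = fun n => T (f (φ n)) := by
    ext1 n; exact (hfv (φ n)).symm
  rw [e, tendsto_iff_norm_sub_tendsto_zero]
  have hsq : Tendsto (fun n => ‖T (f (φ n)) - T f₀‖ ^ 2) atTop (𝓝 0) := by
    simp_rw [← map_sub, L2_norm_sq]
    have hd : ∀ g, Tendsto (fun n => inner ℂ g (f (φ n) - f₀)) atTop (𝓝 (inner ℂ g (0 : L2))) := by
      intro g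
      simp_rw [inner_sub_right]
      simpa using (hlim g).sub_const (inner ℂ g f₀)
    have hB2 : ∀ n x, ‖freeVal k (f (φ n) - f₀) x‖ ≤ |B| * 2 := by
      intro n x
      refine (hB _ _).trans ?_
      have : ‖f (φ n) - f₀‖ ≤ 2 := by
        refine (norm_sub_le _ _).trans ?_
        have : ‖f (φ n)‖ ≤ 1 := by simpa using hf (φ n)
        linarith
      exact mul_le_mul (le_abs_self B) this (norm_nonneg _) (abs_nonneg _)
    have hlim0 : Tendsto (fun n => ∫ x, ‖T (f (φ n) - f₀) x‖ ^ 2) atTop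
        (𝓝 (∫ _ : ℝ, (0 : ℝ))) := by
      refine tendsto_integral_of_dominated_convergence
        (fun x => ‖W x‖ ^ 2 * (|B| * 2) ^ 2) (fun n => (Lp.memLp _).1.norm.pow 2)
        (((memLp_two_iff_integrable_sq_norm hW.1).1 hW).mul_const _) (fun n => ?_) ?_
      · filter_upwards [hTae (f (φ n) - f₀)] with x hx
        rw [hx, norm_pow, norm_norm, norm_mul, Complex.norm_real, mul_pow]
        gcongr
        exact hB2 n x
      · filter_upwards [ae_all_iff.2 fun n => hTae (f (φ n) - f₀)] with x hx
        simp_rw [hx]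
        have h1 := tendsto_freeVal hk hd x
        have h0 : freeVal k 0 x = 0 := by simpa using hB 0 x
        rw [h0] at h1
        have h2 := ((h1.const_mul (W x : ℂ)).norm).pow 2
        simpa using h2
    simpa using hlim0
  have h2 := hsq.sqrt
  simpa [Real.sqrt_sq (norm_nonneg _)] using h2

/-- The two square roots of 4 − z are opposite, so one has positive real part unless both are
imaginary; in that case z = 4 + (Im w)² lies on the half-line. -/
theorem exists_sqrt {z : ℂ} (hz : z ∉ (fun r : ℝ => (r : ℂ)) '' Ici 4) :
    ∃ k : ℂ, 0 < k.re ∧ z = 4 - k ^ 2 := by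
  obtain ⟨w, hw⟩ := IsAlgClosed.exists_pow_nat_eq (4 - z) (n := 2) (by norm_num)
  have hz' : z = 4 - w ^ 2 := by rw [hw]; ring
  rcases lt_trichotomy w.re 0 with h | h | h
  · exact ⟨-w, by simpa using h, by rw [neg_sq]; exact hz'⟩
  · refine absurd ⟨4 + w.im ^ 2, by simp [sq_nonneg], ?_⟩ hz
    have : w = w.im * Complex.I := by
      apply Complex.ext <;> simp [h]
    rw [hz', this, mul_pow, Complex.I_sq]
    simp
  · exact ⟨w, h, hz'⟩

/-- Fredholm alternative: a point off the half-line `[4, ∞)` which is not an eigenvalue lies in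
the resolvent set. -/
theorem mem_resolventSet_of_not_isEigenvalue {W : ℝ → ℝ} (hc : Continuous W)
    (hb : ∃ C, ∀ x, |W x| ≤ C) (hW : MemLp W 2) {z : ℂ}
    (hz : z ∉ (fun r : ℝ => (r : ℂ)) '' Ici 4) (he : ¬ IsEigenvalue (fun x => 4 + W x) z) :
    z ∈ resolventSet (schrodinger fun x => 4 + W x) := by
  obtain ⟨k, hk, rfl⟩ := exists_sqrt hz
  set R₀ := freeResolvent hk
  set M := mulL W hc hb
  have hiff := mem_schrodingerGraph_iff hc hb hk
  have hcpt := isCompactOperator_mulL_freeResolvent hc hb hW hk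
  -- Applying H − z after R₀ gives 1 + M R₀, so this is the operator to invert. By compactness the
  -- only obstruction is a vector v with M R₀ v = −v, and then R₀ v is an eigenvector of H.
  have hu : IsUnit (1 + M ∘L R₀) := by
    rcases hcpt.hasEigenvalue_or_mem_resolventSet (μ := -1) (by simp) with h | h
    · exfalso
      obtain ⟨v, hv, hv0⟩ := h.exists_hasEigenvector
      rw [Module.End.mem_eigenspace_iff] at hv
      have hv' : M (R₀ v) = -v := by simpa using hv
      refine he ⟨R₀ v, fun h0 => hv0 ?_, ?_⟩
      · rw [h0, map_zero] at hv'
        exact neg_eq_zero.1 hv'.symm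
      · rw [hiff, hv']
        congr 1
        abel
    · rw [_root_.spectrum.mem_resolventSet_iff] at h
      have e : algebraMap ℂ (L2 →L[ℂ] L2) (-1) - M ∘L R₀ = -(1 + M ∘L R₀) := by
        rw [map_neg, map_one]; abel
      rw [e] at h
      exact (IsUnit.neg_iff _).1 h
  obtain ⟨⟨A, S, hAS, hSA⟩, hA⟩ := hu
  have hA' : A = 1 + M ∘L R₀ := hA
  rw [hA'] at hAS
  have h1 : ∀ y, (R₀ (S y), y + (4 - k ^ 2) • R₀ (S y)) ∈ schrodingerGraph fun x => 4 + W x := by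
    intro y
    rw [hiff]
    have : S y + M (R₀ (S y)) = y := by simpa using DFunLike.congr_fun hAS y
    congr 1
    nth_rewrite 2 [← this]
    abel
  refine mem_resolventSet_iff.2 ⟨R₀ ∘L S, h1, fun u f huf => ?_⟩
  -- By `h1`, R₀ S is a right inverse of H − z. Two preimages of one vector differ by an eigenvector
  -- or by zero, so it is a left inverse too.
  have h2 := (schrodingerGraph _).sub_mem (h1 (f - (4 - k ^ 2) • u)) huf
  by_contra hne
  refine he ⟨R₀ (S (f - (4 - k ^ 2) • u)) - u, sub_ne_zero.2 hne, ?_⟩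
  rw [Prod.mk_sub_mk] at h2
  convert h2 using 2
  rw [smul_sub]
  abel

/-! ### Symmetry and eigenvalues -/

/-- Equality fails at s = 0, where `kerR` is 1 and `kerL` is 0; hence only almost everywhere. -/
theorem kerL_neg_ae {k : ℂ} (hk : k.im = 0) : ∀ᵐ s, kerL k (-s) = star (kerR k s) := by
  have h0 : ∀ᵐ s : ℝ, s ≠ 0 := by simp [ae_iff, measure_singleton]
  have hkc : (starRingEnd ℂ) k = k := Complex.conj_eq_iff_im.2 hk
  filter_upwards [h0] with s hs
  rcases lt_or_gt_of_ne hs with h | h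
  · rw [kerL, kerR, indicator_of_notMem (by simpa using h.le),
      indicator_of_notMem (by simpa using h)]
    simp
  · rw [kerL, kerR, indicator_of_mem (by simpa using h), indicator_of_mem (by simpa using h.le)]
    simp [← Complex.exp_conj, hkc]

/-- For real k the two one-sided solution operators are adjoint to each other, so their sum is
symmetric. -/
theorem inner_freeResolvent {k : ℂ} (hk : 0 < k.re) (hk' : k.im = 0) (f g : L2) :
    inner ℂ (freeResolvent hk f) g = inner ℂ f (freeResolvent hk g) := by
  have hkc : (starRingEnd ℂ) k = k := Complex.conj_eq_iff_im.2 hk'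
  have e1 : inner ℂ (solveR hk f) g = inner ℂ f (solveL hk g) :=
    inner_convL _ _ _ _ (kerL_neg_ae hk') f g
  have e2 : inner ℂ (solveL hk f) g = inner ℂ f (solveR hk g) := by
    refine inner_convL _ _ _ _ ?_ f g
    filter_upwards [(Measure.measurePreserving_neg (volume : Measure ℝ)).quasiMeasurePreserving.ae
      (kerL_neg_ae hk')] with s hs
    rw [neg_neg] at hs
    rw [hs, star_star]
  simp only [freeResolvent, _root_.smul_apply, _root_.add_apply, inner_smul_left, inner_smul_right,
    inner_add_left, inner_add_right, e1, e2, map_inv₀, map_mul, hkc]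
  simp [add_comm, map_ofNat (starRingEnd ℂ) 2]

theorem inner_mulL {W : ℝ → ℝ} (hc : Continuous W) (hb : ∃ C, ∀ x, |W x| ≤ C) (f g : L2) :
    inner ℂ (mulL W hc hb f) g = inner ℂ f (mulL W hc hb g) := by
  rw [L2.inner_def, L2.inner_def]
  refine integral_congr_ae ?_
  filter_upwards [mulL_ae hc hb f, mulL_ae hc hb g] with x h1 h2
  rw [h1, h2]
  simp [mul_left_comm, mul_assoc]

section Bounded

variable {W : ℝ → ℝ} (hc : Continuous W) (hb : ∃ C, ∀ x, |W x| ≤ C)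
include hc hb

/-- `-∂² + 4 + W` is symmetric. -/
theorem inner_schrodingerGraph {u f v g : L2} (h : (u, f) ∈ schrodingerGraph fun x => 4 + W x)
    (h' : (v, g) ∈ schrodingerGraph fun x => 4 + W x) : inner ℂ u g = inner ℂ f v := by
  -- The choice k = 2 makes 4 − k² vanish: the resolvent equation becomes u = R₀ (f − M u), and
  -- symmetry of H reduces to that of the bounded operators R₀ and M.
  have hk : 0 < (2 : ℂ).re := by norm_num
  set M := mulL W hc hb with hM
  have e1 : u = freeResolvent hk (f - M u) := by
    have := (mem_schrodingerGraph_iff hc hb hk u f).1 h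
    convert this using 2
    norm_num [hM]
  have e2 : v = freeResolvent hk (g - M v) := by
    have := (mem_schrodingerGraph_iff hc hb hk v g).1 h'
    convert this using 2
    norm_num [hM]
  have e3 : inner ℂ u (g - M v) = inner ℂ (f - M u) v := by
    nth_rewrite 1 [e1]
    nth_rewrite 2 [e2]
    exact inner_freeResolvent hk (by simp) _ _
  rw [inner_sub_left, inner_sub_right, hM, inner_mulL hc hb u v] at e3
  exact sub_left_injective e3

theorem IsEigenvalue.im_eq_zero {z : ℂ} (h : IsEigenvalue (fun x => 4 + W x) z) : z.im = 0 := by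
  obtain ⟨u, hu, hg⟩ := h
  have := inner_schrodingerGraph hc hb hg hg
  rw [inner_smul_left, inner_smul_right] at this
  exact Complex.conj_eq_iff_im.1 (mul_right_cancel₀ (inner_self_ne_zero.2 hu) this.symm)

/-- Normalized eigenvectors for convergent eigenvalues off `[4, ∞)` subconverge. -/
theorem exists_tendsto_of_eigenvectors (hW : MemLp W 2) {z : ℂ}
    (hz : z ∉ (fun r : ℝ => (r : ℂ)) '' Ici 4) {ζ : ℕ → ℂ} (hζ : Tendsto ζ atTop (𝓝 z))
    {u : ℕ → L2} (hu : ∀ n, ‖u n‖ ≤ 1)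
    (hg : ∀ n, (u n, ζ n • u n) ∈ schrodingerGraph fun x => 4 + W x) :
    ∃ v : L2, (v, z • v) ∈ (schrodingerGraph fun x => 4 + W x) ∧
      ∃ φ : ℕ → ℕ, StrictMono φ ∧ Tendsto (u ∘ φ) atTop (𝓝 v) := by
  obtain ⟨k, hk, rfl⟩ := exists_sqrt hz
  set R₀ := freeResolvent hk
  set M := mulL W hc hb
  have hiff := mem_schrodingerGraph_iff hc hb hk
  have hcpt := isCompactOperator_mulL_freeResolvent hc hb hW hk
  set g : ℕ → L2 := fun n => ζ n • u n - (4 - k ^ 2) • u n - M (u n) with hgdef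
  have hug : ∀ n, u n = R₀ (g n) := fun n => (hiff _ _).1 (hg n)
  obtain ⟨B, hB⟩ := (hζ.sub_const (4 - k ^ 2)).norm.bddAbove_range
  have hgb : ∀ n, ‖g n‖ ≤ B + ‖M‖ := by
    intro n
    rw [hgdef]
    simp only [← sub_smul]
    refine (norm_sub_le _ _).trans (add_le_add ?_ ?_)
    · rw [norm_smul]
      exact (mul_le_of_le_one_right (norm_nonneg _) (hu n)).trans (hB (mem_range_self n))
    · exact (M.le_opNorm _).trans (mul_le_of_le_one_right (norm_nonneg _) (hu n))
  -- The vectors M uₙ = M R₀ gₙ lie in a compact set. Along a subsequence M uₙ → w, hence gₙ → −w,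
  -- hence uₙ = R₀ gₙ → −R₀ w.
  obtain ⟨K, hK, hKs⟩ := IsCompactOperator.image_subset_compact_of_bounded
    (f := ((M ∘L R₀ : L2 →L[ℂ] L2) : L2 →ₗ[ℂ] L2)) hcpt
    (Metric.isBounded_closedBall (x := (0 : L2)) (r := B + ‖M‖))
  obtain ⟨w, -, φ, hφ, hlim⟩ := hK.tendsto_subseq (x := fun n => M (u n)) fun n =>
    hKs ⟨g n, by simpa using hgb n, by rw [hug n]; rfl⟩
  have hφt := hφ.tendsto_atTop
  have hz0 : Tendsto (fun n => (ζ (φ n) - (4 - k ^ 2)) • u (φ n)) atTop (𝓝 0) := by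
    refine squeeze_zero_norm (a := fun n => ‖ζ (φ n) - (4 - k ^ 2)‖) (fun n => ?_) ?_
    · rw [norm_smul]
      exact mul_le_of_le_one_right (norm_nonneg _) (hu _)
    · have := ((hζ.comp hφt).sub_const (4 - k ^ 2)).norm
      rwa [sub_self, norm_zero] at this
  have hgl : Tendsto (fun n => g (φ n)) atTop (𝓝 (0 - w)) := by
    simp only [hgdef, ← sub_smul]
    exact hz0.sub hlim
  have hul : Tendsto (fun n => u (φ n)) atTop (𝓝 (R₀ (0 - w))) := by
    have := (R₀.continuous.tendsto _).comp hgl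
    refine this.congr fun n => ?_
    exact (hug _).symm
  have hMw : M (R₀ (0 - w)) = w :=
    tendsto_nhds_unique ((M.continuous.tendsto _).comp hul) hlim
  refine ⟨_, ?_, φ, hφ, hul⟩
  rw [hiff, hMw, sub_self]

/-- Riesz's criterion: the closed unit ball of the eigenspace is compact, by
`exists_tendsto_of_eigenvectors` for the constant sequence z. -/
theorem finiteDimensional_ker_shift (hW : MemLp W 2) {z : ℂ}
    (hz : z ∉ (fun r : ℝ => (r : ℂ)) '' Ici 4) :
    FiniteDimensional ℂ (LinearMap.ker (shift (schrodinger fun x => 4 + W x) z)) := by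
  refine FiniteDimensional.of_isCompact_closedBall₀ ℂ one_pos (IsSeqCompact.isCompact ?_)
  intro x hx
  obtain ⟨v, hv, φ, hφ, hlim⟩ := exists_tendsto_of_eigenvectors hc hb hW hz
    (tendsto_const_nhds (x := z)) (u := fun n => ((x n : (schrodinger _).domain) : L2))
    (fun n => by simpa using hx n) fun n => mem_ker_shift_iff.1 (x n).2
  obtain ⟨y, rfl, -⟩ := exists_domain_of_mem_graph hv
  have hlim' : Tendsto (x ∘ φ) atTop (𝓝 ⟨y, mem_ker_shift_iff.2 hv⟩) :=
    tendsto_subtype_rng.2 (tendsto_subtype_rng.2 hlim)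
  exact ⟨_, Metric.isClosed_closedBall.mem_of_tendsto hlim'
    (Eventually.of_forall fun n => hx _), φ, hφ, hlim'⟩

/-- Eigenvalues off `[4, ∞)` are isolated. -/
theorem exists_ball_of_not_mem (hW : MemLp W 2) {z : ℂ}
    (hz : z ∉ (fun r : ℝ => (r : ℂ)) '' Ici 4) :
    ∃ ε > 0, spectrum (schrodinger fun x => 4 + W x) ∩ Metric.ball z ε ⊆ {z} := by
  have hcl : IsClosed ((fun r : ℝ => (r : ℂ)) '' Ici 4) :=
    Complex.isometry_ofReal.isClosedEmbedding.isClosedMap _ isClosed_Ici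
  obtain ⟨δ, hδ, hball⟩ := Metric.isOpen_iff.1 hcl.isOpen_compl z hz
  by_contra! hcon
  have h1 : ∀ n : ℕ, ∃ ζ : ℂ, ∃ u : L2, dist ζ z < 1 / ((n : ℝ) + 1) ∧ ζ ≠ z ∧ ‖u‖ = 1 ∧
      (u, ζ • u) ∈ schrodingerGraph fun x => 4 + W x := by
    intro n
    obtain ⟨ζ, ⟨hs, hζ⟩, hne⟩ := not_subset.1
      (hcon (min δ (1 / ((n : ℝ) + 1))) (lt_min hδ (by positivity)))
    have hζ' := Metric.mem_ball.1 hζ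
    have he : IsEigenvalue (fun x => 4 + W x) ζ := by
      by_contra hne
      exact hs (mem_resolventSet_of_not_isEigenvalue hc hb hW
        (hball (hζ'.trans_le (min_le_left _ _))) hne)
    obtain ⟨u, hu, hg⟩ := he
    refine ⟨ζ, ((‖u‖ : ℂ)⁻¹) • u, hζ'.trans_le (min_le_right _ _), hne, ?_, ?_⟩
    · rw [norm_smul]
      simp [norm_ne_zero_iff.2 hu]
    · have := (schrodingerGraph _).smul_mem ((‖u‖ : ℂ)⁻¹) hg
      rw [smul_comm]
      exact this
  choose ζ u hd hne hn hg using h1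
  have hζ : Tendsto ζ atTop (𝓝 z) := by
    rw [tendsto_iff_dist_tendsto_zero]
    exact squeeze_zero (fun _ => dist_nonneg) (fun n => (hd n).le)
      tendsto_one_div_add_atTop_nhds_zero_nat
  obtain ⟨v, hv, φ, hφ, hlim⟩ := exists_tendsto_of_eigenvectors hc hb hW hz hζ
    (fun n => (hn n).le) hg
  have hnv : ‖v‖ = 1 := by
    refine tendsto_nhds_unique hlim.norm ?_
    simp [hn]
  have hv0 : v ≠ 0 := fun h => by simp [h] at hnv
  have hzr : (starRingEnd ℂ) z = z :=
    Complex.conj_eq_iff_im.2 (IsEigenvalue.im_eq_zero hc hb ⟨v, hv0, hv⟩)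
  -- By symmetry, eigenvectors for ζₙ ≠ z are orthogonal to v. They also subconverge to v, which has
  -- norm 1: a contradiction.
  have horth : ∀ n, inner ℂ v (u n) = 0 := by
    intro n
    have := inner_schrodingerGraph hc hb hv (hg n)
    rw [inner_smul_left, inner_smul_right, hzr, ← sub_eq_zero, ← sub_mul] at this
    exact (mul_eq_zero.1 this).resolve_left (sub_ne_zero.2 (hne n))
  have h0 : Tendsto (fun n => inner ℂ v ((u ∘ φ) n)) atTop (𝓝 (inner ℂ v v)) :=
    (tendsto_const_nhds (x := v)).inner hlim
  simp only [Function.comp_apply, horth] at h0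
  exact inner_self_ne_zero.2 hv0 (tendsto_nhds_unique h0 tendsto_const_nhds)

/-- The range of `-∂² + 4 + W - z` is dense if `z` is real and not an eigenvalue. -/
theorem denseRange_shift {z μ : ℂ} (hz : z.im = 0) (hμ : μ.im = 0)
    (hμr : μ ∈ resolventSet (schrodinger fun x => 4 + W x))
    (he : ¬ IsEigenvalue (fun x => 4 + W x) z) :
    DenseRange (shift (schrodinger fun x => 4 + W x) z) := by
  set T := schrodinger fun x => 4 + W x with hT
  obtain ⟨R, hR, -⟩ := mem_resolventSet_iff.1 hμr
  have hzc : (starRingEnd ℂ) z = z := Complex.conj_eq_iff_im.2 hz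
  have hμc : (starRingEnd ℂ) μ = μ := Complex.conj_eq_iff_im.2 hμ
  suffices (LinearMap.range (shift T z)).topologicalClosure = ⊤ by
    rw [DenseRange, ← LinearMap.coe_range]
    exact (Submodule.dense_iff_topologicalClosure_eq_top).2 this
  rw [Submodule.topologicalClosure_eq_top_iff, Submodule.eq_bot_iff]
  intro g hg
  rw [Submodule.mem_orthogonal] at hg
  set w := R g with hw
  have hgz : ∀ u f, (u, f) ∈ (schrodingerGraph fun x => 4 + W x) →
      inner ℂ (f - z • u) g = 0 := by
    intro u f huf
    obtain ⟨x, rfl, rfl⟩ := exists_domain_of_mem_graph huf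
    exact hg _ ⟨x, rfl⟩
  -- A vector g orthogonal to the range is orthogonal to (H − z) R y = y − (z − μ) R y for all y.
  -- Moving the symmetric R across gives g = (z − μ) R g, so g lies in the domain and is an
  -- eigenvector unless zero. The real resolvent point μ thus stands in for a description of the
  -- adjoint of H.
  have key : ∀ y, inner ℂ y (g - (z - μ) • w) = 0 := by
    intro y
    have h1 := hgz _ _ (hR y)
    have h2 := inner_schrodingerGraph hc hb (hR y) (hR g)
    simp only [inner_sub_left, inner_add_left, inner_smul_left, inner_sub_right,
      inner_add_right, inner_smul_right, hzc, hμc, ← hw] at h1 h2 ⊢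
    linear_combination h1 + (z - μ) * h2
  have hgw : g = (z - μ) • w := sub_eq_zero.1 (inner_self_eq_zero.1 (key _))
  by_contra hg0
  refine he ⟨g, hg0, ?_⟩
  have h3 := (schrodingerGraph _).smul_mem (z - μ) (hR g)
  rw [Prod.smul_mk, ← hw, smul_add, smul_comm (z - μ) μ w, ← hgw, ← add_smul,
    sub_add_cancel] at h3
  exact h3

end Bounded

/-! ### Eigenfunctions and the differential equation -/

theorem hasDerivAt_of_primitive {F g : ℝ → ℂ} (hg : Continuous g)
    (h : ∀ x y, F y - F x = ∫ t in x..y, g t) (x : ℝ) : HasDerivAt F (g x) x :=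
  ((intervalIntegral.integral_hasDerivAt_right (hg.intervalIntegrable x x)
      (hg.stronglyMeasurableAtFilter _ _) hg.continuousAt).const_add (F x)).congr_of_eventuallyEq
      (Eventually.of_forall fun y => by simp [← h])

/-- Eigenvectors are represented by classical solutions of the eigenvalue equation. -/
theorem exists_classical {U : ℝ → ℝ} (hU : Continuous U) {u : L2} {z : ℂ}
    (h : (u, z • u) ∈ schrodingerGraph U) :
    ∃ F F₁ : ℝ → ℂ, u =ᵐ[volume] F ∧ (∀ x, HasDerivAt F (F₁ x) x) ∧
      (∀ x, HasDerivAt F₁ ((U x - z) * F x) x) ∧ MemLp F 2 ∧ MemLp F₁ 2 := by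
  obtain ⟨g, h, hg, hh, hf⟩ := h
  obtain ⟨F, hF, hFc, hFi⟩ := hg.exists_primitive
  obtain ⟨F₁, hF₁, hF₁c, hF₁i⟩ := hh.exists_primitive
  refine ⟨F, F₁, hF, hasDerivAt_of_primitive hF₁c fun x y => ?_,
    hasDerivAt_of_primitive (g := fun x => (U x - z) * F x) (by fun_prop) fun x y => ?_,
    (memLp_congr_ae hF).1 (Lp.memLp u), (memLp_congr_ae hF₁).1 (Lp.memLp g)⟩
  · rw [hFi]
    refine intervalIntegral.integral_congr_ae ?_
    filter_upwards [hF₁] with t ht _ using ht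
  · rw [hF₁i]
    refine intervalIntegral.integral_congr_ae ?_
    filter_upwards [hF, hf, Lp.coeFn_smul z u] with t h1 h2 h3 _
    rw [h3, Pi.smul_apply, smul_eq_mul, h1] at h2
    linear_combination h2

theorem isWeakDeriv_of_hasDerivAt {f g : L2} {F F₁ : ℝ → ℂ} (hf : f =ᵐ[volume] F)
    (hg : g =ᵐ[volume] F₁) (hF : ∀ x, HasDerivAt F (F₁ x) x) (hF₁ : Continuous F₁) :
    IsWeakDeriv f g := by
  refine isWeakDeriv_of_primitive hf fun x y => ?_
  rw [← intervalIntegral.integral_eq_sub_of_hasDerivAt (fun t _ => hF t)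
    (hF₁.intervalIntegrable x y)]
  refine intervalIntegral.integral_congr_ae ?_
  filter_upwards [hg] with t ht _ using ht.symm

/-- Classical functions in the domain of `-∂² + U`. -/
theorem mem_graph_of_classical {U : ℝ → ℝ} {u f : L2} {F F₁ F₂ : ℝ → ℂ} (hu : u =ᵐ[volume] F)
    (hF : ∀ x, HasDerivAt F (F₁ x) x) (hF₁ : ∀ x, HasDerivAt F₁ (F₂ x) x) (hF₂ : Continuous F₂)
    (h₁ : MemLp F₁ 2) (h₂ : MemLp F₂ 2) (hf : ∀ᵐ x, f x = -F₂ x + U x * F x) :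
    (u, f) ∈ schrodingerGraph U := by
  refine ⟨h₁.toLp, h₂.toLp,
    isWeakDeriv_of_hasDerivAt hu h₁.coeFn_toLp hF
      (continuous_iff_continuousAt.2 fun x => (hF₁ x).continuousAt),
    isWeakDeriv_of_hasDerivAt h₁.coeFn_toLp h₂.coeFn_toLp hF₁ hF₂, ?_⟩
  filter_upwards [hu, hf, h₂.coeFn_toLp] with x h1 h2 h3
  rw [h1, h3]
  exact h2

/-- Uniqueness for the linear second order equation. -/
theorem eq_zero_of_initial {q : ℝ → ℂ} {K : ℝ} (hq : ∀ x, ‖q x‖ ≤ K) {F F₁ : ℝ → ℂ}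
    (hF : ∀ x, HasDerivAt F (F₁ x) x) (hF₁ : ∀ x, HasDerivAt F₁ (q x * F x) x) {c : ℝ}
    (h0 : F c = 0) (h1 : F₁ c = 0) (x : ℝ) : F x = 0 := by
  have hK : 0 ≤ K := (norm_nonneg _).trans (hq 0)
  -- For the first order system of the pair (F, F₁), max 1 K is a Lipschitz constant in the sup norm
  -- of ℂ × ℂ.
  have := ODE_solution_unique_univ (E := ℂ × ℂ) (v := fun t p => (p.2, q t * p.1))
    (s := fun _ => univ) (K := (max 1 K).toNNReal) (f := fun t => (F t, F₁ t))
    (g := fun _ => (0, 0)) (t₀ := c)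
    (fun t => (LipschitzWith.of_dist_le_mul fun p p' => by
      rw [dist_eq_norm, dist_eq_norm, Real.coe_toNNReal _ (by positivity)]
      have h2 : ‖p.2 - p'.2‖ ≤ ‖p - p'‖ := norm_snd_le (p - p')
      have h1 : ‖p.1 - p'.1‖ ≤ ‖p - p'‖ := norm_fst_le (p - p')
      refine norm_prod_le_iff.2 ⟨?_, ?_⟩
      · refine h2.trans (le_mul_of_one_le_left (norm_nonneg _) (le_max_left _ _))
      · simp only [Prod.snd_sub, ← mul_sub, norm_mul]
        exact mul_le_mul ((hq t).trans (le_max_right _ _)) h1 (norm_nonneg _)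
          (by positivity)).lipschitzOnWith)
    (fun t => ⟨(hF t).prodMk (hF₁ t), mem_univ _⟩)
    (fun t => ⟨by rw [mul_zero]; exact hasDerivAt_const t ((0 : ℂ), (0 : ℂ)), mem_univ _⟩)
    (by simp [h0, h1])
  exact congrArg Prod.fst (congrFun this x)

/-! ### Absence of eigenvalues in `[4, ∞)` -/

section Embedded

variable {W : ℝ → ℝ} {C E : ℝ} {F F₁ : ℝ → ℂ}

/-- Lower bound for the decay of solutions. -/
theorem energy_lower_bound (hW : ∀ x, |W x| ≤ C * Real.exp (-|x|))
    (hF : ∀ x, HasDerivAt F (F₁ x) x)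
    (hF₁ : ∀ x, HasDerivAt F₁ (((W x - E : ℝ) : ℂ) * F x) x) {κ : ℝ} (hκ : 0 < κ) {x : ℝ}
    (hx : 0 ≤ x) :
    (‖F₁ 0‖ ^ 2 + κ ^ 2 * ‖F 0‖ ^ 2) * Real.exp (-(C / κ))
      ≤ (‖F₁ x‖ ^ 2 + κ ^ 2 * ‖F x‖ ^ 2) * Real.exp (|κ ^ 2 - E| / κ * x) := by
  set δ := |κ ^ 2 - E| / κ with hδ
  set e : ℝ → ℝ := fun x => ‖F₁ x‖ ^ 2 + κ ^ 2 * ‖F x‖ ^ 2 with he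
  have hC : 0 ≤ C := by
    have := (abs_nonneg _).trans (hW 0)
    simpa using this
  have hed : ∀ x, HasDerivAt e (2 * (W x - E + κ ^ 2) * inner ℝ (F x) (F₁ x)) x := by
    intro x
    have h1 := ((hF₁ x).norm_sq).add (((hF x).norm_sq).const_mul (κ ^ 2))
    refine h1.congr_deriv ?_
    rw [← Complex.real_smul, inner_smul_right, real_inner_comm]
    ring
  -- The weight solves w' = (δ + (C/κ) e^{-x}) w. From 2κ‖F‖‖F₁‖ ≤ e one gets |e'| ≤ (δ + (C/κ)
  -- e^{-x}) e on x > 0, so e w is nondecreasing there.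
  set w : ℝ → ℝ := fun x => Real.exp (δ * x - C / κ * Real.exp (-x)) with hw
  have hwd : ∀ x, HasDerivAt w (w x * (δ + C / κ * Real.exp (-x))) x := by
    intro x
    have h1 : HasDerivAt (fun x : ℝ => δ * x - C / κ * Real.exp (-x))
        (δ * 1 - C / κ * (Real.exp (-x) * -1)) x :=
      ((hasDerivAt_id x).const_mul δ).sub (((hasDerivAt_id x).neg.exp).const_mul (C / κ))
    convert h1.exp using 1
    simp only [hw]
    ring
  have hm : MonotoneOn (fun x => e x * w x) (Ici 0) := by
    refine monotoneOn_of_hasDerivWithinAt_nonneg (convex_Ici 0)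
      (fun x _ => ((hed x).mul (hwd x)).continuousAt.continuousWithinAt)
      (fun x _ => ((hed x).mul (hwd x)).hasDerivWithinAt) fun x hx => ?_
    rw [interior_Ici, mem_Ioi] at hx
    have hWx : |W x| ≤ C * Real.exp (-x) := by simpa [abs_of_pos hx] using hW x
    have h1 : |inner ℝ (F x) (F₁ x)| ≤ ‖F x‖ * ‖F₁ x‖ := abs_real_inner_le_norm _ _
    have h2 : 2 * κ * (‖F x‖ * ‖F₁ x‖) ≤ e x := by
      simp only [he]
      nlinarith [sq_nonneg (‖F₁ x‖ - κ * ‖F x‖)]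
    have h3 : |W x - E + κ ^ 2| ≤ C * Real.exp (-x) + |κ ^ 2 - E| := by
      have := abs_add_le (W x) (κ ^ 2 - E)
      rw [show W x - E + κ ^ 2 = W x + (κ ^ 2 - E) by ring]
      linarith
    have h4 : |2 * (W x - E + κ ^ 2) * inner ℝ (F x) (F₁ x)|
        ≤ (δ + C / κ * Real.exp (-x)) * e x := by
      rw [abs_mul, abs_mul, abs_two]
      have e1 : δ + C / κ * Real.exp (-x) = (C * Real.exp (-x) + |κ ^ 2 - E|) / κ := by
        rw [hδ]; ring
      rw [e1, div_mul_eq_mul_div, le_div_iff₀ hκ]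
      calc 2 * |W x - E + κ ^ 2| * |inner ℝ (F x) (F₁ x)| * κ
          ≤ 2 * (C * Real.exp (-x) + |κ ^ 2 - E|) * (‖F x‖ * ‖F₁ x‖) * κ := by gcongr
        _ = (C * Real.exp (-x) + |κ ^ 2 - E|) * (2 * κ * (‖F x‖ * ‖F₁ x‖)) := by ring
        _ ≤ _ := by gcongr
    have h5 := neg_le_of_abs_le h4
    have h6 : 0 ≤ (2 * (W x - E + κ ^ 2) * inner ℝ (F x) (F₁ x)
        + (δ + C / κ * Real.exp (-x)) * e x) * w x :=
      mul_nonneg (by linarith) (Real.exp_pos _).le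
    calc (0 : ℝ) ≤ _ := h6
      _ = _ := by ring
  have h := hm (mem_Ici.2 le_rfl) (mem_Ici.2 hx) hx
  have hw0 : w 0 = Real.exp (-(C / κ)) := by simp [hw]
  have hwx : w x ≤ Real.exp (δ * x) := by
    refine Real.exp_le_exp.2 (sub_le_self _ (by positivity))
  calc _ = e 0 * w 0 := by rw [hw0]
    _ ≤ e x * w x := h
    _ ≤ _ := by gcongr

/-- Integrate g from x to y and let y → ∞. Used twice, this gives exponential decay of a threshold
solution and of its derivative. -/
theorem norm_le_exp_of_deriv {G g : ℝ → ℂ} {A : ℝ} (hG : ∀ x, HasDerivAt G (g x) x)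
    (hg : Continuous g) (hb : ∀ x, 0 ≤ x → ‖g x‖ ≤ A * Real.exp (-x))
    (hlim : Tendsto G atTop (𝓝 0)) {x : ℝ} (hx : 0 ≤ x) : ‖G x‖ ≤ A * Real.exp (-x) := by
  have hA : 0 ≤ A := by
    have := (norm_nonneg _).trans (hb 0 le_rfl)
    simpa using this
  have h1 : ∀ y, x ≤ y → ‖G y - G x‖ ≤ A * Real.exp (-x) := by
    intro y hxy
    rw [← intervalIntegral.integral_eq_sub_of_hasDerivAt (fun t _ => hG t)
      (hg.intervalIntegrable x y)]
    have hc : Continuous fun t : ℝ => A * Real.exp (-t) := by fun_prop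
    refine (intervalIntegral.norm_integral_le_of_norm_le hxy
      (Eventually.of_forall fun t ht => hb t (hx.trans ht.1.le))
      (hc.intervalIntegrable x y)).trans ?_
    rw [intervalIntegral.integral_const_mul, intervalIntegral.integral_comp_neg
      (f := fun t => Real.exp t), integral_exp]
    have := (Real.exp_pos (-y)).le
    gcongr
    linarith
  have h2 : Tendsto (fun y => ‖G y - G x‖) atTop (𝓝 ‖0 - G x‖) := (hlim.sub_const _).norm
  have h3 := le_of_tendsto h2 ((eventually_ge_atTop x).mono h1)
  simpa using h3

/-- Both ‖G‖² and its derivative 2⟨G, G₁⟩ are integrable, so ‖G‖² tends to 0. -/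
theorem tendsto_zero_of_memLp {G G₁ : ℝ → ℂ} (hG : ∀ x, HasDerivAt G (G₁ x) x)
    (h : MemLp G 2) (h₁ : MemLp G₁ 2) : Tendsto G atTop (𝓝 0) := by
  have hi : Integrable fun x => 2 * inner ℝ (G x) (G₁ x) := by
    refine Integrable.const_mul ?_ 2
    have := h.integrable_mul (MemLp.star h₁)
    refine this.re.congr (Eventually.of_forall fun x => ?_)
    simp [Complex.inner]
    ring
  have := tendsto_zero_of_hasDerivAt_of_integrableOn_Ioi (a := 0)
    (fun x _ => (hG x).norm_sq) hi.integrableOn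
    ((memLp_two_iff_integrable_sq_norm h.1).1 h).integrableOn
  have h2 := this.sqrt
  rw [tendsto_zero_iff_norm_tendsto_zero]
  simpa [Real.sqrt_sq (norm_nonneg _)] using h2

/-- Solutions in `L²` of `-F'' + W F = E F` with `E ≥ 0` and `W` exponentially decaying
vanish. -/
theorem eq_zero_of_nonneg_energy (hWc : Continuous W) (hW : ∀ x, |W x| ≤ C * Real.exp (-|x|))
    (hF : ∀ x, HasDerivAt F (F₁ x) x)
    (hF₁ : ∀ x, HasDerivAt F₁ (((W x - E : ℝ) : ℂ) * F x) x) (hE : 0 ≤ E) (h : MemLp F 2)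
    (h₁ : MemLp F₁ 2) (x : ℝ) : F x = 0 := by
  have hFc : Continuous F := continuous_iff_continuousAt.2 fun x => (hF x).continuousAt
  have hC : 0 ≤ C := by
    have := (abs_nonneg _).trans (hW 0)
    simpa using this
  have hWC : ∀ x, |W x| ≤ C := fun x => (hW x).trans
    (mul_le_of_le_one_right hC (Real.exp_le_one_iff.2 (by simp)))
  suffices ∃ κ : ℝ, 0 < κ ∧ (‖F₁ 0‖ ^ 2 + κ ^ 2 * ‖F 0‖ ^ 2) * Real.exp (-(C / κ)) ≤ 0 by
    obtain ⟨κ, hκ, h0⟩ := this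
    have h1 : ‖F₁ 0‖ ^ 2 + κ ^ 2 * ‖F 0‖ ^ 2 ≤ 0 := by
      by_contra hc
      exact absurd h0 (not_le.2 (mul_pos (not_le.1 hc) (Real.exp_pos _)))
    have h2 : 0 ≤ κ ^ 2 * ‖F 0‖ ^ 2 := by positivity
    have h3 : ‖F₁ 0‖ ^ 2 = 0 := le_antisymm (by linarith) (by positivity)
    have h4 : κ ^ 2 * ‖F 0‖ ^ 2 = 0 := le_antisymm (by nlinarith [sq_nonneg ‖F₁ 0‖]) h2
    have h5 : ‖F 0‖ ^ 2 = 0 := (mul_eq_zero.1 h4).resolve_left (by positivity)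
    refine eq_zero_of_initial (q := fun x => ((W x - E : ℝ) : ℂ)) (K := C + E) (fun x => ?_)
      hF hF₁ (c := 0) (by simpa using h5) (by simpa using h3) x
    rw [Complex.norm_real, Real.norm_eq_abs]
    have := abs_sub (W x) E
    rw [abs_of_nonneg hE] at this
    linarith [hWC x]
  rcases hE.eq_or_lt with rfl | hE
  -- At the threshold E = 0 the choice κ = 1/2 bounds the energy below by a multiple of e^{-x/2}.
  -- Integrating F'' = W F twice from infinity bounds it above by a multiple of e^{-2x}, so the
  -- multiple in the lower bound is zero.
  · refine ⟨1 / 2, by norm_num, ?_⟩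
    have hF₂ : MemLp (fun x => ((W x - 0 : ℝ) : ℂ) * F x) 2 := by
      refine h.of_le_mul (c := C) ?_ (Eventually.of_forall fun x => ?_)
      · exact (Continuous.aestronglyMeasurable (by fun_prop))
      · rw [norm_mul, Complex.norm_real, Real.norm_eq_abs, sub_zero]
        gcongr
        exact hWC x
    have hlim := tendsto_zero_of_memLp hF h h₁
    have hlim₁ := tendsto_zero_of_memLp hF₁ h₁ hF₂
    obtain ⟨B, hB⟩ : ∃ B, ∀ x, 0 ≤ x → ‖F x‖ ≤ B := by
      obtain ⟨y, hy⟩ := (hlim.norm.eventually_le_const (u := 1) (by simp)).exists_forall_of_atTop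
      obtain ⟨B, hB⟩ := (isCompact_Icc (a := 0) (b := y)).exists_bound_of_continuousOn
        hFc.continuousOn
      refine ⟨max B 1, fun x hx => ?_⟩
      rcases le_total x y with hxy | hxy
      · exact (hB x ⟨hx, hxy⟩).trans (le_max_left _ _)
      · exact (hy x hxy).trans (le_max_right _ _)
    have hb₁ : ∀ x, 0 ≤ x → ‖F₁ x‖ ≤ C * B * Real.exp (-x) := fun x hx =>
      norm_le_exp_of_deriv hF₁ (by fun_prop) (fun t ht => by
        rw [norm_mul, Complex.norm_real, Real.norm_eq_abs, sub_zero]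
        have := hW t
        rw [abs_of_nonneg ht] at this
        calc |W t| * ‖F t‖ ≤ (C * Real.exp (-t)) * B :=
              mul_le_mul this (hB t ht) (norm_nonneg _) (by positivity)
          _ = _ := by ring) hlim₁ hx
    have hF₁c : Continuous F₁ := continuous_iff_continuousAt.2 fun x => (hF₁ x).continuousAt
    have hb : ∀ x, 0 ≤ x → ‖F x‖ ≤ C * B * Real.exp (-x) := fun x hx =>
      norm_le_exp_of_deriv hF hF₁c hb₁ hlim hx
    set A := C * B with hA
    have hbound : ∀ x, 0 ≤ x → (‖F₁ 0‖ ^ 2 + (1 / 2) ^ 2 * ‖F 0‖ ^ 2) * Real.exp (-(C / (1 / 2)))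
        ≤ 2 * A ^ 2 * Real.exp (-(3 / 2 * x)) := by
      intro x hx
      refine (energy_lower_bound hW hF hF₁ (κ := 1 / 2) (by norm_num) hx).trans ?_
      have e1 : |(1 / 2 : ℝ) ^ 2 - 0| / (1 / 2) * x = 1 / 2 * x := by norm_num
      rw [e1]
      have e2 : ‖F₁ x‖ ^ 2 ≤ (A * Real.exp (-x)) ^ 2 := by gcongr; exact hb₁ x hx
      have e3 : ‖F x‖ ^ 2 ≤ (A * Real.exp (-x)) ^ 2 := by gcongr; exact hb x hx
      have e4 : ‖F₁ x‖ ^ 2 + (1 / 2) ^ 2 * ‖F x‖ ^ 2 ≤ 2 * (A * Real.exp (-x)) ^ 2 := by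
        nlinarith [sq_nonneg ‖F x‖]
      have e5 : Real.exp (-(3 / 2 * x)) = Real.exp (-x) ^ 2 * Real.exp (1 / 2 * x) := by
        rw [← Real.exp_nat_mul, ← Real.exp_add]
        congr 1
        push_cast
        ring
      rw [e5]
      calc _ ≤ 2 * (A * Real.exp (-x)) ^ 2 * Real.exp (1 / 2 * x) := by gcongr
        _ = _ := by ring
    have ht : Tendsto (fun x : ℝ => 2 * A ^ 2 * Real.exp (-(3 / 2 * x))) atTop (𝓝 0) := by
      have h1 : Tendsto (fun x : ℝ => 3 / 2 * x) atTop atTop :=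
        tendsto_id.const_mul_atTop (by norm_num)
      simpa using (Real.tendsto_exp_neg_atTop_nhds_zero.comp h1).const_mul (2 * A ^ 2)
    exact ge_of_tendsto ht ((eventually_ge_atTop 0).mono hbound)
  -- With κ = √E the exponent |κ² − E|/κ is zero, so the energy is at least c on the whole
  -- half-line. It is integrable, which forces c = 0.
  · refine ⟨Real.sqrt E, Real.sqrt_pos.2 hE, ?_⟩
    set c := (‖F₁ 0‖ ^ 2 + Real.sqrt E ^ 2 * ‖F 0‖ ^ 2) * Real.exp (-(C / Real.sqrt E)) with hc
    have hc0 : 0 ≤ c := by positivity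
    have hle : ∀ x, 0 ≤ x → c ≤ ‖F₁ x‖ ^ 2 + Real.sqrt E ^ 2 * ‖F x‖ ^ 2 := by
      intro x hx
      have := energy_lower_bound hW hF hF₁ (Real.sqrt_pos.2 hE) hx
      rw [hc]
      simpa [Real.sq_sqrt hE.le] using this
    have hint : Integrable fun x => ‖F₁ x‖ ^ 2 + Real.sqrt E ^ 2 * ‖F x‖ ^ 2 :=
      ((memLp_two_iff_integrable_sq_norm h₁.1).1 h₁).add
        (((memLp_two_iff_integrable_sq_norm h.1).1 h).const_mul _)
    have : IntegrableOn (fun _ => c) (Ioi (0 : ℝ)) := by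
      refine Integrable.mono (hint.integrableOn (s := Ioi 0)) aestronglyMeasurable_const ?_
      filter_upwards [ae_restrict_mem measurableSet_Ioi] with x hx
      rw [Real.norm_of_nonneg hc0, Real.norm_of_nonneg (by positivity)]
      exact hle x (mem_Ioi.1 hx).le
    rw [integrableOn_const_iff] at this
    rcases this with h | h
    · exact (by simpa using h : c = 0).le
    · simp at h

/-- There are no eigenvalues in `[4, ∞)`. -/
theorem not_isEigenvalue_of_four_le (hWc : Continuous W)
    (hW : ∀ x, |W x| ≤ C * Real.exp (-|x|)) {r : ℝ} (hr : 4 ≤ r) :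
    ¬ IsEigenvalue (fun x => 4 + W x) r := by
  rintro ⟨u, hu, hg⟩
  obtain ⟨F, F₁, huF, hF, hF₁, h, h₁⟩ := exists_classical (by fun_prop) hg
  refine hu ((Lp.eq_zero_iff_ae_eq_zero).2 ?_)
  filter_upwards [huF] with x hx
  rw [hx]
  refine eq_zero_of_nonneg_energy (E := r - 4) hWc hW hF (fun x => ?_) (by linarith) h h₁ x
  convert hF₁ x using 2
  push_cast
  ring

end Embedded

/-! ### Weyl sequences -/

theorem integrable_inv_one_add_mul_sq {ε : ℝ} (hε : ε ≠ 0) :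
    Integrable fun x : ℝ => (1 + (ε * x) ^ 2)⁻¹ :=
  integrable_inv_one_add_sq.comp_mul_left' hε

/-- Approximate eigenfunctions of `-∂² + 4 + W`. -/
theorem exists_approx_eigenvector {W : ℝ → ℝ} (hc : Continuous W) (hb : ∃ C, ∀ x, |W x| ≤ C)
    (hW : MemLp W 2) (κ : ℝ) {ε : ℝ} (hε : 0 < ε) (hε1 : ε ≤ 1) :
    ∃ u f : L2, (u, f) ∈ (schrodingerGraph fun x => 4 + W x) ∧
      ‖u‖ ^ 2 = ε⁻¹ * ∫ x : ℝ, ((1 + x ^ 2)⁻¹) ^ 2 ∧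
      ‖f - ((4 + κ ^ 2 : ℝ) : ℂ) • u‖ ^ 2 ≤
        2 * ((10 + 2 * |κ|) * ε) ^ 2 * ‖u‖ ^ 2 + 2 * ∫ x, W x ^ 2 := by
  -- The trial function is G(x) e^{iκx}. This profile satisfies |G'| ≤ ε G and |G''| ≤ 10 ε² G
  -- pointwise, so the kinetic error is a small multiple of u. The error from W is at most ‖W‖ in
  -- L², whatever ε, while ‖u‖² grows like 1/ε.
  set G : ℝ → ℝ := fun x => (1 + (ε * x) ^ 2)⁻¹ with hG
  set G₁ : ℝ → ℝ := fun x => -2 * ε ^ 2 * x * G x ^ 2 with hG₁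
  set G₂ : ℝ → ℝ := fun x => -2 * ε ^ 2 * G x ^ 2 + 8 * ε ^ 4 * x ^ 2 * G x ^ 3 with hG₂
  have hpos : ∀ x : ℝ, 0 < 1 + (ε * x) ^ 2 := fun x => by positivity
  have hG0 : ∀ x, 0 < G x := fun x => inv_pos.2 (hpos x)
  have hGle : ∀ x, G x ≤ 1 := fun x => inv_le_one_of_one_le₀ (by nlinarith [sq_nonneg (ε * x)])
  have hGm : ∀ x, G x * (1 + (ε * x) ^ 2) = 1 := fun x => inv_mul_cancel₀ (hpos x).ne'
  have hGc : Continuous G := by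
    refine Continuous.inv₀ (by fun_prop) fun x => (hpos x).ne'
  have hGd : ∀ x, HasDerivAt G (G₁ x) x := by
    intro x
    have h1 : HasDerivAt (fun x : ℝ => 1 + (ε * x) ^ 2) (2 * ε ^ 2 * x) x := by
      have := (((hasDerivAt_id x).const_mul ε).pow 2).const_add 1
      refine this.congr_deriv ?_
      simp
      ring
    refine (h1.inv (hpos x).ne').congr_deriv ?_
    simp only [hG₁, hG]
    field_simp
  have hG₁d : ∀ x, HasDerivAt G₁ (G₂ x) x := by
    intro x
    have h1 := ((hasDerivAt_id x).const_mul (-2 * ε ^ 2)).mul ((hGd x).pow 2)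
    refine h1.congr_deriv ?_
    simp only [hG₂, hG₁, id_eq, Pi.pow_apply, Nat.cast_ofNat]
    ring
  have hG₁b : ∀ x, |G₁ x| ≤ ε * G x := by
    intro x
    have h1 : 2 * |ε * x| ≤ 1 + (ε * x) ^ 2 := by
      nlinarith [sq_nonneg (|ε * x| - 1), sq_abs (ε * x)]
    have h2 : |G₁ x| = ε * (2 * |ε * x| * G x) * G x := by
      simp only [hG₁]
      rw [show -2 * ε ^ 2 * x * G x ^ 2 = (-2 * ε * G x ^ 2) * (ε * x) by ring, abs_mul, abs_mul,
        abs_mul, abs_neg, abs_two, abs_of_pos hε, abs_of_pos (pow_pos (hG0 x) 2)]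
      ring
    have h3 : 2 * |ε * x| * G x ≤ 1 := by
      rw [← hGm x, mul_comm (G x)]
      exact mul_le_mul_of_nonneg_right h1 (hG0 x).le
    rw [h2]
    have := mul_le_mul_of_nonneg_left h3 hε.le
    rw [mul_one] at this
    exact mul_le_mul_of_nonneg_right this (hG0 x).le
  have hG₂b : ∀ x, |G₂ x| ≤ 10 * ε ^ 2 * G x := by
    intro x
    have h1 : (ε * x) ^ 2 * G x ≤ 1 := by nlinarith [hGm x, hG0 x]
    have h1' : 0 ≤ (ε * x) ^ 2 * G x := mul_nonneg (sq_nonneg _) (hG0 x).le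
    have h2 : G x ^ 2 ≤ G x := by nlinarith [hG0 x, hGle x]
    have h3 : G₂ x = ε ^ 2 * G x ^ 2 * (8 * ((ε * x) ^ 2 * G x) - 2) := by
      simp only [hG₂]; ring
    rw [h3, abs_mul, abs_of_nonneg (by positivity)]
    calc ε ^ 2 * G x ^ 2 * |8 * ((ε * x) ^ 2 * G x) - 2| ≤ ε ^ 2 * G x * 10 := by
          gcongr
          rw [abs_le]
          constructor <;> linarith
      _ = _ := by ring
  set e : ℝ → ℂ := fun x => Complex.exp (κ * x * Complex.I) with he
  have hen : ∀ x, ‖e x‖ = 1 := fun x => by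
    simp only [he]
    exact_mod_cast Complex.norm_exp_ofReal_mul_I (κ * x)
  have hed : ∀ x, HasDerivAt e (e x * (κ * Complex.I)) x := by
    intro x
    have := (((hasDerivAt_id x).ofReal_comp.const_mul (κ : ℂ)).mul_const Complex.I).cexp
    refine this.congr_deriv ?_
    simp [he]
  have hec : Continuous e := continuous_iff_continuousAt.2 fun x => (hed x).continuousAt
  have hG₁c : Continuous G₁ := continuous_iff_continuousAt.2 fun x => (hG₁d x).continuousAt
  have hG₂c : Continuous G₂ := by fun_prop
  set F : ℝ → ℂ := fun x => G x * e x with hF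
  set F₁ : ℝ → ℂ := fun x => G₁ x * e x + G x * (e x * (κ * Complex.I)) with hF₁
  set F₂ : ℝ → ℂ := fun x => (G₂ x * e x + G₁ x * (e x * (κ * Complex.I))) +
    (G₁ x * (e x * (κ * Complex.I)) + G x * (e x * (κ * Complex.I) * (κ * Complex.I))) with hF₂
  have hFd : ∀ x, HasDerivAt F (F₁ x) x := fun x => ((hGd x).ofReal_comp).mul (hed x)
  have hF₁d : ∀ x, HasDerivAt F₁ (F₂ x) x := fun x =>
    (((hG₁d x).ofReal_comp).mul (hed x)).add
      (((hGd x).ofReal_comp).mul ((hed x).mul_const (κ * Complex.I)))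
  have hGi : Integrable fun x => G x ^ 2 := by
    refine (integrable_inv_one_add_mul_sq hε.ne').mono (hGc.pow 2).aestronglyMeasurable
      (Eventually.of_forall fun x => ?_)
    rw [Real.norm_of_nonneg (by positivity), Real.norm_of_nonneg (hG0 x).le]
    nlinarith [hG0 x, hGle x]
  have hGL : MemLp G 2 := by
    rw [memLp_two_iff_integrable_sq_norm hGc.aestronglyMeasurable]
    simpa using hGi
  have hFn : ∀ x, ‖F x‖ = G x := fun x => by
    simp only [hF]
    rw [norm_mul, hen, mul_one, Complex.norm_real, Real.norm_of_nonneg (hG0 x).le]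
  have hκI : ‖(κ : ℂ) * Complex.I‖ = |κ| := by simp
  have hFL : MemLp F 2 := hGL.of_le_mul (c := 1) (by fun_prop : Continuous F).aestronglyMeasurable
    (Eventually.of_forall fun x => by
      rw [hFn, Real.norm_of_nonneg (hG0 x).le, one_mul])
  have hF₁L : MemLp F₁ 2 := by
    refine hGL.of_le_mul (c := ε + |κ|) (by fun_prop : Continuous F₁).aestronglyMeasurable
      (Eventually.of_forall fun x => ?_)
    simp only [hF₁]
    refine (norm_add_le _ _).trans ?_
    rw [norm_mul, norm_mul, norm_mul, hen, hκI, Complex.norm_real, Complex.norm_real, one_mul,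
      mul_one, Real.norm_eq_abs, Real.norm_of_nonneg (hG0 x).le]
    linarith [hG₁b x]
  have hF₂L : MemLp F₂ 2 := by
    refine hGL.of_le_mul (c := 10 * ε ^ 2 + 2 * |κ| * ε + |κ| ^ 2)
      (by fun_prop : Continuous F₂).aestronglyMeasurable (Eventually.of_forall fun x => ?_)
    simp only [hF₂]
    refine (norm_add_le _ _).trans ((add_le_add (norm_add_le _ _) (norm_add_le _ _)).trans ?_)
    simp only [norm_mul, hen, Complex.norm_real, one_mul, mul_one, Real.norm_eq_abs,
      Complex.norm_I, abs_of_pos (hG0 x)]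
    nlinarith [hG₁b x, hG₂b x, mul_le_mul_of_nonneg_right (hG₁b x) (abs_nonneg κ)]
  have hfL : MemLp (fun x => -F₂ x + ((4 + W x : ℝ) : ℂ) * F x) 2 := by
    refine hF₂L.neg.add ?_
    obtain ⟨C, hC⟩ := hb
    refine hFL.of_le_mul (c := 4 + C)
      (by fun_prop : Continuous fun x => ((4 + W x : ℝ) : ℂ) * F x).aestronglyMeasurable
      (Eventually.of_forall fun x => ?_)
    rw [norm_mul, Complex.norm_real, Real.norm_eq_abs]
    gcongr
    refine (abs_add_le _ _).trans ?_
    have : |(4 : ℝ)| = 4 := abs_of_pos (by norm_num)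
    linarith [hC x]
  have hu2 : ‖hFL.toLp‖ ^ 2 = ∫ x, G x ^ 2 := by
    rw [L2_norm_sq]
    refine integral_congr_ae ?_
    filter_upwards [hFL.coeFn_toLp] with x hx
    rw [hx, hFn]
  refine ⟨hFL.toLp, hfL.toLp, mem_graph_of_classical hFL.coeFn_toLp hFd hF₁d (by fun_prop)
    hF₁L hF₂L hfL.coeFn_toLp, ?_, ?_⟩
  · rw [hu2]
    have := Measure.integral_comp_mul_left (fun x : ℝ => ((1 + x ^ 2)⁻¹) ^ 2) ε
    simp only [hG]
    rw [this, abs_of_pos (inv_pos.2 hε), smul_eq_mul]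
  · have hWi : Integrable fun x => W x ^ 2 := by
      simpa using (memLp_two_iff_integrable_sq_norm hW.1).1 hW
    rw [hu2, ← integral_const_mul, ← integral_const_mul,
      ← integral_add (hGi.const_mul _) (hWi.const_mul _), L2_norm_sq]
    refine integral_mono_ae (L2_integrable_norm_sq _)
      ((hGi.const_mul _).add (hWi.const_mul _)) ?_
    filter_upwards [hFL.coeFn_toLp, hfL.coeFn_toLp,
      Lp.coeFn_sub hfL.toLp (((4 + κ ^ 2 : ℝ) : ℂ) • hFL.toLp),
      Lp.coeFn_smul ((4 + κ ^ 2 : ℝ) : ℂ) hFL.toLp] with x h1 h2 h3 h4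
    rw [h3, Pi.sub_apply, h4, Pi.smul_apply, h1, h2, smul_eq_mul]
    have e1 : -F₂ x + ((4 + W x : ℝ) : ℂ) * F x - ((4 + κ ^ 2 : ℝ) : ℂ) * F x
        = (-(G₂ x : ℂ) + -(2 * G₁ x * (κ * Complex.I)) + W x * G x) * e x := by
      simp only [hF₂, hF]
      push_cast
      linear_combination -(G x : ℂ) * e x * κ ^ 2 * Complex.I_sq
    have e2 : ‖-(G₂ x : ℂ) + -(2 * G₁ x * (κ * Complex.I)) + W x * G x‖
        ≤ (10 + 2 * |κ|) * ε * G x + |W x| := by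
      refine (norm_add₃_le).trans ?_
      simp only [norm_neg, norm_mul, Complex.norm_real, Real.norm_eq_abs, Complex.norm_I, mul_one,
        Complex.norm_ofNat, abs_of_pos (hG0 x)]
      have h5 : |W x| * G x ≤ |W x| := mul_le_of_le_one_right (abs_nonneg _) (hGle x)
      have h6 : 2 * |G₁ x| * |κ| ≤ 2 * (ε * G x) * |κ| := by gcongr; exact hG₁b x
      have h7 : 10 * ε ^ 2 * G x ≤ 10 * ε * G x := by
        have : ε ^ 2 ≤ ε := by nlinarith
        have := hG0 x
        gcongr
      nlinarith [hG₂b x]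
    rw [e1, norm_mul, hen, mul_one]
    refine (pow_le_pow_left₀ (norm_nonneg _) e2 2).trans ?_
    nlinarith [sq_nonneg ((10 + 2 * |κ|) * ε * G x - |W x|), sq_abs (W x)]

theorem integral_inv_one_add_sq_sq_pos : 0 < ∫ x : ℝ, ((1 + x ^ 2)⁻¹) ^ 2 := by
  have hpos : ∀ x : ℝ, 0 < ((1 + x ^ 2)⁻¹) ^ 2 := fun x => by positivity
  have hc : Continuous fun x : ℝ => (1 + x ^ 2)⁻¹ :=
    Continuous.inv₀ (by fun_prop) fun x => by positivity
  refine (integral_pos_iff_support_of_nonneg (fun x => (hpos x).le) ?_).2 ?_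
  · refine integrable_inv_one_add_sq.mono (hc.pow 2).aestronglyMeasurable
      (Eventually.of_forall fun x => ?_)
    have h1 : (1 + x ^ 2)⁻¹ ≤ 1 := inv_le_one_of_one_le₀ (by nlinarith [sq_nonneg x])
    have h0 : 0 < (1 + x ^ 2)⁻¹ := by positivity
    rw [Real.norm_of_nonneg (hpos x).le, Real.norm_of_nonneg h0.le]
    nlinarith
  · have : Function.support (fun x : ℝ => ((1 + x ^ 2)⁻¹) ^ 2) = univ :=
      eq_univ_of_forall fun x => (hpos x).ne'
    rw [this]
    simp

/-- The half-line `[4, ∞)` lies in the spectrum. -/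
theorem mem_spectrum_of_four_le {W : ℝ → ℝ} (hc : Continuous W) (hb : ∃ C, ∀ x, |W x| ≤ C)
    (hW : MemLp W 2) {r : ℝ} (hr : 4 ≤ r) :
    (r : ℂ) ∈ spectrum (schrodinger fun x => 4 + W x) := by
  intro hz
  obtain ⟨R, -, hR⟩ := mem_resolventSet_iff.1 hz
  set N := ∫ x : ℝ, ((1 + x ^ 2)⁻¹) ^ 2 with hN
  set Ω := ∫ x, W x ^ 2 with hΩ
  set D := 10 + 2 * |Real.sqrt (r - 4)| with hD
  have hr' : 4 + Real.sqrt (r - 4) ^ 2 = r := by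
    rw [Real.sq_sqrt (by linarith)]; ring
  -- Multiplying ‖u‖² ≤ ‖R‖² ‖(H − r) u‖² by ε leaves the fixed number N > 0 on the left, and on the
  -- right a bound that vanishes as ε → 0.
  have key : ∀ ε ∈ Ioc (0 : ℝ) 1, N ≤ ‖R‖ ^ 2 * (2 * (D * ε) ^ 2 * N + 2 * Ω * ε) := by
    intro ε hε
    obtain ⟨u, f, huf, hu, hf⟩ := exists_approx_eigenvector hc hb hW (Real.sqrt (r - 4)) hε.1 hε.2
    rw [hr'] at hf
    have h1 : ‖u‖ ^ 2 ≤ ‖R‖ ^ 2 * ‖f - (r : ℂ) • u‖ ^ 2 := by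
      rw [← mul_pow]
      have h2 := R.le_opNorm (f - (r : ℂ) • u)
      rw [hR u f huf] at h2
      gcongr
    have h3 : ‖u‖ ^ 2 ≤ ‖R‖ ^ 2 * (2 * (D * ε) ^ 2 * ‖u‖ ^ 2 + 2 * Ω) :=
      h1.trans (by gcongr)
    rw [hu, ← hN] at h3
    have h4 := mul_le_mul_of_nonneg_left h3 hε.1.le
    have hε0 := hε.1.ne'
    calc N = ε * (ε⁻¹ * N) := by field_simp
      _ ≤ _ := h4
      _ = _ := by field_simp
  have hlim : Tendsto (fun ε : ℝ => ‖R‖ ^ 2 * (2 * (D * ε) ^ 2 * N + 2 * Ω * ε)) (𝓝[>] 0)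
      (𝓝 0) := by
    have : Continuous fun ε : ℝ => ‖R‖ ^ 2 * (2 * (D * ε) ^ 2 * N + 2 * Ω * ε) := by fun_prop
    have h := (this.tendsto 0).mono_left (nhdsWithin_le_nhds (s := Ioi 0))
    simpa using h
  have hle : N ≤ 0 := by
    refine ge_of_tendsto hlim ?_
    filter_upwards [Ioc_mem_nhdsGT (zero_lt_one (α := ℝ))] with ε hε using key ε hε
  exact absurd integral_inv_one_add_sq_sq_pos (not_lt.2 hle)

/-! ### Positivity and the ground state -/

/-- `f` is dominated by the nonnegative function `g`. -/
def Dominated (f g : L2) : Prop := ∀ᵐ x, ‖f x‖ ≤ (g x).re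

/-- The absolute value of a function in `L²`. -/
def absL (f : L2) : L2 := ((Lp.memLp f).norm.ofReal : MemLp (fun x => ((‖f x‖ : ℝ) : ℂ)) 2).toLp

theorem absL_ae (f : L2) : ∀ᵐ x, absL f x = ((‖f x‖ : ℝ) : ℂ) :=
  MemLp.coeFn_toLp (Lp.memLp f).norm.ofReal

theorem norm_absL (f : L2) : ‖absL f‖ = ‖f‖ := by
  refine le_antisymm (Lp.norm_le_norm_of_ae_le ?_) (Lp.norm_le_norm_of_ae_le ?_)
  all_goals
    filter_upwards [absL_ae f] with x hx
    rw [hx]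
    simp

theorem dominated_absL (f : L2) : Dominated f (absL f) := by
  filter_upwards [absL_ae f] with x hx
  rw [hx]
  simp

theorem Dominated.add {f g f' g' : L2} (h : Dominated f g) (h' : Dominated f' g') :
    Dominated (f + f') (g + g') := by
  filter_upwards [h, h', Lp.coeFn_add f f', Lp.coeFn_add g g'] with x h1 h2 h3 h4
  rw [h3, h4]
  exact (norm_add_le _ _).trans (add_le_add h1 h2)

theorem Dominated.sum {f g : ℕ → L2} (h : ∀ i, Dominated (f i) (g i)) (n : ℕ) :
    Dominated (∑ i ∈ Finset.range n, f i) (∑ i ∈ Finset.range n, g i) := by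
  induction n with
  | zero =>
    filter_upwards [Lp.coeFn_zero ℂ 2 (volume : Measure ℝ)] with x hx
    simp only [Finset.range_zero, Finset.sum_empty]
    rw [hx]
    simp
  | succ n ih =>
    rw [Finset.sum_range_succ, Finset.sum_range_succ]
    exact ih.add (h n)

theorem Dominated.re_inner_le {f g : L2} (h : Dominated f g) (v : L2) :
    (inner ℂ f v).re ≤ (inner ℂ g (absL v)).re := by
  have e : ∀ a b : L2, (inner ℂ a b).re = ∫ x, (inner ℂ (a x) (b x)).re := fun a b => by
    rw [L2.inner_def]
    exact (integral_re (L2.integrable_inner (𝕜 := ℂ) a b)).symm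
  rw [e, e]
  refine integral_mono_ae (L2.integrable_inner (𝕜 := ℂ) f v).re
    (L2.integrable_inner (𝕜 := ℂ) g (absL v)).re ?_
  filter_upwards [h, absL_ae v] with x h1 h2
  calc (inner ℂ (f x) (v x)).re ≤ ‖f x‖ * ‖v x‖ :=
        (Complex.re_le_norm _).trans (norm_inner_le_norm (𝕜 := ℂ) (f x) (v x))
    _ ≤ (g x).re * ‖v x‖ := by gcongr
    _ = (inner ℂ (g x) (absL v x)).re := by
        rw [h2]
        simp [mul_comm]

/-- A nonnegative kernel preserves domination, by the triangle inequality under the integral. -/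
theorem conv_dominated {K : ℝ → ℂ} (hK : MemLp K 2) (hKr : ∀ s, K s = ((‖K s‖ : ℝ) : ℂ))
    {f g : L2} (h : Dominated f g) (x : ℝ) : ‖conv K f x‖ ≤ (conv K g x).re := by
  rw [conv, conv]
  have e : (∫ y, K (x - y) * g y).re = ∫ y, (K (x - y) * g y).re :=
    (integral_re (integrable_conv hK g x)).symm
  rw [e]
  refine norm_integral_le_of_norm_le (integrable_conv hK g x).re ?_
  filter_upwards [h] with y hy
  rw [norm_mul, hKr (x - y)]
  simp only [Complex.norm_real, norm_norm, Complex.re_ofReal_mul]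
  gcongr

theorem kerR_eq_norm {k : ℝ} (s : ℝ) : kerR k s = ((‖kerR k s‖ : ℝ) : ℂ) := by
  rw [norm_kerR, kerR]
  by_cases h : s ∈ Ici (0 : ℝ)
  · rw [indicator_of_mem h, indicator_of_mem h]; simp
  · rw [indicator_of_notMem h, indicator_of_notMem h]; simp

theorem kerL_eq_norm {k : ℝ} (s : ℝ) : kerL k s = ((‖kerL k s‖ : ℝ) : ℂ) := by
  rw [norm_kerL, kerL]
  by_cases h : s ∈ Iio (0 : ℝ)
  · rw [indicator_of_mem h, indicator_of_mem h]; simp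
  · rw [indicator_of_notMem h, indicator_of_notMem h]; simp

theorem Dominated.freeResolvent {k : ℝ} (hk : 0 < (k : ℂ).re) {f g : L2} (h : Dominated f g) :
    Dominated (freeResolvent hk f) (freeResolvent hk g) := by
  filter_upwards [freeResolvent_ae hk f, freeResolvent_ae hk g] with x h1 h2
  have hk' : 0 < k := hk
  rw [h1, h2, freeVal, freeVal]
  have e : (2 * (k : ℂ))⁻¹ = (((2 * k)⁻¹ : ℝ) : ℂ) := by push_cast; rfl
  rw [e, norm_mul, Complex.norm_real, Real.norm_of_nonneg (by positivity), Complex.re_ofReal_mul,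
    Complex.add_re]
  gcongr
  exact (norm_add_le _ _).trans (add_le_add (conv_dominated (memLp_kerR hk) kerR_eq_norm h x)
    (conv_dominated (memLp_kerL hk) kerL_eq_norm h x))

/-- The bound is the L¹ norm of the kernel e^{-k|s|}/(2k). -/
theorem norm_freeResolvent_le {k : ℝ} (hk : 0 < (k : ℂ).re) :
    ‖freeResolvent hk‖ ≤ 1 / k ^ 2 := by
  have hk' : 0 < k := hk
  have h1 := norm_convL_le (integrable_kerR hk) (memLp_kerR hk)
  have h2 := norm_convL_le (integrable_kerL hk) (memLp_kerL hk)
  rw [integral_norm_kerR hk] at h1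
  rw [integral_norm_kerL hk] at h2
  rw [freeResolvent, norm_smul]
  have h3 : ‖solveR hk + solveL hk‖ ≤ 1 / k + 1 / k :=
    (norm_add_le _ _).trans (add_le_add h1 h2)
  have h4 : ‖(2 * (k : ℂ))⁻¹‖ = (2 * k)⁻¹ := by
    rw [norm_inv, norm_mul, Complex.norm_real, Real.norm_of_nonneg hk'.le]
    simp
  rw [h4]
  calc (2 * k)⁻¹ * ‖solveR hk + solveL hk‖ ≤ (2 * k)⁻¹ * (1 / k + 1 / k) := by gcongr
    _ = 1 / k ^ 2 := by field_simp; ring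

section GroundState

variable {W : ℝ → ℝ} {C : ℝ}

/-- Eigenvalues are bounded below. -/
theorem IsEigenvalue.lower_bound (hc : Continuous W) (hC : ∀ x, |W x| ≤ C) {r : ℝ}
    (h : IsEigenvalue (fun x => 4 + W x) r) : 4 - C ≤ r := by
  have hC0 : 0 ≤ C := (abs_nonneg _).trans (hC 0)
  rcases le_or_gt 4 r with hr | hr
  · linarith
  obtain ⟨u, hu, hg⟩ := h
  have hb : ∃ C, ∀ x, |W x| ≤ C := ⟨C, hC⟩
  -- With k² = 4 − r the eigenvalue equation reads u = −R₀ W u, whence 1 ≤ C/k².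
  set k := Real.sqrt (4 - r) with hkdef
  have hk' : 0 < k := Real.sqrt_pos.2 (by linarith)
  have hk : 0 < (k : ℂ).re := hk'
  have hk2 : k ^ 2 = 4 - r := Real.sq_sqrt (by linarith)
  rw [mem_schrodingerGraph_iff hc hb hk] at hg
  have e : (r : ℂ) • u - (4 - (k : ℂ) ^ 2) • u - mulL W hc hb u = - mulL W hc hb u := by
    rw [← Complex.ofReal_pow, hk2]
    push_cast
    rw [sub_sub_cancel, sub_self, zero_sub]
  rw [e] at hg
  have h1 : ‖u‖ ≤ 1 / k ^ 2 * (C * ‖u‖) := by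
    nth_rewrite 1 [hg]
    refine ((freeResolvent hk).le_opNorm _).trans ?_
    rw [norm_neg]
    exact mul_le_mul (norm_freeResolvent_le hk)
      (((mulL W hc hb).le_opNorm u).trans (by gcongr; exact norm_mulL_le hc hb hC0 hC))
      (norm_nonneg _) (by positivity)
  have hu' : 0 < ‖u‖ := norm_pos_iff.2 hu
  rw [hk2, one_div_mul_eq_div, le_div_iff₀ (by linarith)] at h1
  nlinarith

/-- The resolvent at a sufficiently negative point increases the quadratic form under passage
to absolute values. -/
theorem re_inner_resolvent_le (hc : Continuous W) (hb : ∃ C, ∀ x, |W x| ≤ C)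
    (hneg : ∀ x, W x ≤ 0) (hC : ∀ x, |W x| ≤ C) {k : ℝ} (hk : 0 < k) (hkC : C < k ^ 2)
    {R : L2 →L[ℂ] L2}
    (hR : ∀ y, (R y, y + (4 - (k : ℂ) ^ 2) • R y) ∈ schrodingerGraph fun x => 4 + W x)
    (f : L2) : (inner ℂ (R f) f).re ≤ (inner ℂ (R (absL f)) (absL f)).re := by
  have hC0 : 0 ≤ C := (abs_nonneg _).trans (hC 0)
  have hk' : 0 < (k : ℂ).re := hk
  set R₀ := freeResolvent hk' with hR₀
  set M := mulL W hc hb with hM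
  -- As ‖M‖ ‖R₀‖ ≤ C/k² < 1, the resolvent is R₀ Σ Qⁿ. Both −W and the kernel of R₀ are nonnegative,
  -- so every partial sum preserves domination, in particular that of f by |f|.
  set Q : L2 →L[ℂ] L2 := -(M ∘L R₀) with hQ
  have hQn : ‖Q‖ < 1 := by
    rw [hQ, norm_neg]
    calc ‖M ∘L R₀‖ ≤ ‖M‖ * ‖R₀‖ := ContinuousLinearMap.opNorm_comp_le _ _
      _ ≤ C * (1 / k ^ 2) := mul_le_mul (norm_mulL_le hc hb hC0 hC) (norm_freeResolvent_le hk')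
          (norm_nonneg _) hC0
      _ < 1 := by
          rw [mul_one_div, div_lt_one (by positivity)]
          exact hkC
  have hRS : ∀ y, R y = R₀ ((∑' n : ℕ, Q ^ n) y) := by
    intro y
    have h1 := (mem_schrodingerGraph_iff hc hb hk' _ _).1 (hR y)
    rw [add_sub_cancel_right] at h1
    set s := y - M (R y) with hs
    have h2 : (1 - Q) s = y := by
      rw [hQ, sub_neg_eq_add]
      change s + M (R₀ s) = y
      rw [← h1, hs, sub_add_cancel]
    have h3 := DFunLike.congr_fun (geom_series_mul_neg Q hQn) s
    have h4 : (∑' n : ℕ, Q ^ n) ((1 - Q) s) = s := h3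
    rw [h2] at h4
    rw [h4]
    exact h1
  have hQd : ∀ a b : L2, Dominated a b → Dominated (Q a) (Q b) := by
    intro a b hab
    have h1 := hab.freeResolvent hk'
    have e : ∀ v : L2, ∀ᵐ x, Q v x = -(W x : ℂ) * R₀ v x := fun v => by
      filter_upwards [Lp.coeFn_neg (M (R₀ v)), mulL_ae hc hb (R₀ v)] with x h2 h3
      have : Q v = -(M (R₀ v)) := rfl
      rw [this, h2, Pi.neg_apply, h3, neg_mul]
    filter_upwards [h1, e a, e b] with x h2 h3 h4
    rw [h3, h4, norm_mul, norm_neg, Complex.norm_real, Real.norm_eq_abs,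
      abs_of_nonpos (hneg x), ← Complex.ofReal_neg, Complex.re_ofReal_mul]
    exact mul_le_mul_of_nonneg_left h2 (neg_nonneg.2 (hneg x))
  have hQpow : ∀ n, Dominated ((Q ^ n) f) ((Q ^ n) (absL f)) := by
    intro n
    induction n with
    | zero => exact dominated_absL f
    | succ n ih =>
      rw [pow_succ']
      exact hQd _ _ ih
  have hsum : HasSum (fun n : ℕ => Q ^ n) (∑' n : ℕ, Q ^ n) :=
    (summable_geometric_of_norm_lt_one hQn).hasSum
  have hlim : ∀ y v : L2, Tendsto
      (fun n => (inner ℂ (R₀ (∑ i ∈ Finset.range n, (Q ^ i) y)) v).re) atTop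
      (𝓝 (inner ℂ (R y) v).re) := by
    intro y v
    have h1 := (hsum.mapL (ContinuousLinearMap.apply ℂ L2 y)).tendsto_sum_nat
    have h2 := (R₀.continuous.tendsto _).comp h1
    have h3 := (h2.inner (𝕜 := ℂ) (tendsto_const_nhds (x := v)))
    rw [hRS y]
    exact (Complex.continuous_re.tendsto _).comp h3
  refine le_of_tendsto_of_tendsto' (hlim f f) (hlim (absL f) (absL f)) fun n => ?_
  exact ((Dominated.sum hQpow n).freeResolvent hk').re_inner_le f

/-- Equality case of the norm bound: in the expansion of ‖R|u| − t|u|‖² the two squares are each at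
most t²‖u‖², while the cross term subtracts at least 2t²‖u‖², because replacing u by |u| does not
lower the quadratic form. -/
theorem absL_eigen_of_norm_eq {R : L2 →L[ℂ] L2} {t : ℝ} (ht : 0 ≤ t) (hn : ‖R‖ = t)
    (hpos : ∀ f, (inner ℂ (R f) f).re ≤ (inner ℂ (R (absL f)) (absL f)).re) {u : L2}
    (hu : R u = (t : ℂ) • u) : R (absL u) = (t : ℂ) • absL u := by
  have h1 : t * ‖u‖ ^ 2 ≤ (inner ℂ (R (absL u)) (absL u)).re := by
    refine le_trans (le_of_eq ?_) (hpos u)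
    rw [hu, inner_smul_left, inner_self_eq_norm_sq_to_K, Complex.conj_ofReal, Complex.re_ofReal_mul]
    norm_cast
  have h2 : ‖R (absL u)‖ ≤ t * ‖u‖ := by
    rw [← hn, ← norm_absL u]
    exact R.le_opNorm _
  have h3 : ‖R (absL u) - (t : ℂ) • absL u‖ ^ 2 ≤ 0 := by
    rw [@norm_sub_sq ℂ, inner_smul_right, norm_smul, Complex.norm_real, norm_absL,
      Real.norm_of_nonneg ht]
    simp only [RCLike.re_eq_complex_re, Complex.re_ofReal_mul]
    nlinarith [pow_le_pow_left₀ (norm_nonneg _) h2 2, mul_le_mul_of_nonneg_left h1 ht]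
  have h4 : ‖R (absL u) - (t : ℂ) • absL u‖ = 0 :=
    pow_eq_zero_iff (two_ne_zero) |>.1 (le_antisymm h3 (sq_nonneg _))
  exact sub_eq_zero.1 (norm_eq_zero.1 h4)

/-- If there is an eigenvalue below `4`, then the spectrum has a least element, which is an
eigenvalue below `4`, and the absolute value of each of its eigenvectors is an eigenvector. -/
theorem exists_ground_state (hc : Continuous W) (hneg : ∀ x, W x ≤ 0)
    (hC : ∀ x, |W x| ≤ C) (hW : MemLp W 2) {r₀ : ℝ} (hr₀ : r₀ < 4)
    (he : IsEigenvalue (fun x => 4 + W x) r₀) :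
    ∃ l : ℝ, l ≤ r₀ ∧ IsEigenvalue (fun x => 4 + W x) l ∧
      (∀ z ∈ spectrum (schrodinger fun x => 4 + W x), z.im = 0 ∧ l ≤ z.re) ∧
      ∀ u : L2, (u, (l : ℂ) • u) ∈ (schrodingerGraph fun x => 4 + W x) →
        (absL u, (l : ℂ) • absL u) ∈ schrodingerGraph fun x => 4 + W x := by
  have hb : ∃ C, ∀ x, |W x| ≤ C := ⟨C, hC⟩
  have hC0 : 0 ≤ C := (abs_nonneg _).trans (hC 0)
  -- This gives k² > C, so the Neumann series converges and μ = 4 − k² lies strictly below the lower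
  -- bound 4 − C for eigenvalues.
  set k : ℝ := C + 1 with hkdef
  have hk : 0 < k := by linarith
  have hkC : C < k ^ 2 := by nlinarith
  set μ : ℝ := 4 - k ^ 2 with hμ
  have hμc : (μ : ℂ) = 4 - (k : ℂ) ^ 2 := by rw [hμ]; push_cast; rfl
  have hμ4 : μ < 4 - C := by linarith
  have hspec : ∀ z ∈ spectrum (schrodinger fun x => 4 + W x), z.im = 0 ∧ μ < z.re ∧
      (z.re < 4 → IsEigenvalue (fun x => 4 + W x) z) := by
    intro z hz
    by_cases h4 : z ∈ (fun r : ℝ => (r : ℂ)) '' Ici 4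
    · obtain ⟨r, hr, rfl⟩ := h4
      have hr' : 4 ≤ r := hr
      refine ⟨Complex.ofReal_im r, ?_, fun h => ?_⟩
      · simp only [Complex.ofReal_re]; linarith
      · simp only [Complex.ofReal_re] at h; linarith
    · have h : IsEigenvalue (fun x => 4 + W x) z := by
        by_contra h
        exact hz (mem_resolventSet_of_not_isEigenvalue hc hb hW h4 h)
      have him := h.im_eq_zero hc hb
      have hzr : z = (z.re : ℂ) := by apply Complex.ext <;> simp [him]
      rw [hzr] at h
      refine ⟨him, hμ4.trans_le (h.lower_bound hc hC), fun _ => hzr ▸ h⟩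
  have hμr : (μ : ℂ) ∈ resolventSet (schrodinger fun x => 4 + W x) := by
    by_contra h
    have := (hspec _ h).2.1
    simp at this
  obtain ⟨R, hR, hR'⟩ := mem_resolventSet_iff.1 hμr
  have hRu : ∀ (u : L2) (z : ℂ), (u, z • u) ∈ (schrodingerGraph fun x => 4 + W x) →
      (z - μ) • R u = u := by
    intro u z h
    have := hR' _ _ h
    rwa [← sub_smul, map_smul] at this
  have hsa : IsSelfAdjoint R := by
    rw [ContinuousLinearMap.isSelfAdjoint_iff_isSymmetric]
    intro f g
    have h := inner_schrodingerGraph hc hb (hR f) (hR g)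
    rw [inner_add_right, inner_add_left, inner_smul_left, inner_smul_right,
      Complex.conj_ofReal] at h
    exact add_right_cancel h
  obtain ⟨u₀, hu₀, hg₀⟩ := he
  have hnt : Nontrivial L2 := ⟨u₀, 0, hu₀⟩
  -- A self-adjoint R has a spectral point of modulus ‖R‖; `hsr` below identifies it as ‖R‖ itself.
  obtain ⟨s, hs, hsn⟩ := _root_.spectrum.exists_nnnorm_eq_spectralRadius R
  rw [hsa.spectralRadius_eq_nnnorm] at hsn
  have hsn' : ‖s‖ = ‖R‖ := by
    have h : ‖s‖₊ = ‖R‖₊ := by exact_mod_cast hsn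
    exact congrArg NNReal.toReal h
  set t := ‖R‖ with ht
  have hR0 : 0 < t := by
    rw [ht, norm_pos_iff]
    intro h0
    have := hRu u₀ _ hg₀
    rw [h0] at this
    simp at this
    exact hu₀ this.symm
  have hs0 : s ≠ 0 := by
    intro h
    rw [h, norm_zero] at hsn'
    exact hR0.ne hsn'
  -- Spectral mapping: if H had a resolvent R' at μ + 1/s, the resolvent identity would make s⁻¹ (1
  -- + s⁻¹ R') an inverse of s − R.
  have hzs : (μ : ℂ) + s⁻¹ ∈ spectrum (schrodinger fun x => 4 + W x) := by
    intro hz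
    obtain ⟨R', h1, h2⟩ := mem_resolventSet_iff.1 hz
    refine hs ?_
    rw [_root_.spectrum.mem_resolventSet_iff]
    have hcomm : ∀ y, R' y - R y = s⁻¹ • R' (R y) ∧ R' y - R y = s⁻¹ • R (R' y) := by
      intro y
      constructor
      · have h3 := h2 _ _ (hR y)
        have e : y + (μ : ℂ) • R y - ((μ : ℂ) + s⁻¹) • R y = y - s⁻¹ • R y := by module
        rw [e, map_sub, map_smul] at h3
        rw [sub_eq_iff_eq_add, ← sub_eq_iff_eq_add']
        exact h3
      · have h3 := hR' _ _ (h1 y)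
        have e : y + ((μ : ℂ) + s⁻¹) • R' y - (μ : ℂ) • R' y = y + s⁻¹ • R' y := by module
        rw [e, map_add, map_smul] at h3
        rw [sub_eq_iff_eq_add, add_comm]
        exact h3.symm
    set A : L2 →L[ℂ] L2 := algebraMap ℂ (L2 →L[ℂ] L2) s - R with hA
    set B : L2 →L[ℂ] L2 := s⁻¹ • (1 + s⁻¹ • R') with hB
    have hAy : ∀ y, A y = s • y - R y := fun y => by simp [hA, Algebra.algebraMap_eq_smul_one]
    have hBy : ∀ y, B y = s⁻¹ • (y + s⁻¹ • R' y) := fun y => by simp [hB]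
    have hAB : A * B = 1 := by
      ext1 y
      change A (B y) = y
      have h3 := (hcomm y).2
      rw [hAy, hBy, map_smul, map_add, map_smul, ← h3]
      match_scalars <;> field_simp
      all_goals ring
    have hBA : B * A = 1 := by
      ext1 y
      change B (A y) = y
      have h3 := (hcomm y).1
      rw [hBy, hAy, map_sub, map_smul, smul_sub s⁻¹ (s • R' y), ← h3]
      match_scalars <;> field_simp
      all_goals ring
    exact ⟨⟨A, B, hAB, hBA⟩, rfl⟩
  obtain ⟨him, hre, hev⟩ := hspec _ hzs
  -- The spectrum of H is real and lies to the right of μ, so 1/s is real and positive.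
  have hsr : s⁻¹ = ((t⁻¹ : ℝ) : ℂ) := by
    have h1 : s⁻¹.im = 0 := by simpa using him
    have h2 : 0 < s⁻¹.re := by
      rw [Complex.add_re, Complex.ofReal_re] at hre
      linarith
    have h3 : s⁻¹ = ((s⁻¹.re : ℝ) : ℂ) := by
      apply Complex.ext
      · rw [Complex.ofReal_re]
      · rw [Complex.ofReal_im, h1]
    have h4 : ‖s⁻¹‖ = s⁻¹.re := by
      rw [h3, Complex.norm_real, Complex.ofReal_re, Real.norm_of_nonneg h2.le]
    rw [h3, ← h4, norm_inv, hsn']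
  set l : ℝ := μ + t⁻¹ with hl
  have hzl : (μ : ℂ) + s⁻¹ = (l : ℂ) := by rw [hsr, hl]; push_cast; rfl
  rw [hzl] at hev hzs
  -- An eigenvalue r of H gives the eigenvalue 1/(r − μ) of R, which is at most ‖R‖ = t.
  have hlow : ∀ r : ℝ, IsEigenvalue (fun x => 4 + W x) r → l ≤ r := by
    intro r hr
    have hμr : 0 < r - μ := by linarith [hr.lower_bound hc hC]
    obtain ⟨u, hu, hg⟩ := hr
    have h1 := hRu u _ hg
    have h2 : ‖u‖ ≤ (r - μ) * (t * ‖u‖) := by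
      nth_rewrite 1 [← h1]
      rw [norm_smul, ← Complex.ofReal_sub, Complex.norm_real, Real.norm_of_nonneg hμr.le]
      gcongr
      exact R.le_opNorm u
    have h3 : 1 ≤ (r - μ) * t := by
      have := norm_pos_iff.2 hu
      by_contra hlt
      nlinarith
    have h4 : t⁻¹ ≤ r - μ := by
      rw [inv_eq_one_div, div_le_iff₀ hR0]
      exact h3
    linarith
  have hl0 : l ≤ r₀ := hlow r₀ ⟨u₀, hu₀, hg₀⟩
  refine ⟨l, hl0, hev (by rw [Complex.ofReal_re]; linarith), fun z hz => ?_, fun u hu => ?_⟩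
  · obtain ⟨h1, -, h3⟩ := hspec z hz
    refine ⟨h1, ?_⟩
    rcases lt_or_ge z.re 4 with h4 | h4
    · have hzr : z = (z.re : ℂ) := by apply Complex.ext <;> simp [h1]
      exact hlow _ (hzr ▸ h3 h4)
    · linarith
  · have h1 := hRu u _ hu
    have hlμ : (l : ℂ) - μ = (t : ℂ)⁻¹ := by rw [hl]; push_cast; ring
    have htc : (t : ℂ) ≠ 0 := Complex.ofReal_ne_zero.2 hR0.ne'
    rw [hlμ, inv_smul_eq_iff₀ htc] at h1
    have h2 := absL_eigen_of_norm_eq hR0.le rfl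
      (re_inner_resolvent_le hc hb hneg hC hk hkC (hμc ▸ hR)) h1
    have h3 := (schrodingerGraph _).smul_mem ((t : ℂ)⁻¹) (hR (absL u))
    rw [h2, Prod.smul_mk, inv_smul_smul₀ htc] at h3
    convert h3 using 2
    rw [smul_add, smul_comm _ (μ : ℂ), inv_smul_smul₀ htc, ← add_smul, ← hlμ]
    congr 1
    ring

/-- An eigenvector which equals its absolute value is represented by a positive solution. -/
theorem exists_positive_solution {U : ℝ → ℝ} (hU : Continuous U) (hUb : ∃ C, ∀ x, |U x| ≤ C)
    {u : L2} (hu : u ≠ 0) {l : ℝ} (h : (absL u, (l : ℂ) • absL u) ∈ schrodingerGraph U) :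
    ∃ η η₁ : ℝ → ℝ, (∀ᵐ x, ‖u x‖ = η x) ∧ (∀ x, 0 < η x) ∧ (∀ x, HasDerivAt η (η₁ x) x) ∧
      (∀ x, HasDerivAt η₁ ((U x - l) * η x) x) ∧ MemLp η 2 ∧ MemLp η₁ 2 := by
  obtain ⟨F, F₁, huF, hF, hF₁, hL, hL₁⟩ := exists_classical hU h
  have hFc : Continuous F := continuous_iff_continuousAt.2 fun x => (hF x).continuousAt
  have hae : ∀ᵐ x, F x = ((‖u x‖ : ℝ) : ℂ) := by
    filter_upwards [huF, absL_ae u] with x h1 h2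
    rw [← h1, h2]
  have hreal : F = fun x => ((‖F x‖ : ℝ) : ℂ) := by
    refine (Continuous.ae_eq_iff_eq volume hFc (by fun_prop)).1 ?_
    filter_upwards [hae] with x hx
    rw [hx]
    simp
  have hre : ∀ x, (F x).re = ‖F x‖ := fun x => by
    rw [congrFun hreal x]
    simp
  have him : ∀ x, (F x).im = 0 := fun x => by
    rw [congrFun hreal x]
    exact Complex.ofReal_im _
  have hd : ∀ x, HasDerivAt (fun x => (F x).re) (F₁ x).re x := fun x =>
    Complex.reCLM.hasFDerivAt.comp_hasDerivAt x (hF x)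
  have hdi : ∀ x, HasDerivAt (fun x => (F x).im) (F₁ x).im x := fun x =>
    Complex.imCLM.hasFDerivAt.comp_hasDerivAt x (hF x)
  have hd₁ : ∀ x, HasDerivAt (fun x => (F₁ x).re) ((U x - l) * (F x).re) x := fun x => by
    have := Complex.reCLM.hasFDerivAt.comp_hasDerivAt x (hF₁ x)
    refine this.congr_deriv ?_
    simp
  refine ⟨fun x => (F x).re, fun x => (F₁ x).re, ?_, fun c => ?_, hd, hd₁, hL.re, hL₁.re⟩
  · filter_upwards [hae] with x hx
    rw [hx, Complex.ofReal_re]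
  · have hnn : 0 ≤ (F c).re := by rw [hre]; exact norm_nonneg _
    refine hnn.lt_of_ne fun h0 => hu ?_
    -- A zero c of the nonnegative F is a minimum, so F' vanishes there as well, and uniqueness for
    -- the differential equation makes F identically zero.
    have hmin : IsLocalMin (fun x => (F x).re) c := Eventually.of_forall fun y => by
      change (F c).re ≤ (F y).re
      rw [← h0, hre]
      exact norm_nonneg _
    have h1 : (F₁ c).re = 0 := hmin.hasDerivAt_eq_zero (hd c)
    have h2 : (F₁ c).im = 0 := by
      have h3 := hdi c
      simp_rw [him] at h3
      exact h3.unique (hasDerivAt_const c 0)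
    have h3 : F c = 0 := Complex.ext h0.symm (him c)
    have h4 : F₁ c = 0 := Complex.ext h1 h2
    obtain ⟨C, hC⟩ := hUb
    have h5 := eq_zero_of_initial (q := fun x => (U x - l : ℂ)) (K := C + |l|) (fun x => by
      rw [← Complex.ofReal_sub, Complex.norm_real, Real.norm_eq_abs]
      exact (abs_sub _ _).trans (by linarith [hC x])) hF hF₁ h3 h4
    rw [Lp.eq_zero_iff_ae_eq_zero]
    filter_upwards [hae] with x hx
    rw [h5 x] at hx
    simpa using hx.symm

end GroundState

/-! ### The lump -/

theorem memLp_two_of_le_exp {E : Type*} [NormedAddCommGroup E] {f : ℝ → E} {A : ℝ}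
    (hf : AEStronglyMeasurable f) (h : ∀ x, ‖f x‖ ≤ A * Real.exp (-|x|)) : MemLp f 2 := by
  have h1 : Integrable fun x : ℝ => Real.exp (-|x|) := by
    have hk : 0 < (1 : ℂ).re := by simp
    refine ((integrable_kerR hk).norm.add (integrable_kerL hk).norm).congr
      (Eventually.of_forall fun x => ?_)
    simp only [Pi.add_apply, norm_kerR, norm_kerL]
    rcases le_or_gt 0 x with hx | hx
    · simp [hx, not_lt.2 hx, abs_of_nonneg hx]
    · simp [hx, not_le.2 hx, abs_of_neg hx]
  have h2 : MemLp (fun x : ℝ => Real.exp (-|x|)) 2 := by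
    rw [memLp_two_iff_integrable_sq_norm h1.1]
    refine h1.mono (h1.1.norm.pow 2) (Eventually.of_forall fun x => ?_)
    have h3 : Real.exp (-|x|) ≤ 1 := Real.exp_le_one_iff.2 (by simp)
    have h4 := Real.exp_pos (-|x|)
    simp only [norm_pow, Real.norm_of_nonneg h4.le]
    nlinarith
  refine h2.of_le_mul (c := A) hf (Eventually.of_forall fun x => ?_)
  rw [Real.norm_of_nonneg (Real.exp_pos _).le]
  exact h x

section Lump

variable {a : ℝ} (x₀ : ℝ)

theorem tanh_mul_coth (ha : 0 < a) : Real.tanh a * (Real.cosh a / Real.sinh a) = 1 := by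
  have := (Real.sinh_pos_iff.2 ha).ne'
  have := (Real.cosh_pos a).ne'
  rw [Real.tanh_eq_sinh_div_cosh]
  field_simp

theorem tanh_add_coth (ha : 0 < a) : Real.tanh a + Real.cosh a / Real.sinh a
    = 2 * (Real.cosh (2 * a) / Real.sinh (2 * a)) := by
  have := (Real.sinh_pos_iff.2 ha).ne'
  have := (Real.cosh_pos a).ne'
  rw [Real.tanh_eq_sinh_div_cosh, Real.cosh_two_mul, Real.sinh_two_mul]
  field_simp
  ring

/-- The nonzero roots have product 1 and sum 2 coth 2a. In particular V''(0) = 4 for every a, which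
is the threshold of the continuous spectrum. -/
theorem quarticPotential_eq (ha : 0 < a) (u : ℝ) : quarticPotential a u
    = 2 * u ^ 4 - 4 * (Real.cosh (2 * a) / Real.sinh (2 * a)) * u ^ 3 + 2 * u ^ 2 := by
  rw [quarticPotential]
  linear_combination 2 * u ^ 2 * tanh_mul_coth ha - 2 * u ^ 3 * tanh_add_coth ha

theorem hasDerivAt_quarticPotential (ha : 0 < a) (u : ℝ) : HasDerivAt (quarticPotential a)
    (8 * u ^ 3 - 12 * (Real.cosh (2 * a) / Real.sinh (2 * a)) * u ^ 2 + 4 * u) u := by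
  rw [funext (quarticPotential_eq ha)]
  have h := ((((hasDerivAt_id u).pow 4).const_mul 2).sub (((hasDerivAt_id u).pow 3).const_mul
    (4 * (Real.cosh (2 * a) / Real.sinh (2 * a))))).add (((hasDerivAt_id u).pow 2).const_mul 2)
  refine h.congr_deriv ?_
  simp
  ring

theorem deriv_quarticPotential (ha : 0 < a) : deriv (quarticPotential a) = fun u =>
    8 * u ^ 3 - 12 * (Real.cosh (2 * a) / Real.sinh (2 * a)) * u ^ 2 + 4 * u :=
  funext fun u => (hasDerivAt_quarticPotential ha u).deriv

theorem hasDerivAt_deriv_quarticPotential (ha : 0 < a) (u : ℝ) :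
    HasDerivAt (deriv (quarticPotential a))
      (24 * u ^ 2 - 24 * (Real.cosh (2 * a) / Real.sinh (2 * a)) * u + 4) u := by
  rw [deriv_quarticPotential ha]
  have h := ((((hasDerivAt_id u).pow 3).const_mul 8).sub (((hasDerivAt_id u).pow 2).const_mul
    (12 * (Real.cosh (2 * a) / Real.sinh (2 * a))))).add ((hasDerivAt_id u).const_mul 4)
  refine h.congr_deriv ?_
  simp
  ring

variable (a) in
/-- The potential well `V''(φ(x)) - 4`. -/
def lumpWell (x : ℝ) : ℝ :=
  24 * lump a x₀ x ^ 2 - 24 * (Real.cosh (2 * a) / Real.sinh (2 * a)) * lump a x₀ x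

theorem perturbationPotential_lump (ha : 0 < a) :
    perturbationPotential (quarticPotential a) (lump a x₀) = fun x => 4 + lumpWell a x₀ x := by
  ext x
  rw [perturbationPotential, (hasDerivAt_deriv_quarticPotential ha _).deriv, lumpWell]
  ring

theorem lump_denom_pos (x : ℝ) : 0 < Real.cosh (2 * a) + Real.cosh (2 * (x - x₀)) :=
  add_pos (Real.cosh_pos _) (Real.cosh_pos _)

theorem sinh_two_mul_pos (ha : 0 < a) : 0 < Real.sinh (2 * a) :=
  Real.sinh_pos_iff.2 (by linarith)

theorem lump_pos (ha : 0 < a) (x : ℝ) : 0 < lump a x₀ x :=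
  div_pos (sinh_two_mul_pos ha) (lump_denom_pos x₀ x)

theorem contDiff_lump {n : WithTop ℕ∞} : ContDiff ℝ n (lump a x₀) := by
  refine contDiff_const.div ?_ fun x => (lump_denom_pos x₀ x).ne'
  exact contDiff_const.add (Real.contDiff_cosh.comp (by fun_prop))

theorem hasDerivAt_lump (x : ℝ) : HasDerivAt (lump a x₀)
    (-2 * Real.sinh (2 * a) * Real.sinh (2 * (x - x₀))
      / (Real.cosh (2 * a) + Real.cosh (2 * (x - x₀))) ^ 2) x := by
  have h1 : HasDerivAt (fun x : ℝ => 2 * (x - x₀)) 2 x := by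
    simpa using ((hasDerivAt_id x).sub_const x₀).const_mul 2
  have h2 := (hasDerivAt_const x (Real.sinh (2 * a))).div (h1.cosh.const_add (Real.cosh (2 * a)))
    (lump_denom_pos x₀ x).ne'
  refine h2.congr_deriv ?_
  ring

theorem deriv_lump : deriv (lump a x₀) = fun x => -2 * Real.sinh (2 * a)
    * Real.sinh (2 * (x - x₀)) / (Real.cosh (2 * a) + Real.cosh (2 * (x - x₀))) ^ 2 :=
  funext fun x => (hasDerivAt_lump x₀ x).deriv

theorem hasDerivAt_deriv_lump (ha : 0 < a) (x : ℝ) :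
    HasDerivAt (deriv (lump a x₀)) (deriv (quarticPotential a) (lump a x₀ x)) x := by
  have h1 : HasDerivAt (fun x : ℝ => 2 * (x - x₀)) 2 x := by
    simpa using ((hasDerivAt_id x).sub_const x₀).const_mul 2
  have hD := lump_denom_pos (a := a) x₀ x
  have h2 := (h1.sinh.const_mul (-2 * Real.sinh (2 * a))).div
    ((h1.cosh.const_add (Real.cosh (2 * a))).pow 2) (pow_pos hD 2).ne'
  rw [deriv_lump, deriv_quarticPotential ha]
  refine h2.congr_deriv ?_
  have hs := (sinh_two_mul_pos ha).ne'
  have e1 := Real.cosh_sq (2 * a)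
  have e2 := Real.cosh_sq (2 * (x - x₀))
  simp only [lump, Pi.pow_apply]
  set s := Real.sinh (2 * a)
  set c := Real.cosh (2 * a)
  set σ := Real.sinh (2 * (x - x₀))
  set χ := Real.cosh (2 * (x - x₀))
  have hD' : c + χ ≠ 0 := hD.ne'
  field_simp
  have e3 : σ ^ 2 = χ ^ 2 - 1 := by linarith
  have e4 : s ^ 2 = c ^ 2 - 1 := by linarith
  push_cast
  linear_combination 8 * (c + χ) * e3 - 8 * (c + χ) * e4

theorem deriv_lump_eq_zero_iff (ha : 0 < a) (x : ℝ) : deriv (lump a x₀) x = 0 ↔ x = x₀ := by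
  have hs := (sinh_two_mul_pos ha).ne'
  have hD := (lump_denom_pos (a := a) x₀ x).ne'
  rw [deriv_lump]
  simp [hs, hD, sub_eq_zero]

/-- The lump decays at rate 2 around x₀. The weaker rate 1 around the origin is enough, and e^{|x₀|}
pays for moving the centre. -/
theorem lump_le_exp (ha : 0 < a) (x : ℝ) :
    lump a x₀ x ≤ 2 * Real.sinh (2 * a) * Real.exp |x₀| * Real.exp (-|x|) := by
  have hs := sinh_two_mul_pos ha
  have h1 : Real.exp (|x| - |x₀|) / 2 ≤ Real.cosh (2 * a) + Real.cosh (2 * (x - x₀)) := by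
    have h2 : Real.exp |2 * (x - x₀)| / 2 ≤ Real.cosh (2 * (x - x₀)) := by
      rw [← Real.cosh_abs, Real.cosh_eq]
      have := Real.exp_pos (-|2 * (x - x₀)|)
      linarith
    have h3 : |x| - |x₀| ≤ |2 * (x - x₀)| := by
      rw [abs_mul, abs_two]
      linarith [abs_sub_abs_le_abs_sub x x₀, abs_nonneg (x - x₀)]
    have h4 := Real.exp_le_exp.2 h3
    have := Real.cosh_pos (2 * a)
    linarith
  rw [lump, div_le_iff₀ (lump_denom_pos x₀ x)]
  calc Real.sinh (2 * a) = 2 * Real.sinh (2 * a) * Real.exp |x₀| * Real.exp (-|x|)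
        * (Real.exp (|x| - |x₀|) / 2) := by
        have : Real.exp |x₀| * Real.exp (-|x|) * Real.exp (|x| - |x₀|) = 1 := by
          rw [← Real.exp_add, ← Real.exp_add, Real.exp_eq_one_iff]
          ring
        linear_combination -Real.sinh (2 * a) * this
    _ ≤ _ := by gcongr

theorem lump_mul_sinh_le (x : ℝ) : lump a x₀ x * Real.sinh (2 * a)
    ≤ Real.cosh (2 * a) := by
  rw [lump, div_mul_eq_mul_div, div_le_iff₀ (lump_denom_pos x₀ x)]
  have e1 := Real.cosh_sq (2 * a)
  have := mul_pos (Real.cosh_pos (2 * a)) (Real.cosh_pos (2 * (x - x₀)))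
  nlinarith

theorem lump_le_sinh (ha : 0 < a) (x : ℝ) : lump a x₀ x ≤ Real.sinh (2 * a) := by
  refine div_le_self (sinh_two_mul_pos ha).le ?_
  linarith [Real.one_le_cosh (2 * a), Real.cosh_pos (2 * (x - x₀))]

theorem abs_deriv_lump_le (ha : 0 < a) (x : ℝ) : |deriv (lump a x₀) x| ≤ 2 * lump a x₀ x := by
  have hs := sinh_two_mul_pos ha
  have hD := lump_denom_pos (a := a) x₀ x
  have e2 : |Real.sinh (2 * (x - x₀))| ≤ Real.cosh (2 * a) + Real.cosh (2 * (x - x₀)) := by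
    have h1 := Real.sinh_lt_cosh (2 * (x - x₀))
    have h2 := Real.sinh_lt_cosh (-(2 * (x - x₀)))
    rw [Real.sinh_neg, Real.cosh_neg] at h2
    have := Real.cosh_pos (2 * a)
    rw [abs_le]
    constructor <;> linarith
  rw [deriv_lump, lump]
  simp only
  rw [abs_div, abs_mul, abs_mul, abs_of_pos hs, abs_of_pos (pow_pos hD 2), abs_neg, abs_two,
    div_le_iff₀ (pow_pos hD 2)]
  calc 2 * Real.sinh (2 * a) * |Real.sinh (2 * (x - x₀))|
      ≤ 2 * Real.sinh (2 * a) * (Real.cosh (2 * a) + Real.cosh (2 * (x - x₀))) := by gcongr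
    _ = _ := by field_simp

theorem continuous_lumpWell : Continuous (lumpWell a x₀) := by
  have : Continuous (lump a x₀) := (contDiff_lump x₀ (n := 0)).continuous
  unfold lumpWell
  fun_prop

/-- The well is 24 φ (φ − coth 2a) with 0 < φ ≤ coth 2a. Its sign is what makes the resolvent
preserve positivity. -/
theorem lumpWell_nonpos (ha : 0 < a) (x : ℝ) : lumpWell a x₀ x ≤ 0 := by
  have hs := sinh_two_mul_pos ha
  have h1 : lump a x₀ x ≤ Real.cosh (2 * a) / Real.sinh (2 * a) := by
    rw [le_div_iff₀ hs]
    exact lump_mul_sinh_le x₀ x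
  have h2 := lump_pos x₀ ha x
  rw [lumpWell]
  nlinarith

theorem exists_abs_lumpWell_le (ha : 0 < a) :
    ∃ C, ∀ x, |lumpWell a x₀ x| ≤ C * Real.exp (-|x|) := by
  have hs := sinh_two_mul_pos ha
  have hc := Real.cosh_pos (2 * a)
  refine ⟨24 * (Real.cosh (2 * a) / Real.sinh (2 * a)) *
    (2 * Real.sinh (2 * a) * Real.exp |x₀|), fun x => ?_⟩
  rw [abs_of_nonpos (lumpWell_nonpos x₀ ha x), lumpWell, mul_assoc]
  have h1 := mul_le_mul_of_nonneg_left (lump_le_exp x₀ ha x)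
    (show 0 ≤ 24 * (Real.cosh (2 * a) / Real.sinh (2 * a)) by positivity)
  nlinarith [sq_nonneg (lump a x₀ x)]

theorem memLp_deriv_lump (ha : 0 < a) : MemLp (deriv (lump a x₀)) 2 := by
  refine memLp_two_of_le_exp (A := 2 * (2 * Real.sinh (2 * a) * Real.exp |x₀|))
    ((contDiff_lump x₀ (n := 1)).continuous_deriv le_rfl).aestronglyMeasurable fun x => ?_
  rw [Real.norm_eq_abs, mul_assoc]
  linarith [abs_deriv_lump_le x₀ ha x, lump_le_exp x₀ ha x]

/-- This function is φ'', the derivative of the zero mode; it must be in L² for φ' to lie in the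
domain. -/
theorem memLp_deriv_quarticPotential_lump (ha : 0 < a) :
    MemLp (fun x => deriv (quarticPotential a) (lump a x₀ x)) 2 := by
  have hc : Continuous (lump a x₀) := (contDiff_lump x₀ (n := 0)).continuous
  have hs := sinh_two_mul_pos ha
  have hch := Real.cosh_pos (2 * a)
  set B := 2 * Real.sinh (2 * a) * Real.exp |x₀| with hB
  set K := 8 * Real.sinh (2 * a) ^ 2
    + 12 * (Real.cosh (2 * a) / Real.sinh (2 * a)) * Real.sinh (2 * a) + 4 with hK
  have hK0 : 0 ≤ K := by positivity
  refine memLp_two_of_le_exp (A := K * B) ?_ fun x => ?_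
  · rw [deriv_quarticPotential ha]
    exact Continuous.aestronglyMeasurable (by fun_prop)
  · have h0 := lump_pos x₀ ha x
    have h1 := lump_le_sinh x₀ ha x
    rw [deriv_quarticPotential ha, Real.norm_eq_abs]
    simp only
    set φ := lump a x₀ x
    set q := Real.cosh (2 * a) / Real.sinh (2 * a)
    have hq : 0 < q := div_pos hch hs
    have e : 8 * φ ^ 3 - 12 * q * φ ^ 2 + 4 * φ = (8 * φ ^ 2 - 12 * q * φ + 4) * φ := by ring
    rw [e, abs_mul, abs_of_pos h0, mul_assoc K]
    have h2 : φ ^ 2 ≤ Real.sinh (2 * a) ^ 2 := by gcongr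
    have h3 : q * φ ≤ q * Real.sinh (2 * a) := by gcongr
    have h5 : 0 < q * φ := mul_pos hq h0
    have h4 : |8 * φ ^ 2 - 12 * q * φ + 4| ≤ K := by
      rw [abs_le, hK]
      constructor <;> nlinarith [sq_nonneg φ]
    exact mul_le_mul h4 (lump_le_exp x₀ ha x) h0.le hK0

/-- `φ'²/2 = V(φ)` for the lump. -/
theorem half_deriv_lump_sq (ha : 0 < a) (x : ℝ) :
    (1 / 2) * deriv (lump a x₀) x ^ 2 = quarticPotential a (lump a x₀ x) := by
  have hD := (lump_denom_pos (a := a) x₀ x).ne'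
  have hs := (sinh_two_mul_pos ha).ne'
  have e1 := Real.cosh_sq (2 * a)
  have e2 := Real.cosh_sq (2 * (x - x₀))
  rw [quarticPotential_eq ha, deriv_lump, lump]
  simp only
  set s := Real.sinh (2 * a)
  set c := Real.cosh (2 * a)
  set σ := Real.sinh (2 * (x - x₀))
  set χ := Real.cosh (2 * (x - x₀))
  field_simp
  linear_combination 2 * e1 - 2 * e2

theorem isLocalized_lump (ha : 0 < a) : IsLocalized (lump a x₀) 0 := by
  set A := 2 * Real.sinh (2 * a) * Real.exp |x₀| with hA
  have h : ∀ l : Filter ℝ, Tendsto (fun x : ℝ => |x|) l atTop → Tendsto (lump a x₀) l (𝓝 0) := by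
    intro l hl
    refine squeeze_zero (fun x => (lump_pos x₀ ha x).le) (lump_le_exp x₀ ha) ?_
    simpa using (Real.tendsto_exp_neg_atTop_nhds_zero.comp hl).const_mul A
  exact ⟨⟨x₀, (lump_pos x₀ ha x₀).ne'⟩, h _ tendsto_abs_atBot_atTop, h _ tendsto_abs_atTop_atTop⟩

theorem isFalseVacuum_quarticPotential (ha : 0 < a) : IsFalseVacuum (quarticPotential a) 0 := by
  have hs := Real.sinh_pos_iff.2 ha
  have hT : 0 < Real.tanh a := by
    rw [Real.tanh_eq_sinh_div_cosh]
    exact div_pos hs (Real.cosh_pos a)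
  have hT1 : Real.tanh a < 1 := Real.tanh_lt_one a
  have hC : 1 < Real.cosh a / Real.sinh a := by
    rw [lt_div_iff₀ hs, one_mul]
    exact Real.sinh_lt_cosh a
  -- Since tanh a < 1 < coth a, the point 1 lies between the two nonzero roots, where V is negative.
  refine ⟨?_, 1, ?_⟩
  · filter_upwards [Iio_mem_nhds hT] with u hu
    have hu' : u < Real.tanh a := hu
    have h1 : 0 ≤ (Real.tanh a - u) * (Real.cosh a / Real.sinh a - u) :=
      mul_nonneg (by linarith) (by linarith)
    simp only [quarticPotential]
    nlinarith [mul_nonneg (sq_nonneg u) h1]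
  · simp only [quarticPotential]
    nlinarith [mul_pos (sub_pos.2 hT1) (sub_pos.2 hC)]

theorem isStaticSolution_lump (ha : 0 < a) : IsStaticSolution (quarticPotential a) (lump a x₀) :=
  ⟨contDiff_lump x₀, fun x => (hasDerivAt_deriv_lump x₀ ha x).deriv⟩

/-- By `half_deriv_lump_sq` the energy density equals φ'². -/
theorem hasFiniteEnergy_lump (ha : 0 < a) : HasFiniteEnergy (quarticPotential a) (lump a x₀) := by
  have h := memLp_deriv_lump x₀ ha
  refine ((memLp_two_iff_integrable_sq_norm h.1).1 h).congr (Eventually.of_forall fun x => ?_)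
  simp only [← half_deriv_lump_sq x₀ ha, Real.norm_eq_abs, sq_abs]
  ring

/-- The derivative of the lump spans the kernel of the linearization. -/
theorem deriv_lump_mem_graph (ha : 0 < a) :
    ((memLp_deriv_lump x₀ ha).ofReal.toLp (fun x => ((deriv (lump a x₀) x : ℝ) : ℂ)), 0) ∈
      schrodingerGraph fun x => 4 + lumpWell a x₀ x := by
  have hφ : ∀ x, HasDerivAt (lump a x₀) (deriv (lump a x₀) x) x := fun x =>
    (hasDerivAt_lump x₀ x).differentiableAt.hasDerivAt
  -- Differentiating φ'' = V'(φ) gives φ''' = (4 + W) φ', that is, H φ' = 0.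
  have h₁ : ∀ x, HasDerivAt (fun x => deriv (quarticPotential a) (lump a x₀ x))
      ((4 + lumpWell a x₀ x) * deriv (lump a x₀) x) x := fun x => by
    refine ((hasDerivAt_deriv_quarticPotential ha _).comp x (hφ x)).congr_deriv ?_
    rw [lumpWell]
    ring
  have hc : Continuous (lump a x₀) := (contDiff_lump x₀ (n := 0)).continuous
  have hcd : Continuous (deriv (lump a x₀)) :=
    (contDiff_lump x₀ (n := 1)).continuous_deriv le_rfl
  have hcW := continuous_lumpWell (a := a) x₀
  have hF₂ : MemLp (fun x => (((4 + lumpWell a x₀ x) * deriv (lump a x₀) x : ℝ) : ℂ)) 2 := by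
    refine MemLp.ofReal ?_
    obtain ⟨C, hC⟩ := exists_abs_lumpWell_le x₀ ha
    have hC0 : 0 ≤ C := by simpa using (abs_nonneg _).trans (hC 0)
    refine (memLp_deriv_lump x₀ ha).of_le_mul (c := 4 + C)
      (by fun_prop : Continuous fun x =>
        (4 + lumpWell a x₀ x) * deriv (lump a x₀) x).aestronglyMeasurable
      (Eventually.of_forall fun x => ?_)
    refine (norm_mul_le _ _).trans ?_
    gcongr
    refine (norm_add_le _ _).trans ?_
    have h1 : ‖(4 : ℝ)‖ = 4 := by norm_num
    have h2 : Real.exp (-|x|) ≤ 1 := Real.exp_le_one_iff.2 (by simp)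
    have h3 := hC x
    rw [h1, Real.norm_eq_abs]
    nlinarith
  refine mem_graph_of_classical (memLp_deriv_lump x₀ ha).ofReal.coeFn_toLp
    (fun x => (hasDerivAt_deriv_lump x₀ ha x).ofReal_comp) (fun x => (h₁ x).ofReal_comp)
    (by fun_prop) (memLp_deriv_quarticPotential_lump x₀ ha).ofReal hF₂ ?_
  filter_upwards [Lp.coeFn_zero ℂ 2 (volume : Measure ℝ)] with x hx
  rw [hx]
  push_cast
  simp

end Lump

/-! ### The spectrum of the linearization -/

section Spectrum

variable {W : ℝ → ℝ} {C : ℝ}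

theorem abs_le_of_abs_le_exp (hW : ∀ x, |W x| ≤ C * Real.exp (-|x|)) (x : ℝ) : |W x| ≤ C := by
  have hC : 0 ≤ C := by simpa using (abs_nonneg _).trans (hW 0)
  exact (hW x).trans (mul_le_of_le_one_right hC (Real.exp_le_one_iff.2 (by simp)))

/-- Off the half-line a spectral point is an eigenvalue, so injectivity fails. On it there are no
eigenvalues, which gives injectivity and, by symmetry, dense range. -/
theorem continuousSpectrum_eq (hc : Continuous W) (hW : ∀ x, |W x| ≤ C * Real.exp (-|x|)) :
    continuousSpectrum (schrodinger fun x => 4 + W x) = (fun r : ℝ => (r : ℂ)) '' Ici 4 := by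
  have hC := abs_le_of_abs_le_exp hW
  have hC0 : 0 ≤ C := (abs_nonneg _).trans (hC 0)
  have hb : ∃ C, ∀ x, |W x| ≤ C := ⟨C, hC⟩
  have hW2 : MemLp W 2 := memLp_two_of_le_exp hc.aestronglyMeasurable hW
  ext z
  constructor
  · rintro ⟨hz, hinj, -⟩
    by_contra h4
    refine hz (mem_resolventSet_of_not_isEigenvalue hc hb hW2 h4 fun he => ?_)
    exact ker_shift_ne_bot_iff.2 he (LinearMap.ker_eq_bot.2 hinj)
  · rintro ⟨r, hr, rfl⟩
    have hne := not_isEigenvalue_of_four_le hc hW hr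
    -- The point 3 − C is below the lower bound 4 − C for eigenvalues and off the half-line, so it
    -- is a real resolvent point.
    refine ⟨mem_spectrum_of_four_le hc hb hW2 hr, injective_shift_of_not_isEigenvalue hne,
      denseRange_shift hc hb (μ := ((3 - C : ℝ) : ℂ)) (Complex.ofReal_im r) (Complex.ofReal_im _)
        (mem_resolventSet_of_not_isEigenvalue hc hb hW2 ?_ fun he => ?_) hne⟩
    · rintro ⟨s, hs, he⟩
      have hs' : (4 : ℝ) ≤ s := hs
      have : s = 3 - C := Complex.ofReal_injective he
      linarith
    · have := he.lower_bound hc hC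
      linarith

theorem mem_discreteSpectrum (hc : Continuous W) (hW : ∀ x, |W x| ≤ C * Real.exp (-|x|)) {z : ℂ}
    (hz : z ∉ (fun r : ℝ => (r : ℂ)) '' Ici 4) (he : IsEigenvalue (fun x => 4 + W x) z) :
    z ∈ discreteSpectrum (schrodinger fun x => 4 + W x) := by
  have hb : ∃ C, ∀ x, |W x| ≤ C := ⟨C, abs_le_of_abs_le_exp hW⟩
  have hW2 : MemLp W 2 := memLp_two_of_le_exp hc.aestronglyMeasurable hW
  exact ⟨he.mem_spectrum, exists_ball_of_not_mem hc hb hW2 hz, ker_shift_ne_bot_iff.2 he,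
    finiteDimensional_ker_shift hc hb hW2 hz⟩

/-- Points of the half-line fail to be discrete merely because they are not eigenvalues; isolation
matters only off it. -/
theorem essentialSpectrum_eq (hc : Continuous W) (hW : ∀ x, |W x| ≤ C * Real.exp (-|x|)) :
    essentialSpectrum (schrodinger fun x => 4 + W x) = (fun r : ℝ => (r : ℂ)) '' Ici 4 := by
  have hb : ∃ C, ∀ x, |W x| ≤ C := ⟨C, abs_le_of_abs_le_exp hW⟩
  have hW2 : MemLp W 2 := memLp_two_of_le_exp hc.aestronglyMeasurable hW
  ext z
  constructor
  · rintro ⟨hz, hd⟩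
    by_contra h4
    by_cases he : IsEigenvalue (fun x => 4 + W x) z
    · exact hd (mem_discreteSpectrum hc hW h4 he)
    · exact hz (mem_resolventSet_of_not_isEigenvalue hc hb hW2 h4 he)
  · rintro ⟨r, hr, rfl⟩
    refine ⟨mem_spectrum_of_four_le hc hb hW2 hr, fun hd => ?_⟩
    exact not_isEigenvalue_of_four_le hc hW hr (ker_shift_ne_bot_iff.1 hd.2.2.1)

theorem isEigenfunction_of_mem_graph {U : ℝ → ℝ} {u : L2} {μ : ℝ} {η : ℝ → ℝ} (hu : u ≠ 0)
    (hη : ∀ᵐ x, u x = (η x : ℂ)) (h : (u, (μ : ℂ) • u) ∈ schrodingerGraph U) :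
    IsEigenfunction (schrodinger U) μ η := by
  obtain ⟨x, rfl, hx⟩ := exists_domain_of_mem_graph h
  exact ⟨x, hu, hη, hx⟩

theorem toLp_ofReal_ne_zero {η : ℝ → ℝ} (hc : Continuous η) (hη : MemLp η 2) {x : ℝ}
    (hx : η x ≠ 0) : (hη.ofReal.toLp fun x => ((η x : ℝ) : ℂ)) ≠ 0 := by
  intro h
  rw [Lp.eq_zero_iff_ae_eq_zero] at h
  have h1 : (fun x => ((η x : ℝ) : ℂ)) =ᵐ[volume] fun _ => 0 :=
    hη.ofReal.coeFn_toLp.symm.trans h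
  have h2 := (Continuous.ae_eq_iff_eq volume (by fun_prop) continuous_const).1 h1
  exact hx (Complex.ofReal_eq_zero.1 (congrFun h2 x))

/-- Real classical eigenfunctions. -/
theorem isEigenfunction_of_classical {U η η₁ : ℝ → ℝ} (hU : Continuous U)
    (hUb : ∃ C, ∀ x, |U x| ≤ C) {l : ℝ} (hη : ∀ x, HasDerivAt η (η₁ x) x)
    (hη₁ : ∀ x, HasDerivAt η₁ ((U x - l) * η x) x) (h : MemLp η 2) (h₁ : MemLp η₁ 2) {x : ℝ}
    (hx : η x ≠ 0) : IsEigenfunction (schrodinger U) l η := by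
  have hc : Continuous η := continuous_iff_continuousAt.2 fun x => (hη x).continuousAt
  obtain ⟨C, hC⟩ := hUb
  have h₂ : MemLp (fun x => (U x - l) * η x) 2 := by
    refine h.of_le_mul (c := C + |l|)
      (by fun_prop : Continuous fun x => (U x - l) * η x).aestronglyMeasurable
      (Eventually.of_forall fun x => ?_)
    refine (norm_mul_le _ _).trans ?_
    gcongr
    exact (abs_sub _ _).trans (by linarith [hC x])
  have h₀ : MemLp (fun x => ((η x : ℝ) : ℂ)) 2 := h.ofReal
  refine isEigenfunction_of_mem_graph (toLp_ofReal_ne_zero hc h hx) h₀.coeFn_toLp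
    (mem_graph_of_classical h₀.coeFn_toLp (fun x => (hη x).ofReal_comp)
      (fun x => (hη₁ x).ofReal_comp) (by fun_prop) h₁.ofReal h₂.ofReal ?_)
  filter_upwards [h₀.coeFn_toLp, Lp.coeFn_smul (l : ℂ) (h₀.toLp _)] with x h1 h2
  rw [h2, Pi.smul_apply, h1, smul_eq_mul]
  push_cast
  ring

end Spectrum

/-! ### Zero mode, ground state and instability of the lump -/

section LumpSpectrum

variable {a : ℝ} (x₀ : ℝ)

theorem lumpOperator_eq (ha : 0 < a) :
    lumpOperator a x₀ = schrodinger fun x => 4 + lumpWell a x₀ x := by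
  rw [lumpOperator, perturbationPotential_lump x₀ ha]

theorem isEigenfunction_deriv_lump (ha : 0 < a) :
    IsEigenfunction (lumpOperator a x₀) 0 (deriv (lump a x₀)) := by
  rw [lumpOperator_eq x₀ ha]
  refine isEigenfunction_of_mem_graph (toLp_ofReal_ne_zero
    ((contDiff_lump x₀ (n := 1)).continuous_deriv le_rfl) (memLp_deriv_lump x₀ ha)
    (x := x₀ + 1) ?_) (memLp_deriv_lump x₀ ha).ofReal.coeFn_toLp ?_
  · rw [Ne, deriv_lump_eq_zero_iff x₀ ha]
    simp
  · simpa using deriv_lump_mem_graph x₀ ha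

theorem lumpWell_reflect (x : ℝ) : lumpWell a x₀ (2 * x₀ - x) = lumpWell a x₀ x := by
  have : lump a x₀ (2 * x₀ - x) = lump a x₀ x := by
    rw [lump, lump, ← Real.cosh_neg (2 * (x - x₀))]
    congr 3
    ring
  rw [lumpWell, lumpWell, this]

/-- The ground state of the linearization about the lump. -/
theorem exists_lump_ground_state (ha : 0 < a) :
    ∃ (l : ℝ) (η : ℝ → ℝ), l < 0 ∧
      (l : ℂ) ∈ discreteSpectrum (lumpOperator a x₀) ∧
      (∀ z ∈ spectrum (lumpOperator a x₀), z.im = 0 ∧ l ≤ z.re) ∧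
      IsEigenfunction (lumpOperator a x₀) l η ∧ (∀ x, η x ≠ 0) ∧
      (∀ s, η (x₀ - s) = η (x₀ + s)) ∧
      IsGrowingMode (quarticPotential a) (lump a x₀) (Real.sqrt (-l)) η := by
  set W := lumpWell a x₀ with hWdef
  have hc : Continuous W := continuous_lumpWell x₀
  obtain ⟨C, hW⟩ := exists_abs_lumpWell_le x₀ ha
  have hC := abs_le_of_abs_le_exp hW
  have hW2 : MemLp W 2 := memLp_two_of_le_exp hc.aestronglyMeasurable hW
  have hUc : Continuous fun x => 4 + W x := by fun_prop
  have hUb : ∃ C, ∀ x, |4 + W x| ≤ C := ⟨4 + C, fun x => by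
    refine (abs_add_le _ _).trans ?_
    rw [abs_of_pos (by norm_num : (0 : ℝ) < 4)]
    linarith [hC x]⟩
  rw [lumpOperator_eq x₀ ha]
  have hφc : Continuous (deriv (lump a x₀)) :=
    (contDiff_lump x₀ (n := 1)).continuous_deriv le_rfl
  have hφL := memLp_deriv_lump x₀ ha
  have hφL₀ : MemLp (fun x => ((deriv (lump a x₀) x : ℝ) : ℂ)) 2 := hφL.ofReal
  set v : L2 := hφL₀.toLp fun x => ((deriv (lump a x₀) x : ℝ) : ℂ) with hv
  have hv0 : v ≠ 0 := toLp_ofReal_ne_zero hφc hφL (x := x₀ + 1) (by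
    rw [Ne, deriv_lump_eq_zero_iff x₀ ha]
    simp)
  have hvg : (v, ((0 : ℝ) : ℂ) • v) ∈ schrodingerGraph fun x => 4 + W x := by
    simpa using deriv_lump_mem_graph x₀ ha
  obtain ⟨l, hl0, he, hmin, habs⟩ := exists_ground_state hc (lumpWell_nonpos x₀ ha) hC hW2
    (by norm_num : (0 : ℝ) < 4) ⟨v, hv0, hvg⟩
  -- Were 0 the lowest point, |φ'| would be a ground state and so strictly positive, but φ' vanishes
  -- at x₀.
  have hl : l < 0 := by
    refine hl0.lt_of_ne fun h0 => ?_
    rw [h0] at habs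
    obtain ⟨η, η₁, hη, hpos, hd, -⟩ := exists_positive_solution hUc hUb hv0 (habs v hvg)
    have hηc : Continuous η := continuous_iff_continuousAt.2 fun x => (hd x).continuousAt
    have h1 : η = fun x => |deriv (lump a x₀) x| := by
      refine (Continuous.ae_eq_iff_eq volume hηc (by fun_prop)).1 ?_
      filter_upwards [hη, hφL₀.coeFn_toLp] with x h1 h2
      rw [← h1, h2]
      simp
    have h2 := hpos x₀
    rw [h1] at h2
    beta_reduce at h2
    rw [(deriv_lump_eq_zero_iff x₀ ha x₀).2 rfl, abs_zero] at h2
    exact lt_irrefl _ h2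
  have hl4 : (l : ℂ) ∉ (fun r : ℝ => (r : ℂ)) '' Ici 4 := by
    rintro ⟨s, hs, he⟩
    have hs' : (4 : ℝ) ≤ s := hs
    have : s = l := Complex.ofReal_injective he
    linarith
  obtain ⟨u, hu0, hug⟩ := he
  obtain ⟨η, η₁, -, hpos, hd, hd₁, hL, hL₁⟩ := exists_positive_solution hUc hUb hu0 (habs u hug)
  -- The sum of η and its reflection about x₀ solves the same equation, since W is symmetric about
  -- x₀. It is even and, as a sum of positive functions, has no zeros, so simplicity of the
  -- eigenvalue is not needed.
  have hr : ∀ x, HasDerivAt (fun x : ℝ => 2 * x₀ - x) (-1) x := fun x => by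
    simpa using (hasDerivAt_id x).const_sub (2 * x₀)
  have hmp := Measure.measurePreserving_sub_left (volume : Measure ℝ) (2 * x₀)
  have hs : ∀ x, HasDerivAt (fun x => η x + η (2 * x₀ - x)) (η₁ x - η₁ (2 * x₀ - x)) x :=
    fun x => by
      refine ((hd x).add ((hd _).comp x (hr x))).congr_deriv ?_
      ring
  have hs₁ : ∀ x, HasDerivAt (fun x => η₁ x - η₁ (2 * x₀ - x))
      ((4 + W x - l) * (η x + η (2 * x₀ - x))) x := fun x => by
    refine ((hd₁ x).sub ((hd₁ _).comp x (hr x))).congr_deriv ?_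
    rw [hWdef, lumpWell_reflect]
    ring
  have hsL : MemLp (fun x => η x + η (2 * x₀ - x)) 2 := hL.add (hL.comp_measurePreserving hmp)
  have hsL₁ : MemLp (fun x => η₁ x - η₁ (2 * x₀ - x)) 2 :=
    hL₁.sub (hL₁.comp_measurePreserving hmp)
  have hspos : ∀ x, 0 < η x + η (2 * x₀ - x) := fun x => add_pos (hpos _) (hpos _)
  have hsd : deriv (fun x => η x + η (2 * x₀ - x)) = fun x => η₁ x - η₁ (2 * x₀ - x) :=
    funext fun x => (hs x).deriv
  have hsc : Continuous fun x => η x + η (2 * x₀ - x) :=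
    continuous_iff_continuousAt.2 fun x => (hs x).continuousAt
  have hsC : ContDiff ℝ 2 fun x => η x + η (2 * x₀ - x) := by
    rw [show (2 : WithTop ℕ∞) = 1 + 1 from rfl, contDiff_succ_iff_deriv]
    refine ⟨fun x => (hs x).differentiableAt, by simp, ?_⟩
    rw [hsd, contDiff_one_iff_deriv]
    refine ⟨fun x => (hs₁ x).differentiableAt, ?_⟩
    rw [funext fun x => (hs₁ x).deriv]
    fun_prop
  refine ⟨l, fun x => η x + η (2 * x₀ - x), hl, mem_discreteSpectrum hc hW hl4 ⟨u, hu0, hug⟩,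
    hmin, isEigenfunction_of_classical hUc hUb hs hs₁ hsL hsL₁ (hspos 0).ne',
    fun x => (hspos x).ne', fun s => ?_, Real.sqrt_pos.2 (by linarith),
    fun h => (hspos 0).ne' (congrFun h 0), hsC, hsL, hsd ▸ hsL₁, fun t x => ?_⟩
  · change η (x₀ - s) + η (2 * x₀ - (x₀ - s)) = η (x₀ + s) + η (2 * x₀ - (x₀ + s))
    rw [show 2 * x₀ - (x₀ - s) = x₀ + s by ring, show 2 * x₀ - (x₀ + s) = x₀ - s by ring, add_comm]
  · set κ := Real.sqrt (-l) with hκ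
    -- This balances the equation: w_tt = κ² w, while −w_xx + U w = l w.
    have hκ2 : κ * κ = -l := Real.mul_self_sqrt (by linarith)
    have hE : ∀ (c s : ℝ), HasDerivAt (fun s => Real.exp (κ * s) * c)
        (Real.exp (κ * s) * (κ * c)) s := fun c s => by
      refine ((((hasDerivAt_id s).const_mul κ).exp).mul_const c).congr_deriv ?_
      simp
      ring
    beta_reduce
    rw [funext fun s => (hE (η x + η (2 * x₀ - x)) s).deriv,
      (hE (κ * (η x + η (2 * x₀ - x))) t).deriv,
      funext fun y => ((hs y).const_mul (Real.exp (κ * t))).deriv,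
      ((hs₁ x).const_mul (Real.exp (κ * t))).deriv, perturbationPotential_lump x₀ ha]
    linear_combination Real.exp (κ * t) * (η x + η (2 * x₀ - x)) * hκ2

theorem isSphaleron_lump (ha : 0 < a) : IsSphaleron (quarticPotential a) (lump a x₀) 0 where
  static := isStaticSolution_lump x₀ ha
  falseVacuum := isFalseVacuum_quarticPotential ha
  localized := isLocalized_lump x₀ ha
  finiteEnergy := hasFiniteEnergy_lump x₀ ha
  unstable := by
    obtain ⟨l, η, -, -, -, -, -, -, h⟩ := exists_lump_ground_state x₀ ha
    exact ⟨_, η, h⟩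

end LumpSpectrum

end Sphaleron

end

theorem mainTheorem3 (a x₀ : ℝ) (ha : 0 < a) :
    -- the continuous spectrum and the essential spectrum are `[4, ∞)`
    Sphaleron.continuousSpectrum (Sphaleron.lumpOperator a x₀)
        = (fun r : ℝ => (r : ℂ)) '' Set.Ici 4 ∧
    Sphaleron.essentialSpectrum (Sphaleron.lumpOperator a x₀)
        = (fun r : ℝ => (r : ℂ)) '' Set.Ici 4 ∧
    -- the derivative of the lump is a zero mode with exactly one node
    Sphaleron.IsEigenfunction (Sphaleron.lumpOperator a x₀) 0
        (deriv (Sphaleron.lump a x₀)) ∧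
    {x : ℝ | deriv (Sphaleron.lump a x₀) x = 0} = {x₀} ∧
    -- the lowest point of the spectrum is a negative eigenvalue in the discrete spectrum, with a
    -- nodeless even eigenfunction, which gives a growing mode of the linearized equation
    (∃ (l : ℝ) (η : ℝ → ℝ), l < 0 ∧
      (l : ℂ) ∈ Sphaleron.discreteSpectrum (Sphaleron.lumpOperator a x₀) ∧
      (∀ z ∈ Sphaleron.spectrum (Sphaleron.lumpOperator a x₀), z.im = 0 ∧ l ≤ z.re) ∧
      Sphaleron.IsEigenfunction (Sphaleron.lumpOperator a x₀) l η ∧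
      (∀ x, η x ≠ 0) ∧
      (∀ s, η (x₀ - s) = η (x₀ + s)) ∧
      Sphaleron.IsGrowingMode (Sphaleron.quarticPotential a) (Sphaleron.lump a x₀)
        (Real.sqrt (-l)) η) ∧
    -- the lump is a sphaleron, in particular linearly unstable
    Sphaleron.IsSphaleron (Sphaleron.quarticPotential a) (Sphaleron.lump a x₀) 0 := by
  obtain ⟨C, hW⟩ := Sphaleron.exists_abs_lumpWell_le x₀ ha
  have hc := Sphaleron.continuous_lumpWell (a := a) x₀
  refine ⟨?_, ?_, Sphaleron.isEigenfunction_deriv_lump x₀ ha, ?_,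
    Sphaleron.exists_lump_ground_state x₀ ha, Sphaleron.isSphaleron_lump x₀ ha⟩
  · rw [Sphaleron.lumpOperator_eq x₀ ha]
    exact Sphaleron.continuousSpectrum_eq hc hW
  · rw [Sphaleron.lumpOperator_eq x₀ ha]
    exact Sphaleron.essentialSpectrum_eq hc hW
  · ext x
    exact Sphaleron.deriv_lump_eq_zero_iff x₀ ha x
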